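/- **Proposition 6.4.** Let $g(x)=-\log|x|$ on $\mathbb R^2$ and $c_d=2\pi$, so that $-\Delta g=c_d\,\delta_0$ in the sense of distributions. For a vector field $X$ put $[X,X]_{ij}=2X_iX_j-|X|^2\delta_{ij}$; write $(D\varphi)_{ij}=\partial_j\varphi_i$, $A:B=\operatorname{tr}(A^TB)$, and let $\operatorname{div}$ act on matrix fields row by row. Let $\mu$ be a finite signed Radon measure on $\mathbb R^2$ with $\mu\in H^{-1}_{\rm loc}(\mathbb R^2)$, i.e. $\chi\mu\in H^{-1}(\mathbb R^2)$ for every $\chi\in C_c^\infty(\mathbb R^2)$. (i) The convolution $\nabla g*\mu$ is defined by an absolutely convergent integral almost everywhere, it belongs to $L^2_{\rm loc}(\mathbb R^2;\mathbb R^2)$, and for every $\varphi\in C_c^\infty(\mathbb R^2;\mathbb R^2)$ $$\iint_{\mathbb R^2\times\mathbb R^2}\nabla g(x-y)\cdot(\varphi(x)-\varphi(y))\,d\mu(x)\,d\mu(y)=\frac1{c_d}\int_{\mathbb R^2}D\varphi(x):[\nabla g*\mu,\nabla g*\mu](x)\,dx,$$ both integrals being absolutely convergent (the integrand on the left is taken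 to be $0$ for $x=y$). (ii) Let $F,V\in C^1(\mathbb R^2)$ with $F$ even, and assume that $(x,y)\mapsto\nabla F(x-y)\cdot(\varphi(x)-\varphi(y))$ is $|\mu|\otimes|\mu|$-integrable for every $\varphi\in C_c^\infty(\mathbb R^2;\mathbb R^2)$, so that $$\langle(\nabla F)_\mu,\varphi\rangle:=\tfrac12\iint\nabla F(x-y)\cdot(\varphi(x)-\varphi(y))\,d\mu(x)\,d\mu(y)$$ is well defined. Then the following two conditions are equivalent. * *Velocity formulation*: there is $R\in L^p_{\rm loc}(\mathbb R^2;\mathbb R^{2\times2})$, for some $1\le p<2$, with $\operatorname{div}R=-2c_d\big((\nabla F)_\mu+\mu\nabla V\big)$ in $\mathcal D'(\mathbb R^2;\mathbb R^2)$, such that every row of $[\nabla g*\mu,\nabla g*\mu]+R$ is divergence-free in finite part, $\nabla g*\mu\in L^2_{\rm loc}(\mathbb R^2;\mathbb R^2)$, and $\operatorname{div}\big([\nabla g*\mu,\nabla g*\mu]+R\big)=0$ in $\mathcal D'(\mathbb R^2;\mathbb R^2)$. * *Vorticity formulation*: for every $\varphi\in C_c^\infty(\mathbb R^2;\mathbb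 R^2)$ $$\frac12\iint_{\{x\ne y\}}\big(\nabla g(x-y)+\nabla F(x-y)\big)\cdot(\varphi(x)-\varphi(y))\,d\mu(x)\,d\mu(y)+\int_{\mathbb R^2}\nabla V\cdot\varphi\,d\mu=0.$$ Here a measurable vector field $X$ on $\mathbb R^2$ is *divergence-free in finite part* if there are measurable sets $(E_\delta)_{\delta>0}$ such that $\mathcal H^1_\infty(K\cap E_\delta)\to0$ as $\delta\to0$ for every compact $K$, $X\in L^1(\mathbb R^2\setminus E_\delta)$ for every $\delta>0$, and $\int_{\mathbb R^2\setminus\zeta^{-1}(\zeta(E_\delta))}X\cdot\nabla\zeta\,dx=0$ for every $\delta>0$ and every $\zeta\in C_c^\infty(\mathbb R^2)$, where $\mathcal H^1_\infty(S)$ is the infimum of $\sum_j r_j$ over the countable covers of $S$ by balls of radii $r_j$. -/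

import Mathlib

open MeasureTheory Filter Topology
open scoped ENNReal NNReal ContDiff RealInnerProductSpace

noncomputable section

namespace Coulomb2D

/-- The Euclidean plane. -/
abbrev Plane : Type := EuclideanSpace ℝ (Fin 2)

/-- Smooth compactly supported functions on the plane. -/
def IsTest {W : Type*} [NormedAddCommGroup W] [NormedSpace ℝ W] (f : Plane → W) : Prop :=
  ContDiff ℝ ∞ f ∧ HasCompactSupport f

/-- The two-dimensional Coulomb potential `g(x) = -log |x|`. -/
def g (x : Plane) : ℝ := -Real.log ‖x‖

/-- The constant `c_d` for `d = 2`. -/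
def cd : ℝ := 2 * Real.pi

/-- `∇g`; it takes the value `0` at the origin, where `g` is not differentiable. -/
def gradG (x : Plane) : Plane := gradient g x

/-- The vector field `∇g ∗ μ`. -/
def gradGConv (μ : SignedMeasure Plane) (x : Plane) : Plane :=
  ∫ᵛ y, gradG (x - y) ∂<•μ

/-- The signed product measure `μ ⊗ μ`. -/
def tensorSq (μ : SignedMeasure Plane) : SignedMeasure (Plane × Plane) :=
  μ.prod μ (ContinuousLinearMap.lsmul ℝ ℝ)

/-- A finite signed measure seen as a tempered distribution. -/
def toTempered (μ : SignedMeasure Plane) : TemperedDistribution Plane ℂ :=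
  μ.toJordanDecomposition.posPart.toTemperedDistribution -
    μ.toJordanDecomposition.negPart.toTemperedDistribution

/-- `μ ∈ H^{-1}_loc(ℝ²)`: every localization `χ μ`, with `χ` a test function, is in
`H^{-1}(ℝ²)`, i.e. in the `L²`-based Sobolev space of order `-1`. -/
def MemHNegOneLoc (μ : SignedMeasure Plane) : Prop :=
  ∀ χ : Plane → ℝ, IsTest χ →
    TemperedDistribution.MemSobolev (-1) 2
      (TemperedDistribution.smulLeftCLM ℂ (fun x => (χ x : ℂ)) (toTempered μ))

/-- `X ∈ L^p_loc(ℝ²; W)`. -/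
def MemLpLoc {W : Type*} [NormedAddCommGroup W] (X : Plane → W) (p : ℝ≥0∞) : Prop :=
  ∀ K : Set Plane, IsCompact K → MemLp X p (volume.restrict K)

/-- The tensor `[X, X]_{ij} = 2 X_i X_j - |X|² δ_{ij}`. -/
def stress (X : Plane → Plane) (x : Plane) : Matrix (Fin 2) (Fin 2) ℝ :=
  fun i j => 2 * X x i * X x j - ‖X x‖ ^ 2 * (if i = j then 1 else 0)

/-- The Jacobian matrix `(Dφ)_{ij} = ∂_j φ_i`. -/
def jac (φ : Plane → Plane) (x : Plane) : Matrix (Fin 2) (Fin 2) ℝ :=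
  fun i j => (fderiv ℝ φ x (EuclideanSpace.single j 1)) i

/-- The Frobenius product `A : B = tr (Aᵀ B)`. -/
def frob (A B : Matrix (Fin 2) (Fin 2) ℝ) : ℝ := (A.transpose * B).trace

/-- `div A = T` in `𝓓'(ℝ²; ℝ²)`, the divergence being taken row by row. -/
def HasDiv (A : Plane → Matrix (Fin 2) (Fin 2) ℝ) (T : (Plane → Plane) → ℝ) : Prop :=
  ∀ φ : Plane → Plane, IsTest φ → -∫ x, frob (jac φ x) (A x) = T φ

/-- The `i`-th row of a matrix field. -/
def row (A : Plane → Matrix (Fin 2) (Fin 2) ℝ) (i : Fin 2) (x : Plane) : Plane :=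
  WithLp.toLp 2 (fun j => A x i j)

/-- The one-dimensional Hausdorff content: the infimum of `∑ r_j` over the countable covers by
balls of radii `r_j`. -/
def content (S : Set Plane) : ℝ≥0∞ :=
  ⨅ (x : ℕ → Plane) (r : ℕ → ℝ≥0) (_ : S ⊆ ⋃ j, Metric.ball (x j) (r j)), ∑' j, (r j : ℝ≥0∞)

/-- Vector fields that are divergence-free in finite part. -/
def DivFreeFinitePart (X : Plane → Plane) : Prop :=
  AEStronglyMeasurable X volume ∧
  ∃ S : ℝ → Set Plane,
    (∀ δ, 0 < δ → MeasurableSet (S δ)) ∧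
    (∀ K : Set Plane, IsCompact K →
      Tendsto (fun δ => content (K ∩ S δ)) (𝓝[>] 0) (𝓝 0)) ∧
    (∀ δ, 0 < δ → IntegrableOn X (S δ)ᶜ volume) ∧
    (∀ δ, 0 < δ → ∀ ζ : Plane → ℝ, IsTest ζ →
      ∫ x in (ζ ⁻¹' (ζ '' S δ))ᶜ, ⟪X x, gradient ζ x⟫ = 0)

/-- The symmetrized kernel `∇h(x - y) · (φ(x) - φ(y))`, where `Y` stands for `∇h`. -/
def symKernel (Y : Plane → Plane) (φ : Plane → Plane) (z : Plane × Plane) : ℝ :=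
  ⟪Y (z.1 - z.2), φ z.1 - φ z.2⟫

/-- The integral defining `(∇F)_μ` is absolutely convergent against every test field. -/
def ForceDefined (F : Plane → ℝ) (μ : SignedMeasure Plane) : Prop :=
  ∀ φ : Plane → Plane, IsTest φ → (tensorSq μ).Integrable (symKernel (gradient F) φ)

/-- `⟨(∇F)_μ, φ⟩ = ½ ∬ ∇F(x - y) · (φ(x) - φ(y)) dμ(x) dμ(y)`. -/
def force (F : Plane → ℝ) (μ : SignedMeasure Plane) (φ : Plane → Plane) : ℝ :=
  (1 / 2) * ∫ᵛ z, symKernel (gradient F) φ z ∂•(tensorSq μ)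

/-- `⟨μ ∇V, φ⟩ = ∫ ∇V · φ dμ`. -/
def potentialForce (V : Plane → ℝ) (μ : SignedMeasure Plane) (φ : Plane → Plane) : ℝ :=
  ∫ᵛ x, ⟪gradient V x, φ x⟫ ∂•μ

/-- `R ∈ L^p_loc` for some `1 ≤ p < 2`, and `div R = -2 c_d ((∇F)_μ + μ ∇V)`. The minus sign goes
with `-Δg = c_d δ_0`, for which formally `div [∇g ∗ μ, ∇g ∗ μ] = -2 c_d μ (∇g ∗ μ)`. -/
def IsRemainder (F V : Plane → ℝ) (μ : SignedMeasure Plane)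
    (R : Plane → Matrix (Fin 2) (Fin 2) ℝ) : Prop :=
  (∃ p : ℝ≥0∞, 1 ≤ p ∧ p < 2 ∧ ∀ i j, MemLpLoc (fun x => R x i j) p) ∧
  HasDiv R (fun φ => -2 * cd * (force F μ φ + potentialForce V μ φ))

/-- Criticality in the velocity formulation. -/
def VelocityCritical (F V : Plane → ℝ) (μ : SignedMeasure Plane) : Prop :=
  ∃ R : Plane → Matrix (Fin 2) (Fin 2) ℝ,
    IsRemainder F V μ R ∧
    (∀ i, DivFreeFinitePart (row (fun x => stress (gradGConv μ) x + R x) i)) ∧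
    MemLpLoc (gradGConv μ) 2 ∧
    HasDiv (fun x => stress (gradGConv μ) x + R x) (fun _ => 0)

/-- Criticality in the vorticity formulation. -/
def VorticityCritical (F V : Plane → ℝ) (μ : SignedMeasure Plane) : Prop :=
  ∀ φ : Plane → Plane, IsTest φ →
    (1 / 2) * (∫ᵛ z in (Set.diagonal Plane)ᶜ,
        symKernel (fun x => gradG x + gradient F x) φ z ∂•(tensorSq μ)) +
      ∫ᵛ x, ⟪gradient V x, φ x⟫ ∂•μ = 0

end Coulomb2D

end

noncomputable section

namespace Coulomb2D

/-! Write `μ = σ ν` with `ν = |μ|` and `σ = ±1`, and let `X = ∇g ∗ μ`. Since `|∇g(x)| = |x|⁻¹` is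
uniformly locally integrable under translations, Tonelli gives absolute convergence of `X` almost
everywhere, and in the sense of distributions `X` is curl-free with `div X = -c_d μ`. For a smooth
curl-free field, `div [X, X] = 2 X div X`. Testing with `φ` and symmetrizing by the oddness of `∇g`
gives the identity of part (i) formally; three facts make it rigorous.

First, `X` is in `L²_loc` by duality (`MemHNegOneLoc.memLp_field_coord`). For `ψ` supported in a
ball, `∫ ψ X_j = -∫ w dμ` with `w = ∂_j g ∗ ψ`, and `Δw = -c_d ∂_j ψ`. A Caccioppoli estimate
(`exists_energy_le`) bounds `χ w` in `H¹` by the `L²` norm of `ψ`, so `χ μ ∈ H⁻¹` controls the part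
near the ball; elsewhere `w` is bounded and `μ` is finite. An `L²`-bounded functional on test
functions comes from an `L²` function (`memLp_two_of_forall_test`).

Second, `μ` has no atoms (`MemHNegOneLoc.measure_singleton`): in the plane the Dirichlet energy of a
bump concentrating at a point does not change with the scale, while the `L²` norm of `X` on
shrinking balls tends to zero. Hence the diagonal is null for `ν ⊗ ν`.

Third, the identity is exact for the mollified field and measure (`integral_frob_mollField`). The
tensor side converges because mollifications converge in `L²_loc`. The double integral converges by
dominated convergence (`tendsto_smearedPairing`), because the symmetrized kernel is bounded and
continuous off the null diagonal.

For part (ii), once `div R` is prescribed, the divergence equation for `[X, X] + R` is `-2 c_d`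
times the vorticity equation (`MemHNegOneLoc.hasDiv_stress_add_iff`). The converse also needs some
`R`. As `F` is even, the force is `β ν` with `β` locally `ν`-integrable, but perhaps of infinite
total mass, so `∇g ∗ (β ν)` may diverge. Truncating `∇g(x - y)` to the half-plane `y · (x - y) > 0`
still gives a multiple of `δ_y` as divergence, and makes the kernel vanish when `|x| < |y|`; only
finite mass then acts on each ball (`integrable_halfKernel_prod`), and `R` is in `L¹_loc`. Finally,
a locally integrable field with zero distributional divergence is divergence-free in finite part
(`divFreeFinitePart_of_integral_eq_zero`): take complements of large balls as exceptional sets and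
test with `Φ ∘ ζ`. -/

/-! ### Coordinates, partial derivatives and integration by parts. -/

/-- The `j`-th partial derivative. -/
def pd (j : Fin 2) (f : Plane → ℝ) (x : Plane) : ℝ := fderiv ℝ f x (EuclideanSpace.single j 1)

lemma plane_eq_sum (x : Plane) :
    x = x 0 • EuclideanSpace.single 0 (1 : ℝ) + x 1 • EuclideanSpace.single 1 (1 : ℝ) := by
  ext i; fin_cases i <;> simp

lemma fderiv_apply_eq_pd (f : Plane → ℝ) (x v : Plane) :
    fderiv ℝ f x v = v 0 * pd 0 f x + v 1 * pd 1 f x := by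
  conv_lhs => rw [plane_eq_sum v]
  simp [pd]

lemma inner_eq_coord (x y : Plane) : ⟪x, y⟫ = x 0 * y 0 + x 1 * y 1 := by
  simp [PiLp.inner_apply, Fin.sum_univ_two, mul_comm]

lemma norm_sq_eq_coord (x : Plane) : ‖x‖ ^ 2 = x 0 ^ 2 + x 1 ^ 2 := by
  simp [EuclideanSpace.norm_sq_eq, Fin.sum_univ_two]

lemma abs_coord_le (x : Plane) (i : Fin 2) : |x i| ≤ ‖x‖ := by
  simpa using PiLp.norm_apply_le x i

lemma gradient_coord (f : Plane → ℝ) (x : Plane) (j : Fin 2) : gradient f x j = pd j f x := by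
  have h : ⟪gradient f x, EuclideanSpace.single j (1 : ℝ)⟫ = pd j f x := by
    simp [gradient, pd]
  rw [← h, EuclideanSpace.inner_single_right]; simp

lemma contDiff_pd {f : Plane → ℝ} {n m : WithTop ℕ∞} (hf : ContDiff ℝ n f) (h : m + 1 ≤ n)
    (j : Fin 2) : ContDiff ℝ m (pd j f) :=
  (hf.fderiv_right h).clm_apply contDiff_const

lemma continuous_pd {f : Plane → ℝ} (hf : ContDiff ℝ 1 f) (j : Fin 2) : Continuous (pd j f) :=
  (contDiff_pd (m := 0) hf (by simp) j).continuous

lemma hasCompactSupport_pd {f : Plane → ℝ} (hf : HasCompactSupport f) (j : Fin 2) :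
    HasCompactSupport (pd j f) :=
  hf.fderiv_apply (𝕜 := ℝ) _

lemma IsTest.pderiv {f : Plane → ℝ} (hf : IsTest f) (j : Fin 2) : IsTest (pd j f) :=
  ⟨contDiff_pd hf.1 (by simp) j, hasCompactSupport_pd hf.2 j⟩

lemma tsupport_pd_subset (f : Plane → ℝ) (j : Fin 2) : tsupport (pd j f) ⊆ tsupport f :=
  tsupport_fderiv_apply_subset ℝ _

lemma pd_mul {f h : Plane → ℝ} {x : Plane} (hf : DifferentiableAt ℝ f x)
    (hh : DifferentiableAt ℝ h x) (j : Fin 2) :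
    pd j (fun x => f x * h x) x = pd j f x * h x + f x * pd j h x := by
  simp only [pd]
  rw [fderiv_fun_mul hf hh]
  simp; ring

lemma pd_comm {f : Plane → ℝ} (hf : ContDiff ℝ 2 f) (i j : Fin 2) (x : Plane) :
    pd i (pd j f) x = pd j (pd i f) x := by
  have hd : DifferentiableAt ℝ (fderiv ℝ f) x :=
    ((hf.fderiv_right (m := 1) (by norm_num)).differentiable (by norm_num)) x
  have hs : IsSymmSndFDerivAt ℝ f x := by
    apply (hf.contDiffAt).isSymmSndFDerivAt
    simp
  have key : ∀ a b : Fin 2, pd a (pd b f) x =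
      fderiv ℝ (fderiv ℝ f) x (EuclideanSpace.single a 1) (EuclideanSpace.single b 1) := by
    intro a b
    unfold pd
    rw [fderiv_clm_apply hd (by fun_prop)]
    simp
  rw [key, key]
  exact hs.eq _ _

lemma laplacian_eq_pd {f : Plane → ℝ} (hf : ContDiff ℝ 2 f) (x : Plane) :
    Laplacian.laplacian f x = pd 0 (pd 0 f) x + pd 1 (pd 1 f) x := by
  have hd : DifferentiableAt ℝ (fderiv ℝ f) x :=
    ((hf.fderiv_right (m := 1) (by norm_num)).differentiable (by norm_num)) x
  rw [InnerProductSpace.laplacian_eq_iteratedFDeriv_orthonormalBasis f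
    (EuclideanSpace.basisFun (Fin 2) ℝ)]
  simp only [Fin.sum_univ_two, EuclideanSpace.basisFun_apply]
  have key : ∀ a : Fin 2, pd a (pd a f) x =
      iteratedFDeriv ℝ 2 f x ![EuclideanSpace.single a 1, EuclideanSpace.single a 1] := by
    intro a
    unfold pd
    rw [fderiv_clm_apply hd (by fun_prop), iteratedFDeriv_two_apply]
    simp
  rw [key, key]

/-- Integration by parts against a compactly supported function. -/
lemma integral_mul_pd {f h : Plane → ℝ} (hf : ContDiff ℝ 1 f) (hh : ContDiff ℝ 1 h)
    (hc : HasCompactSupport h) (j : Fin 2) :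
    ∫ x, f x * pd j h x = -∫ x, pd j f x * h x := by
  apply integral_mul_fderiv_eq_neg_fderiv_mul_of_integrable
  · exact ((continuous_pd hf j).mul hh.continuous).integrable_of_hasCompactSupport hc.mul_left
  · exact (hf.continuous.mul (continuous_pd hh j)).integrable_of_hasCompactSupport
      (hasCompactSupport_pd hc j).mul_left
  · exact (hf.continuous.mul hh.continuous).integrable_of_hasCompactSupport hc.mul_left
  · exact fun x _ => (hf.differentiable (by norm_num)) x
  · exact fun x _ => (hh.differentiable (by norm_num)) x

lemma integral_pd_eq_zero {h : Plane → ℝ} (hh : ContDiff ℝ 1 h) (hc : HasCompactSupport h)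
    (j : Fin 2) : ∫ x, pd j h x = 0 := by
  have h0 : ∀ x, pd j (fun _ : Plane => (1 : ℝ)) x = 0 := by intro x; simp [pd]
  simpa [h0] using integral_mul_pd (f := fun _ => (1 : ℝ)) contDiff_const hh hc j

/-! ### The Coulomb kernel: formula, size and local integrability. -/

lemma gradG_eq (x : Plane) : gradG x = -(‖x‖ ^ 2)⁻¹ • x := by
  rcases eq_or_ne x 0 with rfl | hx
  -- At the origin `g` blows up, so `gradient` takes its default value `0`; this agrees with the
  -- formula since `0⁻¹ = 0`.
  · have : ¬ DifferentiableAt ℝ g (0 : Plane) := by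
      intro h
      have hc := h.continuousAt
      have ht : Tendsto (fun x : Plane => ‖x‖) (𝓝[≠] 0) (𝓝[>] 0) := tendsto_norm_nhdsNE_zero
      have h1 : Tendsto g (𝓝[≠] (0 : Plane)) atTop :=
        tendsto_neg_atBot_atTop.comp (Real.tendsto_log_nhdsGT_zero.comp ht)
      exact not_tendsto_nhds_of_tendsto_atTop h1 _ (hc.tendsto.mono_left nhdsWithin_le_nhds)
    simp [gradG, gradient, fderiv_zero_of_not_differentiableAt this]
  · have hg : ∀ y : Plane, g y = -((1 / 2) * Real.log (‖y‖ ^ 2)) := by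
      intro y; simp [g]
    have hn : ‖x‖ ^ 2 ≠ 0 := by positivity
    have h1 : HasFDerivAt g (-((1 / 2 : ℝ) • ((‖x‖ ^ 2)⁻¹ • (2 • (innerSL ℝ x))))) x := by
      rw [show g = fun y : Plane => -((1 / 2) * Real.log (‖y‖ ^ 2)) from funext hg]
      exact ((((hasStrictFDerivAt_norm_sq x).hasFDerivAt).log hn).const_mul (1 / 2 : ℝ)).neg
    have h2 : HasGradientAt g (-(‖x‖ ^ 2)⁻¹ • x) x := by
      rw [hasGradientAt_iff_hasFDerivAt]
      refine h1.congr_fderiv ?_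
      ext v
      simp
      ring
    exact h2.gradient

lemma norm_gradG (x : Plane) : ‖gradG x‖ = ‖x‖⁻¹ := by
  rw [gradG_eq, norm_smul, norm_neg, norm_inv, norm_pow, norm_norm]
  rcases eq_or_ne ‖x‖ 0 with h | h
  · simp [h]
  · field_simp

lemma gradG_neg (x : Plane) : gradG (-x) = -gradG x := by simp [gradG_eq]

@[fun_prop]
lemma measurable_gradG : Measurable gradG := by
  rw [show gradG = fun x => -(‖x‖ ^ 2)⁻¹ • x from funext gradG_eq]
  fun_prop

lemma continuousAt_gradG {x : Plane} (hx : x ≠ 0) : ContinuousAt gradG x := by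
  rw [show gradG = fun x => -(‖x‖ ^ 2)⁻¹ • x from funext gradG_eq]
  have : ‖x‖ ^ 2 ≠ 0 := by positivity
  fun_prop (disch := assumption)

lemma gradG_coord (x : Plane) (j : Fin 2) : gradG x j = -(‖x‖ ^ 2)⁻¹ * x j := by
  rw [gradG_eq]; simp

/-- In polar coordinates the radial integrand is `r ^ (1 - s)`, and `1 - s > -1`. -/
lemma integrableOn_norm_rpow_ball {s : ℝ} (hs : s < 2) (R : ℝ) :
    IntegrableOn (fun x : Plane => ‖x‖ ^ (-s)) (Metric.ball 0 R) := by
  rw [integrableOn_fun_norm_addHaar volume (f := fun y : ℝ => y ^ (-s))]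
  rcases le_or_gt R 0 with hR | hR
  · simp [Set.Ioo_eq_empty (not_lt.2 hR)]
  have h := intervalIntegral.intervalIntegrable_rpow' (a := 0) (b := R) (r := 1 - s) (by linarith)
  rw [intervalIntegrable_iff_integrableOn_Ioo_of_le hR.le] at h
  refine h.congr_fun (fun y hy => ?_) measurableSet_Ioo
  have : (0 : ℝ) < y := hy.1
  simp only [finrank_euclideanSpace, Fintype.card_fin, Nat.add_one_sub_one, pow_one, smul_eq_mul]
  rw [show (1 - s : ℝ) = 1 + -s by ring, Real.rpow_add this, Real.rpow_one]

/-- The kernels `|x|^{-s}`, `s < 2`, are uniformly locally integrable. -/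
lemma exists_lintegral_rpow_le {s : ℝ} (hs0 : 0 ≤ s) (hs : s < 2) (R : ℝ) :
    ∃ C : ℝ≥0, ∀ y : Plane,
      ∫⁻ x in Metric.ball (0 : Plane) R, ENNReal.ofReal (‖x - y‖ ^ (-s)) ≤ C := by
  have h1 : ∫⁻ x in Metric.ball (0 : Plane) 1, ENNReal.ofReal (‖x‖ ^ (-s)) ≠ ⊤ := by
    have := (integrableOn_norm_rpow_ball hs 1).lintegral_lt_top
    exact this.ne
  set A := ∫⁻ x in Metric.ball (0 : Plane) 1, ENNReal.ofReal (‖x‖ ^ (-s))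
  set B := volume (Metric.ball (0 : Plane) R)
  have hB : B ≠ ⊤ := measure_ball_lt_top.ne
  refine ⟨(A + B).toNNReal, fun y => ?_⟩
  rw [ENNReal.coe_toNNReal (by finiteness)]
  -- Where `|x - y| < 1` translation invariance gives the bound `A` for every `y`; elsewhere the
  -- kernel is at most `1`.
  calc ∫⁻ x in Metric.ball (0 : Plane) R, ENNReal.ofReal (‖x - y‖ ^ (-s))
      ≤ ∫⁻ x in Metric.ball (0 : Plane) R,
          ((Metric.ball (0 : Plane) 1).indicator (fun z => ENNReal.ofReal (‖z‖ ^ (-s))) (x - y) + 1) := by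
        gcongr with x
        by_cases hx : x - y ∈ Metric.ball (0 : Plane) 1
        · simp [Set.indicator_of_mem hx]
        · rw [Set.indicator_of_notMem hx, zero_add]
          rw [← ENNReal.ofReal_one]
          apply ENNReal.ofReal_le_ofReal
          apply Real.rpow_le_one_of_one_le_of_nonpos
          · simpa using hx
          · linarith
    _ ≤ A + B := by
        rw [lintegral_add_right _ measurable_const]
        gcongr
        · calc _ ≤ ∫⁻ x, (Metric.ball (0 : Plane) 1).indicator
                (fun z => ENNReal.ofReal (‖z‖ ^ (-s))) (x - y) := setLIntegral_le_lintegral _ _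
            _ = ∫⁻ x, (Metric.ball (0 : Plane) 1).indicator
                (fun z => ENNReal.ofReal (‖z‖ ^ (-s))) x := lintegral_sub_right_eq_self _ y
            _ = A := by rw [lintegral_indicator measurableSet_ball]
        · simp [B]

lemma ofReal_rpow_neg_one (x : Plane) : ENNReal.ofReal (‖x‖ ^ (-1 : ℝ)) = ‖gradG x‖ₑ := by
  rw [Real.rpow_neg_one, ← norm_gradG, ofReal_norm]

lemma exists_lintegral_gradG_le (R : ℝ) :
    ∃ C : ℝ≥0, ∀ y : Plane, ∫⁻ x in Metric.ball (0 : Plane) R, ‖gradG (x - y)‖ₑ ≤ C := by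
  obtain ⟨C, hC⟩ := exists_lintegral_rpow_le zero_le_one one_lt_two R
  refine ⟨C, fun y => ?_⟩
  simpa only [ofReal_rpow_neg_one] using hC y

lemma locallyIntegrable_of_ball {W : Type*} [NormedAddCommGroup W] {f : Plane → W}
    (h : ∀ R : ℝ, IntegrableOn f (Metric.ball 0 R)) : LocallyIntegrable f := by
  intro x
  exact ⟨Metric.ball 0 (‖x‖ + 1), Metric.isOpen_ball.mem_nhds (by simp), h _⟩

lemma locallyIntegrable_gradG : LocallyIntegrable gradG := by
  refine locallyIntegrable_of_ball fun R => ?_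
  obtain ⟨C, hC⟩ := exists_lintegral_gradG_le R
  refine ⟨measurable_gradG.aestronglyMeasurable, ?_⟩
  have := hC 0
  simp only [sub_zero] at this
  exact lt_of_le_of_lt this ENNReal.coe_lt_top

lemma measurable_g : Measurable g := by
  unfold g; fun_prop

/-- From `log t ≤ t - 1` at `t = |x|` and at `t = |x|⁻¹`; the bound is a locally integrable
majorant. -/
lemma abs_g_le (x : Plane) : |g x| ≤ ‖x‖⁻¹ + ‖x‖ := by
  rcases eq_or_ne x 0 with rfl | hx
  · simp [g]
  have hp : 0 < ‖x‖ := by positivity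
  have h1 := Real.log_le_sub_one_of_pos hp
  have h2 := Real.log_le_sub_one_of_pos (inv_pos.2 hp)
  rw [Real.log_inv] at h2
  have h3 := inv_pos.2 hp
  rw [g, abs_le]
  constructor <;> linarith

lemma integrableOn_norm_inv_ball (R : ℝ) :
    IntegrableOn (fun x : Plane => ‖x‖⁻¹) (Metric.ball 0 R) := by
  simpa [Real.rpow_neg_one] using integrableOn_norm_rpow_ball one_lt_two R

lemma locallyIntegrable_norm_inv : LocallyIntegrable (fun x : Plane => ‖x‖⁻¹) :=
  locallyIntegrable_of_ball integrableOn_norm_inv_ball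

lemma locallyIntegrable_g : LocallyIntegrable g := by
  have h : LocallyIntegrable (fun x : Plane => ‖x‖⁻¹ + ‖x‖) :=
    locallyIntegrable_norm_inv.add continuous_norm.locallyIntegrable
  refine h.mono measurable_g.aestronglyMeasurable (.of_forall fun x => ?_)
  rw [Real.norm_eq_abs, Real.norm_of_nonneg (by positivity)]
  exact abs_g_le x

lemma _root_.MeasureTheory.LocallyIntegrable.integrable_mul_test {f h : Plane → ℝ} (hf : LocallyIntegrable f)
    (hh : Continuous h) (hc : HasCompactSupport h) : Integrable (fun x => f x * h x) := by
  simpa [mul_comm] using hf.integrable_smul_left_of_hasCompactSupport hh hc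

/-! ### Radial integration and the distributional equations of the kernel. -/

lemma abs_fderiv_apply_le (ψ : Plane → ℝ) (x : Plane) :
    |(‖x‖ ^ 2)⁻¹ * fderiv ℝ ψ x x| ≤ ‖x‖⁻¹ * ‖fderiv ℝ ψ x‖ := by
  rcases eq_or_ne ‖x‖ 0 with h | h
  · simp [h]
  have hp : 0 < ‖x‖ := lt_of_le_of_ne (norm_nonneg x) h.symm
  rw [abs_mul, abs_of_nonneg (by positivity : 0 ≤ (‖x‖ ^ 2)⁻¹)]
  calc (‖x‖ ^ 2)⁻¹ * |fderiv ℝ ψ x x| ≤ (‖x‖ ^ 2)⁻¹ * (‖fderiv ℝ ψ x‖ * ‖x‖) := by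
        gcongr; exact (fderiv ℝ ψ x).le_opNorm x
    _ = ‖x‖⁻¹ * ‖fderiv ℝ ψ x‖ := by field_simp

lemma integrable_norm_inv_mul_fderiv {ψ : Plane → ℝ} (hψ : ContDiff ℝ 1 ψ)
    (hc : HasCompactSupport ψ) : Integrable (fun x : Plane => ‖x‖⁻¹ * ‖fderiv ℝ ψ x‖) :=
  locallyIntegrable_norm_inv.integrable_mul_test
    (hψ.continuous_fderiv (by norm_num)).norm (hc.fderiv ℝ).norm

lemma integrable_radial {a : Plane → ℝ} {C : ℝ} (ha : Measurable a) (hC : ∀ x, |a x| ≤ C)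
    {ψ : Plane → ℝ} (hψ : ContDiff ℝ 1 ψ) (hc : HasCompactSupport ψ) :
    Integrable (fun x => a x * ((‖x‖ ^ 2)⁻¹ * fderiv ℝ ψ x x)) := by
  have hm : Measurable fun x : Plane => fderiv ℝ ψ x x :=
    ((hψ.continuous_fderiv (by norm_num)).clm_apply continuous_id).measurable
  refine ((integrable_norm_inv_mul_fderiv hψ hc).const_mul C).mono'
    (by fun_prop) (.of_forall fun x => ?_)
  rw [Real.norm_eq_abs, abs_mul]
  have h0 : 0 ≤ C := (abs_nonneg _).trans (hC 0)
  exact mul_le_mul (hC x) (abs_fderiv_apply_le ψ x) (abs_nonneg _) h0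

/-- The fundamental theorem of calculus along a ray, where `ψ` vanishes at infinity. -/
lemma integral_ray {ψ : Plane → ℝ} (hψ : ContDiff ℝ 1 ψ) (hc : HasCompactSupport ψ)
    (θ : Plane) (hθ : ‖θ‖ = 1) : ∫ r in Set.Ioi (0 : ℝ), fderiv ℝ ψ (r • θ) θ = -ψ 0 := by
  have hd : ∀ r : ℝ, HasDerivAt (fun r : ℝ => ψ (r • θ)) (fderiv ℝ ψ (r • θ) θ) r := by
    intro r
    have h1 : HasDerivAt (fun r : ℝ => r • θ) θ r := by
      simpa using (hasDerivAt_id r).smul_const θ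
    exact ((hψ.differentiable (by norm_num)) (r • θ)).hasFDerivAt.comp_hasDerivAt r h1
  have hemb : Topology.IsClosedEmbedding (fun r : ℝ => r • θ) := by
    apply Isometry.isClosedEmbedding
    apply Isometry.of_dist_eq
    intro r s
    rw [dist_eq_norm, ← sub_smul, norm_smul, hθ, mul_one, Real.dist_eq, Real.norm_eq_abs]
  have hcr : HasCompactSupport (fun r : ℝ => ψ (r • θ)) := hc.comp_isClosedEmbedding hemb
  have hcont : Continuous fun r : ℝ => fderiv ℝ ψ (r • θ) θ :=
    ((hψ.continuous_fderiv (by norm_num)).comp hemb.continuous).clm_apply continuous_const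
  have hcd : HasCompactSupport fun r : ℝ => fderiv ℝ ψ (r • θ) θ :=
    (hc.fderiv_apply (𝕜 := ℝ) θ).comp_isClosedEmbedding hemb
  have := integral_Ioi_of_hasDerivAt_of_tendsto (f := fun r : ℝ => ψ (r • θ)) (a := 0) (m := 0)
    (hd 0).continuousAt.continuousWithinAt (fun r _ => hd r)
    (hcont.integrable_of_hasCompactSupport hcd).integrableOn
    (hcr.is_zero_at_infty.mono_left atTop_le_cocompact)
  simpa using this

/-- Radial integration of a derivative against a kernel which is homogeneous of degree `0`. -/
lemma integral_radial {a : Plane → ℝ} {C : ℝ} (ha : Measurable a) (hC : ∀ x, |a x| ≤ C)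
    (hh : ∀ r : ℝ, 0 < r → ∀ x, a (r • x) = a x)
    {ψ : Plane → ℝ} (hψ : ContDiff ℝ 1 ψ) (hc : HasCompactSupport ψ) :
    ∫ x, a x * ((‖x‖ ^ 2)⁻¹ * fderiv ℝ ψ x x) =
      -((∫ θ : Metric.sphere (0 : Plane) 1, a θ ∂(volume : Measure Plane).toSphere) * ψ 0) := by
  set f : Plane → ℝ := fun x => a x * ((‖x‖ ^ 2)⁻¹ * fderiv ℝ ψ x x) with hf
  have hi : Integrable f := integrable_radial ha hC hψ hc
  have hmp := (volume : Measure Plane).measurePreserving_homeomorphUnitSphereProd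
  have hemb := (homeomorphUnitSphereProd Plane).measurableEmbedding
  set G : Metric.sphere (0 : Plane) 1 × Set.Ioi (0 : ℝ) → ℝ := fun p => f (p.2.1 • p.1.1) with hG
  have hGc : ∀ x : ({0}ᶜ : Set Plane), G (homeomorphUnitSphereProd Plane x) = f x := by
    intro x
    have hx : (x : Plane) ≠ 0 := x.2
    simp [hG, smul_smul, hx]
  have hGi : Integrable G ((volume : Measure Plane).toSphere.prod
      (Measure.volumeIoiPow (Module.finrank ℝ Plane - 1))) := by
    rw [← hmp.integrable_comp_emb hemb]
    rw [show G ∘ (homeomorphUnitSphereProd Plane) = fun x => f x.1 from funext hGc]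
    have := (integrableOn_iff_comap_subtypeVal (μ := (volume : Measure Plane)) (f := f)
      (measurableSet_singleton (0 : Plane)).compl).1 hi.integrableOn
    exact this
  have h1 : ∫ x, f x = ∫ p, G p ∂((volume : Measure Plane).toSphere.prod
      (Measure.volumeIoiPow (Module.finrank ℝ Plane - 1))) := by
    rw [← hmp.integral_comp hemb]
    simp only [hGc]
    rw [integral_subtype_comap (measurableSet_singleton _).compl f, restrict_compl_singleton]
  rw [h1, integral_prod _ hGi, ← integral_mul_const, ← integral_neg]
  congr 1
  ext θ
  have hθ : ‖(θ : Plane)‖ = 1 := by simp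
  rw [← mul_neg, ← integral_ray hψ hc θ hθ, ← integral_const_mul]
  -- The polar Jacobian `r`, the factor `|x|⁻² = r⁻²` and the `r` from `x = r θ` cancel, leaving the
  -- derivative of `ψ` along the ray.
  simp only [Measure.volumeIoiPow, ENNReal.ofReal]
  rw [integral_withDensity_eq_integral_smul
    (by exact (measurable_subtype_coe.pow_const _).real_toNNReal),
    integral_subtype_comap measurableSet_Ioi
      (fun r : ℝ => Real.toNNReal (r ^ (Module.finrank ℝ Plane - 1)) • f (r • θ.1))]
  refine setIntegral_congr_fun measurableSet_Ioi fun r hr => ?_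
  have hr' : (0 : ℝ) < r := hr
  simp only [finrank_euclideanSpace, Fintype.card_fin, Nat.add_one_sub_one, pow_one,
    NNReal.smul_def, Real.coe_toNNReal _ hr'.le, smul_eq_mul, hf]
  rw [hh r hr', norm_smul, hθ, map_smul, Real.norm_of_nonneg hr'.le, smul_eq_mul]
  field_simp

lemma toSphere_univ : (volume : Measure Plane).toSphere.real Set.univ = cd := by
  rw [Measure.toSphere_real_apply_univ]
  simp [measureReal_def, EuclideanSpace.volume_ball_fin_two, cd, Real.pi_pos.le]

/-- `-div ∇g = c_d δ_0`, tested against `C¹` functions. -/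
lemma integral_gradG_pd {ψ : Plane → ℝ} (hψ : ContDiff ℝ 1 ψ) (hc : HasCompactSupport ψ) :
    ∫ x, (gradG x 0 * pd 0 ψ x + gradG x 1 * pd 1 ψ x) = cd * ψ 0 := by
  have h := integral_radial (a := fun _ => 1) (C := 1) measurable_const (by simp)
    (by simp) hψ hc
  simp only [one_mul, integral_const, smul_eq_mul, mul_one, toSphere_univ] at h
  have h2 : ∀ x, gradG x 0 * pd 0 ψ x + gradG x 1 * pd 1 ψ x =
      -((‖x‖ ^ 2)⁻¹ * fderiv ℝ ψ x x) := by
    intro x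
    rw [fderiv_apply_eq_pd, gradG_coord, gradG_coord]; ring
  simp only [h2, integral_neg, h, neg_neg]

/-- `∇g` is the weak gradient of `g`. -/
lemma integral_g_pd {φ : Plane → ℝ} (hφ : ContDiff ℝ 1 φ) (hc : HasCompactSupport φ) (j : Fin 2) :
    ∫ x, g x * pd j φ x = -∫ x, gradG x j * φ x := by
  set e : ℕ → ℝ := fun n => 1 / ((n : ℝ) + 1) with he
  have he0 : ∀ n, 0 < e n := fun n => by positivity
  have he1 : ∀ n, e n ≤ 1 := fun n => by
    rw [he]; simp only; rw [div_le_one (by positivity)]; linarith [Nat.cast_nonneg (α := ℝ) n]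
  have het : Tendsto e atTop (𝓝 0) := tendsto_one_div_add_atTop_nhds_zero_nat
  -- Regularizing under the logarithm removes the singularity and keeps the gradient below `|x|⁻¹`;
  -- `e n ≤ 1` makes the majorant of `G n` independent of `n`.
  set G : ℕ → Plane → ℝ := fun n x => -((1 / 2) * Real.log (‖x‖ ^ 2 + e n)) with hG
  have hpos : ∀ n (x : Plane), 0 < ‖x‖ ^ 2 + e n := fun n x => by have := he0 n; positivity
  have hGd : ∀ n, ContDiff ℝ 1 (G n) := by
    intro n
    refine (contDiff_const.mul (ContDiff.log ?_ fun x => (hpos n x).ne')).neg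
    exact (contDiff_norm_sq ℝ).add contDiff_const
  have hGp : ∀ n x, pd j (G n) x = -(‖x‖ ^ 2 + e n)⁻¹ * x j := by
    intro n x
    have h1 : HasFDerivAt (G n)
        (-((1 / 2 : ℝ) • ((‖x‖ ^ 2 + e n)⁻¹ • (2 • (innerSL ℝ x))))) x :=
      ((((hasStrictFDerivAt_norm_sq x).hasFDerivAt.add_const (e n)).log
        (hpos n x).ne').const_mul (1 / 2 : ℝ)).neg
    simp only [pd]
    rw [h1.fderiv]
    simp [EuclideanSpace.inner_single_right]
    ring
  have hpart : ∀ n, ∫ x, G n x * pd j φ x = -∫ x, -(‖x‖ ^ 2 + e n)⁻¹ * x j * φ x := by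
    intro n
    rw [integral_mul_pd (hGd n) hφ hc j]
    simp only [hGp]
  have hae : ∀ᵐ x : Plane, x ≠ 0 := by
    simp [ae_iff]
  have hcpd := hasCompactSupport_pd hc j
  have l1 : Tendsto (fun n => ∫ x, G n x * pd j φ x) atTop (𝓝 (∫ x, g x * pd j φ x)) := by
    refine tendsto_integral_of_dominated_convergence
      (fun x => (‖x‖⁻¹ + ‖x‖ + (‖x‖ ^ 2 + 1)) * ‖pd j φ x‖) (fun n => ?_) ?_ (fun n => ?_) ?_
    · exact ((hGd n).continuous.mul (continuous_pd hφ j)).aestronglyMeasurable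
    · refine LocallyIntegrable.integrable_mul_test ?_ (continuous_pd hφ j).norm hcpd.norm
      exact (locallyIntegrable_norm_inv.add continuous_norm.locallyIntegrable).add
        (by fun_prop : Continuous fun x : Plane => ‖x‖ ^ 2 + 1).locallyIntegrable
    · filter_upwards [hae] with x hx
      rw [norm_mul]
      gcongr
      have hx' : 0 < ‖x‖ ^ 2 := by positivity
      have hn : 0 < ‖x‖ := by positivity
      have h1 : Real.log (‖x‖ ^ 2) ≤ Real.log (‖x‖ ^ 2 + e n) :=
        Real.log_le_log hx' (by linarith [he0 n])
      have h2 : Real.log (‖x‖ ^ 2 + e n) ≤ ‖x‖ ^ 2 + e n - 1 := Real.log_le_sub_one_of_pos (hpos n x)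
      have h3 := abs_le.1 (abs_g_le x)
      have h4 : g x = -((1 / 2) * Real.log (‖x‖ ^ 2)) := by simp [g]
      have h5 : 0 < ‖x‖⁻¹ := by positivity
      rw [Real.norm_eq_abs, abs_le]
      have := he1 n
      constructor <;> simp only [hG] <;> linarith
    · filter_upwards [hae] with x hx
      have hx' : ‖x‖ ^ 2 ≠ 0 := by positivity
      have h4 : g x = -((1 / 2) * Real.log (‖x‖ ^ 2 + 0)) := by simp [g]
      rw [h4]
      refine Tendsto.mul_const _ ((Tendsto.const_mul _ ?_).neg)
      exact (tendsto_const_nhds.add het).log (by simpa using hx')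
  have l2 : Tendsto (fun n => -∫ x, -(‖x‖ ^ 2 + e n)⁻¹ * x j * φ x) atTop
      (𝓝 (-∫ x, gradG x j * φ x)) := by
    refine Tendsto.neg (tendsto_integral_of_dominated_convergence
      (fun x => ‖x‖⁻¹ * ‖φ x‖) (fun n => ?_) ?_ (fun n => ?_) ?_)
    · have : Measurable φ := hφ.continuous.measurable
      have h2 : Measurable fun x : Plane => x j := by fun_prop
      exact Measurable.aestronglyMeasurable (by fun_prop)
    · exact locallyIntegrable_norm_inv.integrable_mul_test hφ.continuous.norm hc.norm
    · filter_upwards [hae] with x hx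
      rw [norm_mul]
      gcongr
      have hn : 0 < ‖x‖ := by positivity
      rw [norm_mul, norm_neg, norm_inv, Real.norm_of_nonneg (hpos n x).le]
      calc (‖x‖ ^ 2 + e n)⁻¹ * ‖x j‖ ≤ (‖x‖ ^ 2)⁻¹ * ‖x‖ := by
            gcongr
            · linarith [he0 n]
            · exact abs_coord_le x j
        _ = ‖x‖⁻¹ := by field_simp
    · filter_upwards [hae] with x hx
      have hx' : ‖x‖ ^ 2 + 0 ≠ 0 := by simpa using hx
      rw [gradG_coord, show ‖x‖ ^ 2 = ‖x‖ ^ 2 + 0 by simp]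
      simp only [add_zero ((‖x‖ : ℝ) ^ 2)]
      refine Tendsto.mul_const _ (Tendsto.mul_const _ (Tendsto.neg ?_))
      have := ((tendsto_const_nhds (x := ‖x‖ ^ 2)).add het).inv₀ hx'
      simpa using this
  simp only [hpart] at l1
  exact tendsto_nhds_unique l1 l2

/-- `-Δg = c_d δ_0`. -/
lemma laplacian_g {ψ : Plane → ℝ} (hψ : IsTest ψ) :
    Integrable (fun x => g x * Laplacian.laplacian ψ x) ∧
      -∫ x, g x * Laplacian.laplacian ψ x = cd * ψ 0 := by
  have h2 : ContDiff ℝ 2 ψ := contDiff_infty.1 hψ.1 2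
  have h1 : ContDiff ℝ 1 ψ := contDiff_infty.1 hψ.1 1
  have hp : ∀ j, ContDiff ℝ 1 (pd j ψ) := fun j => contDiff_pd h2 (by norm_num) j
  have hI : ∀ j, Integrable fun x => g x * pd j (pd j ψ) x := fun j =>
    locallyIntegrable_g.integrable_mul_test (continuous_pd (hp j) j)
      (hasCompactSupport_pd (hasCompactSupport_pd hψ.2 j) j)
  have hJ : ∀ j : Fin 2, Integrable fun x => gradG x j * pd j ψ x := fun j => by
    refine LocallyIntegrable.integrable_mul_test ?_ (continuous_pd h1 j) (hasCompactSupport_pd hψ.2 j)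
    refine locallyIntegrable_norm_inv.mono (by
      have : Measurable fun x : Plane => gradG x j := by fun_prop
      exact this.aestronglyMeasurable) (.of_forall fun x => ?_)
    rw [norm_inv, norm_norm, ← norm_gradG]
    exact abs_coord_le _ _
  simp only [laplacian_eq_pd h2, mul_add]
  refine ⟨(hI 0).add (hI 1), ?_⟩
  rw [integral_add (hI 0) (hI 1), integral_g_pd (hp 0) (hasCompactSupport_pd hψ.2 0),
    integral_g_pd (hp 1) (hasCompactSupport_pd hψ.2 1), ← integral_gradG_pd h1 hψ.2,
    integral_add (hJ 0) (hJ 1)]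
  ring

/-! ### Signed measures: reduction to a positive measure and a sign. -/

section

section SignDensity

variable {X : Type*} [MeasurableSpace X] {m : Measure X} {s : X → ℝ}
  {G : Type*} [NormedAddCommGroup G] [NormedSpace ℝ G]

/-- `s` is a measurable function with values `±1`. -/
def IsSign (s : X → ℝ) : Prop := Measurable s ∧ ∀ x, s x = 1 ∨ s x = -1

lemma IsSign.abs_eq (hs : IsSign s) (x : X) : |s x| = 1 := by
  rcases hs.2 x with h | h <;> simp [h]

lemma IsSign.integrable [IsFiniteMeasure m] (hs : IsSign s) : Integrable s m :=
  Integrable.of_bound (C := 1) hs.1.aestronglyMeasurable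
    (.of_forall fun x => by rw [Real.norm_eq_abs, hs.abs_eq])

lemma IsSign.integrable_smul (hs : IsSign s) {f : X → G} (hf : Integrable f m) :
    Integrable (fun x => s x • f x) m :=
  hf.bdd_smul (C := 1) hs.1.aestronglyMeasurable
    (.of_forall fun x => by rw [Real.norm_eq_abs, hs.abs_eq])

lemma IsSign.norm_smul (hs : IsSign s) (f : X → G) (x : X) : ‖s x • f x‖ = ‖f x‖ := by
  rw [_root_.norm_smul, Real.norm_eq_abs, hs.abs_eq, one_mul]

/-- Splitting along `{s = 1}` turns an integral against a signed density into a difference of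
integrals against positive measures. -/
lemma IsSign.setIntegral_smul (hs : IsSign s) {f : X → G} (hf : Integrable f m) (A : Set X)
    (hA : MeasurableSet A) :
    ∫ x in A, s x • f x ∂m = ∫ x in A ∩ s ⁻¹' {1}, f x ∂m - ∫ x in A ∩ (s ⁻¹' {1})ᶜ, f x ∂m := by
  have hP : MeasurableSet (s ⁻¹' {1}) := hs.1 (measurableSet_singleton _)
  rw [← integral_inter_add_sdiff hP (hs.integrable_smul hf).integrableOn, Set.sdiff_eq, sub_eq_add_neg,
    ← integral_neg]
  congr 1
  · refine setIntegral_congr_fun (hA.inter hP) fun x hx => ?_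
    have : s x = 1 := hx.2
    simp [this]
  · refine setIntegral_congr_fun (hA.inter hP.compl) fun x hx => ?_
    have : s x = -1 := (hs.2 x).resolve_left hx.2
    simp [this]

variable [IsFiniteMeasure m]

lemma IsSign.withDensityᵥ_eq (hs : IsSign s) : m.withDensityᵥ s =
    (m.restrict (s ⁻¹' {1})).toSignedMeasure - (m.restrict (s ⁻¹' {1})ᶜ).toSignedMeasure := by
  have hP : MeasurableSet (s ⁻¹' {1}) := hs.1 (measurableSet_singleton _)
  ext A hA
  rw [withDensityᵥ_apply hs.integrable hA]
  have := hs.setIntegral_smul (m := m) (f := fun _ => (1 : ℝ)) (integrable_const 1) A hA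
  simp only [smul_eq_mul, mul_one] at this
  rw [this]
  simp [hA, measureReal_def, Measure.restrict_apply hA]

lemma IsSign.variation_withDensityᵥ (hs : IsSign s) : (m.withDensityᵥ s).variation = m := by
  rw [Measure.variation_withDensityᵥ hs.integrable]
  have : (fun x => ‖s x‖ₑ) = 1 := by
    ext x
    rw [← ofReal_norm, Real.norm_eq_abs, hs.abs_eq]; simp
  rw [this, withDensity_one]

lemma IsSign.integral_withDensityᵥ [CompleteSpace G] (hs : IsSign s) {f : X → G}
    (hf : Integrable f m) :
    ∫ᵛ x, f x ∂<•(m.withDensityᵥ s) = ∫ x, s x • f x ∂m := by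
  rw [hs.withDensityᵥ_eq, VectorMeasure.integral_sub_vectorMeasure,
    VectorMeasure.integral_toSignedMeasure, VectorMeasure.integral_toSignedMeasure]
  · simpa using (hs.setIntegral_smul hf Set.univ MeasurableSet.univ).symm
  · simpa [VectorMeasure.Integrable] using hf.restrict
  · simpa [VectorMeasure.Integrable] using hf.restrict

/-- Multiplication of reals is commutative, so for real integrands the integrals `∂•` and `∂<•` use
the same pairing. -/
lemma lsmul_flip_real : (ContinuousLinearMap.lsmul ℝ ℝ (E := ℝ)).flip =
    ContinuousLinearMap.lsmul ℝ ℝ := by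
  ext; simp

end SignDensity

/-- The polar decomposition `μ = σ ν` of a signed measure, with `ν = |μ|` and `σ = ±1`. -/
structure PolarDecomp (μ : SignedMeasure Plane) (ν : Measure Plane) (σ : Plane → ℝ) : Prop where
  isFiniteMeasure : IsFiniteMeasure ν
  isSign : IsSign σ
  eq_withDensity : μ = ν.withDensityᵥ σ
  toTempered_apply : ∀ φ : SchwartzMap Plane ℂ, toTempered μ φ = ∫ x, σ x • φ x ∂ν

/-- The Jordan parts `p` and `q` live on complementary sets; take `ν = p + q` and let `σ` be `-1` on
the set that is null for `p`. -/
lemma exists_polarDecomp (μ : SignedMeasure Plane) : ∃ ν σ, PolarDecomp μ ν σ := by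
  classical
  set p := μ.toJordanDecomposition.posPart with hp
  set q := μ.toJordanDecomposition.negPart with hq
  obtain ⟨S, hS, hpS, hqS⟩ := μ.toJordanDecomposition.mutuallySingular
  set σ : Plane → ℝ := fun x => if x ∈ S then -1 else 1 with hσ
  have hsign : IsSign σ := by
    refine ⟨Measurable.ite hS measurable_const measurable_const, fun x => ?_⟩
    by_cases hx : x ∈ S <;> simp [hσ, hx]
  have hσp : ∀ᵐ x ∂p, σ x = 1 := by
    have : ∀ᵐ x ∂p, x ∉ S := measure_eq_zero_iff_ae_notMem.1 hpS
    filter_upwards [this] with x hx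
    simp [hσ, hx]
  have hσq : ∀ᵐ x ∂q, σ x = -1 := by
    have : ∀ᵐ x ∂q, x ∉ Sᶜ := measure_eq_zero_iff_ae_notMem.1 hqS
    filter_upwards [this] with x hx
    have : x ∈ S := by simpa using hx
    simp [hσ, this]
  refine ⟨p + q, σ, inferInstance, hsign, ?_, fun φ => ?_⟩
  · ext A hA
    rw [withDensityᵥ_apply hsign.integrable hA, Measure.restrict_add, integral_add_measure
      hsign.integrable.integrableOn hsign.integrable.integrableOn]
    have h1 : ∫ x in A, σ x ∂p = p.real A := by
      rw [integral_congr_ae (g := fun _ => 1) (ae_restrict_of_ae hσp)]; simp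
    have h2 : ∫ x in A, σ x ∂q = -q.real A := by
      rw [integral_congr_ae (g := fun _ => -1) (ae_restrict_of_ae hσq)]; simp
    rw [h1, h2]
    conv_lhs => rw [← μ.toSignedMeasure_toJordanDecomposition]
    simp [JordanDecomposition.toSignedMeasure, hA, hp, hq, sub_eq_add_neg]
  · have hφp : Integrable φ p := φ.integrable
    have hφq : Integrable φ q := φ.integrable
    rw [integral_add_measure (hsign.integrable_smul hφp) (hsign.integrable_smul hφq)]
    rw [integral_congr_ae (g := fun x => φ x) (by filter_upwards [hσp] with x hx; simp [hx]),
      integral_congr_ae (μ := q) (g := fun x => -φ x) (by filter_upwards [hσq] with x hx; simp [hx]),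
      integral_neg]
    simp only [toTempered]
    change p.toTemperedDistribution φ - q.toTemperedDistribution φ = _
    simp [sub_eq_add_neg]

namespace PolarDecomp

variable {μ : SignedMeasure Plane} {ν : Measure Plane} {σ : Plane → ℝ}

lemma variation_eq (h : PolarDecomp μ ν σ) : μ.variation = ν := by
  have := h.isFiniteMeasure
  rw [h.eq_withDensity, h.isSign.variation_withDensityᵥ]

lemma integral_flip_eq (h : PolarDecomp μ ν σ) {G : Type*} [NormedAddCommGroup G]
    [NormedSpace ℝ G] [CompleteSpace G] {f : Plane → G} (hf : Integrable f ν) :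
    ∫ᵛ x, f x ∂<•μ = ∫ x, σ x • f x ∂ν := by
  have := h.isFiniteMeasure
  conv_lhs => rw [h.eq_withDensity]
  exact h.isSign.integral_withDensityᵥ hf

lemma integral_eq (h : PolarDecomp μ ν σ) {f : Plane → ℝ} (hf : Integrable f ν) :
    ∫ᵛ x, f x ∂•μ = ∫ x, σ x * f x ∂ν := by
  rw [← lsmul_flip_real, h.integral_flip_eq hf]; rfl

lemma isSign_prod (h : PolarDecomp μ ν σ) : IsSign fun z : Plane × Plane => σ z.1 * σ z.2 := by
  have hm := h.isSign.1
  refine ⟨by fun_prop, fun z => ?_⟩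
  rcases h.isSign.2 z.1 with h1 | h1 <;> rcases h.isSign.2 z.2 with h2 | h2 <;> simp [h1, h2]

/-- A product of vector measures is determined by its values on rectangles, and there the density `σ
⊗ σ` factors. -/
lemma tensorSq_eq (h : PolarDecomp μ ν σ) :
    tensorSq μ = (ν.prod ν).withDensityᵥ fun z : Plane × Plane => σ z.1 * σ z.2 := by
  have := h.isFiniteMeasure
  apply VectorMeasure.prod_eq_of_forall_apply_prod
  intro s t hs ht
  rw [withDensityᵥ_apply h.isSign_prod.integrable (hs.prod ht), ← Measure.prod_restrict,
    integral_prod_mul]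
  conv_rhs => rw [h.eq_withDensity]
  rw [withDensityᵥ_apply h.isSign.integrable hs, withDensityᵥ_apply h.isSign.integrable ht]
  simp

lemma tensorSq_variation (h : PolarDecomp μ ν σ) : (tensorSq μ).variation = ν.prod ν := by
  have := h.isFiniteMeasure
  rw [h.tensorSq_eq, h.isSign_prod.variation_withDensityᵥ]

lemma tensorSq_integral (h : PolarDecomp μ ν σ) {f : Plane × Plane → ℝ}
    (hf : Integrable f (ν.prod ν)) :
    ∫ᵛ z, f z ∂•(tensorSq μ) = ∫ z, σ z.1 * σ z.2 * f z ∂(ν.prod ν) := by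
  have := h.isFiniteMeasure
  rw [← lsmul_flip_real, h.tensorSq_eq]
  exact h.isSign_prod.integral_withDensityᵥ hf

end PolarDecomp

end

/-! ### The duality between `H⁻¹` and `H¹`. -/

open scoped SchwartzMap FourierTransform LineDeriv

/-- A real test function seen as a complex Schwartz function. -/
def IsTest.toSchwartz {u : Plane → ℝ} (hu : IsTest u) : 𝓢(Plane, ℂ) :=
  HasCompactSupport.toSchwartzMap (f := fun x => (u x : ℂ))
    (hu.2.comp_left (g := ((↑) : ℝ → ℂ)) Complex.ofReal_zero)
    (Complex.ofRealCLM.contDiff.comp hu.1)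

lemma IsTest.toSchwartz_apply {u : Plane → ℝ} (hu : IsTest u) (x : Plane) :
    hu.toSchwartz x = u x := rfl

lemma IsTest.lineDeriv_toSchwartz {u : Plane → ℝ} (hu : IsTest u) (j : Fin 2) (x : Plane) :
    (∂_{EuclideanSpace.single j (1 : ℝ)} hu.toSchwartz) x = ((pd j u x : ℝ) : ℂ) := by
  rw [SchwartzMap.lineDerivOp_apply_eq_fderiv]
  have h1 : HasFDerivAt (fun x => (u x : ℂ)) (Complex.ofRealCLM.comp (fderiv ℝ u x)) x :=
    Complex.ofRealCLM.hasFDerivAt.comp x ((hu.1.differentiable (by simp)) x).hasFDerivAt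
  change fderiv ℝ (fun x => (u x : ℂ)) x _ = _
  rw [h1.fderiv]; rfl

lemma hasTemperateGrowth_besselSymbol :
    (fun x : Plane => (((1 + ‖x‖ ^ 2) ^ ((1 : ℝ) / 2) : ℝ) : ℂ)).HasTemperateGrowth := by
  fun_prop

lemma integral_norm_sq_fourierInv (f : 𝓢(Plane, ℂ)) : ∫ ξ, ‖(𝓕⁻ f) ξ‖ ^ 2 = ∫ x, ‖f x‖ ^ 2 := by
  have := SchwartzMap.integral_norm_sq_fourier (𝓕⁻ f)
  rw [FourierTransform.fourier_fourierInv_eq] at this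
  exact this.symm

lemma _root_.SchwartzMap.integrable_norm_sq (f : 𝓢(Plane, ℂ)) :
    Integrable fun x => ‖f x‖ ^ 2 :=
  (f.memLp 2 volume).integrable_norm_pow (by norm_num)

/-- Plancherel applied to `∂_j f`: in the `2π` convention a derivative becomes multiplication by a
factor of modulus `2π |ξ_j|`. -/
lemma integral_coord_sq_fourierInv (f : 𝓢(Plane, ℂ)) (j : Fin 2) :
    Integrable (fun ξ : Plane => ξ j ^ 2 * ‖(𝓕⁻ f) ξ‖ ^ 2) ∧
    ∫ ξ : Plane, ξ j ^ 2 * ‖(𝓕⁻ f) ξ‖ ^ 2 =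
      ((2 * Real.pi) ^ 2)⁻¹ * ∫ x, ‖(∂_{EuclideanSpace.single j (1 : ℝ)} f) x‖ ^ 2 := by
  have h1 : ∀ ξ : Plane, ‖(𝓕⁻ (∂_{EuclideanSpace.single j (1 : ℝ)} f)) ξ‖ ^ 2 =
      (2 * Real.pi) ^ 2 * (ξ j ^ 2 * ‖(𝓕⁻ f) ξ‖ ^ 2) := by
    intro ξ
    rw [SchwartzMap.fourierInv_lineDerivOp_eq]
    have : (fun ξ : Plane => inner ℝ ξ (EuclideanSpace.single j (1 : ℝ))).HasTemperateGrowth := by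
      fun_prop
    rw [smul_apply, SchwartzMap.smulLeftCLM_apply_apply this, norm_smul, norm_smul]
    simp [EuclideanSpace.inner_single_right, abs_of_pos Real.pi_pos, mul_pow]
  have h2 : (0 : ℝ) < (2 * Real.pi) ^ 2 := by positivity
  constructor
  · have := (SchwartzMap.integrable_norm_sq
      (𝓕⁻ (∂_{EuclideanSpace.single j (1 : ℝ)} f))).const_mul ((2 * Real.pi) ^ 2)⁻¹
    refine this.congr (.of_forall fun ξ => ?_)
    simp only [h1]
    field_simp
  · rw [← integral_norm_sq_fourierInv]
    simp only [h1, integral_const_mul]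
    field_simp

/-- The squared symbol is `1 + ξ₀² + ξ₁²`, so Plancherel gives the `L²` norm plus `(2π)⁻²` times the
Dirichlet energy; that factor is at most `1` and is dropped. -/
lemma integral_besselPotential_sq_le {u : Plane → ℝ} (hu : IsTest u) :
    ∫ x, ‖(𝓕 (SchwartzMap.smulLeftCLM ℂ
        (fun x : Plane => (((1 + ‖x‖ ^ 2) ^ ((1 : ℝ) / 2) : ℝ) : ℂ)) (𝓕⁻ hu.toSchwartz))) x‖ ^ 2 ≤
      ∫ x, (u x ^ 2 + (pd 0 u x ^ 2 + pd 1 u x ^ 2)) := by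
  rw [SchwartzMap.integral_norm_sq_fourier]
  have h0 : ∀ ξ, ‖(SchwartzMap.smulLeftCLM ℂ
        (fun x : Plane => (((1 + ‖x‖ ^ 2) ^ ((1 : ℝ) / 2) : ℝ) : ℂ)) (𝓕⁻ hu.toSchwartz)) ξ‖ ^ 2 =
      ‖(𝓕⁻ hu.toSchwartz) ξ‖ ^ 2 +
        (ξ 0 ^ 2 * ‖(𝓕⁻ hu.toSchwartz) ξ‖ ^ 2 + ξ 1 ^ 2 * ‖(𝓕⁻ hu.toSchwartz) ξ‖ ^ 2) := by
    intro ξ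
    have hp : (0 : ℝ) ≤ 1 + ‖ξ‖ ^ 2 := by positivity
    rw [SchwartzMap.smulLeftCLM_apply_apply hasTemperateGrowth_besselSymbol, norm_smul, mul_pow,
      Complex.norm_real, Real.norm_of_nonneg (by positivity), ← Real.sqrt_eq_rpow, Real.sq_sqrt hp,
      norm_sq_eq_coord]
    ring
  obtain ⟨i0, e0⟩ := integral_coord_sq_fourierInv hu.toSchwartz 0
  obtain ⟨i1, e1⟩ := integral_coord_sq_fourierInv hu.toSchwartz 1
  simp only [h0]
  have hI : ∀ {f : Plane → ℝ}, IsTest f → Integrable fun x => f x ^ 2 := fun {f} hf => by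
    have := hf.toSchwartz.integrable_norm_sq
    simpa [IsTest.toSchwartz_apply] using this
  have i01 : Integrable fun ξ : Plane => ξ 0 ^ 2 * ‖(𝓕⁻ hu.toSchwartz) ξ‖ ^ 2 +
    ξ 1 ^ 2 * ‖(𝓕⁻ hu.toSchwartz) ξ‖ ^ 2 := i0.add i1
  have iu : Integrable fun x => pd 0 u x ^ 2 + pd 1 u x ^ 2 :=
    (hI (hu.pderiv 0)).add (hI (hu.pderiv 1))
  rw [integral_add (SchwartzMap.integrable_norm_sq _) i01, integral_add i0 i1, e0, e1,
    integral_norm_sq_fourierInv, integral_add (hI hu) iu,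
    integral_add (hI (hu.pderiv 0)) (hI (hu.pderiv 1))]
  simp only [IsTest.lineDeriv_toSchwartz, IsTest.toSchwartz_apply, Complex.norm_real,
    Real.norm_eq_abs, sq_abs]
  have hc : ((2 * Real.pi) ^ 2)⁻¹ ≤ 1 := by
    apply inv_le_one_of_one_le₀
    nlinarith [Real.pi_gt_three]
  have n0 : 0 ≤ ∫ x, pd 0 u x ^ 2 := integral_nonneg fun x => sq_nonneg _
  have n1 : 0 ≤ ∫ x, pd 1 u x ^ 2 := integral_nonneg fun x => sq_nonneg _
  gcongr
  · exact mul_le_of_le_one_left n0 hc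
  · exact mul_le_of_le_one_left n1 hc

/-- Elements of `H^{-1}` act continuously on test functions for the `H^1` norm. -/
lemma MemHNegOneLoc.exists_abs_integral_le {μ : SignedMeasure Plane} {ν : Measure Plane}
    {σ : Plane → ℝ} (hμ : MemHNegOneLoc μ) (h : PolarDecomp μ ν σ) {χ : Plane → ℝ}
    (hχ : IsTest χ) : ∃ C : ℝ, 0 ≤ C ∧ ∀ u : Plane → ℝ, IsTest u →
      |∫ x, σ x * (χ x * u x) ∂ν| ≤
        C * √(∫ x, (u x ^ 2 + (pd 0 u x ^ 2 + pd 1 u x ^ 2))) := by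
  obtain ⟨f, hf⟩ := hμ χ hχ
  -- Now `χ μ` is the Bessel potential of order one of `f ∈ L²`. The multiplier is moved onto `u`,
  -- giving `V` below, and Cauchy–Schwarz applies.
  rw [TemperedDistribution.besselPotential_neg_apply_eq_iff] at hf
  refine ⟨‖f‖, norm_nonneg _, fun u hu => ?_⟩
  have hχg : (fun x => (χ x : ℂ)).HasTemperateGrowth := hχ.toSchwartz.hasTemperateGrowth
  have h1 : ((∫ x, σ x * (χ x * u x) ∂ν : ℝ) : ℂ) =
      (TemperedDistribution.smulLeftCLM ℂ (fun x => (χ x : ℂ)) (toTempered μ)) hu.toSchwartz := by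
    rw [TemperedDistribution.smulLeftCLM_apply_apply, h.toTempered_apply, ← integral_complex_ofReal]
    congr 1
    ext x
    rw [SchwartzMap.smulLeftCLM_apply_apply hχg, hu.toSchwartz_apply]
    simp
  set V : 𝓢(Plane, ℂ) := 𝓕 (SchwartzMap.smulLeftCLM ℂ
        (fun x : Plane => (((1 + ‖x‖ ^ 2) ^ ((1 : ℝ) / 2) : ℝ) : ℂ)) (𝓕⁻ hu.toSchwartz)) with hV
  have h2 : ((∫ x, σ x * (χ x * u x) ∂ν : ℝ) : ℂ) = ∫ x, V x • f x := by
    rw [h1, ← hf, TemperedDistribution.besselPotential,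
      TemperedDistribution.fourierMultiplierCLM_apply_apply, Lp.toTemperedDistribution_apply]
  have h3 : |∫ x, σ x * (χ x * u x) ∂ν| ≤ ‖f‖ * √(∫ x, ‖V x‖ ^ 2) := by
    rw [← Real.norm_eq_abs, ← Complex.norm_real, h2]
    have hVm : MemLp V 2 := V.memLp 2 volume
    have hfm : MemLp f 2 := Lp.memLp f
    calc ‖∫ x, V x • f x‖ ≤ ∫ x, ‖f x‖ * ‖V x‖ := by
          refine (norm_integral_le_integral_norm _).trans (le_of_eq ?_)
          congr 1; ext x; rw [norm_smul, mul_comm]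
      _ ≤ (∫ x, ‖f x‖ ^ (2 : ℝ)) ^ (1 / (2 : ℝ)) * (∫ x, ‖V x‖ ^ (2 : ℝ)) ^ (1 / (2 : ℝ)) := by
          apply integral_mul_le_Lp_mul_Lq_of_nonneg Real.HolderConjugate.two_two
          · exact .of_forall fun x => norm_nonneg _
          · exact .of_forall fun x => norm_nonneg _
          · simpa using hfm.norm
          · simpa using hVm.norm
      _ = ‖f‖ * √(∫ x, ‖V x‖ ^ 2) := by
          rw [← Real.sqrt_eq_rpow, ← Real.sqrt_eq_rpow]
          simp only [Real.rpow_two]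
          congr 1
          rw [Real.sqrt_eq_iff_mul_self_eq (integral_nonneg fun x => by positivity) (norm_nonneg _),
            ← pow_two, ← @inner_self_eq_norm_sq ℂ]
          rw [L2.inner_def, ← integral_re (by exact L2.integrable_inner f f)]
          congr 1
          ext x
          rw [inner_self_eq_norm_sq]
  exact h3.trans (mul_le_mul_of_nonneg_left
    (Real.sqrt_le_sqrt (integral_besselPotential_sq_le hu)) (norm_nonneg _))

/-! ### The field `∇g ∗ μ` and its distributional divergence and curl. -/

section

/-- The field `∇g ∗ (σ ν)`. -/
def field (ν : Measure Plane) (σ : Plane → ℝ) (x : Plane) : Plane := ∫ y, σ y • gradG (x - y) ∂ν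

/-- The equality holds at every point: since `|σ| = 1` both integrals converge absolutely at the
same points, and elsewhere both default to `0`. -/
lemma PolarDecomp.gradGConv_eq {μ : SignedMeasure Plane} {ν : Measure Plane} {σ : Plane → ℝ}
    (h : PolarDecomp μ ν σ) : gradGConv μ = field ν σ := by
  have := h.isFiniteMeasure
  ext1 x
  by_cases hi : Integrable (fun y => gradG (x - y)) ν
  · exact h.integral_flip_eq hi
  · have h1 : gradGConv μ x = 0 := by
      apply VectorMeasure.integral_undef
      rw [VectorMeasure.Integrable, h.variation_eq]
      exact hi
    have h2 : ¬ Integrable (fun y => σ y • gradG (x - y)) ν := by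
      intro hc
      apply hi
      have hm : AEStronglyMeasurable (fun y => gradG (x - y)) ν :=
        (measurable_gradG.comp (measurable_const.sub measurable_id)).aestronglyMeasurable
      refine (integrable_norm_iff hm).1 (hc.norm.congr (.of_forall fun y => ?_))
      exact h.isSign.norm_smul (fun y => gradG (x - y)) y
    rw [h1, field, integral_undef h2]

section Kernel

variable {ν : Measure Plane} [IsFiniteMeasure ν] {σ : Plane → ℝ}

/-- Integrating in `x` first, the inner integral is bounded uniformly in `y`, and `ν` is finite. -/
lemma lintegral_lintegral_gradG_lt_top (ν : Measure Plane) [IsFiniteMeasure ν] (R : ℝ) :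
    ∫⁻ p, ‖gradG (p.1 - p.2)‖ₑ ∂((volume.restrict (Metric.ball (0 : Plane) R)).prod ν) < ⊤ := by
  obtain ⟨C, hC⟩ := exists_lintegral_gradG_le R
  have hm : Measurable fun p : Plane × Plane => ‖gradG (p.1 - p.2)‖ₑ :=
    (measurable_gradG.comp (measurable_fst.sub measurable_snd)).enorm
  rw [lintegral_prod_symm _ hm.aemeasurable]
  calc _ ≤ ∫⁻ _, C ∂ν := lintegral_mono fun y => hC y
    _ < ⊤ := by
      rw [lintegral_const]
      exact ENNReal.mul_lt_top ENNReal.coe_lt_top (measure_lt_top ν _)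

lemma integrable_gradG_prod (ν : Measure Plane) [IsFiniteMeasure ν] (R : ℝ) :
    Integrable (fun p : Plane × Plane => gradG (p.1 - p.2))
      ((volume.restrict (Metric.ball (0 : Plane) R)).prod ν) :=
  ⟨(measurable_gradG.comp (measurable_fst.sub measurable_snd)).aestronglyMeasurable,
    lintegral_lintegral_gradG_lt_top ν R⟩

lemma ae_of_ae_ball {p : Plane → Prop}
    (h : ∀ R : ℝ, ∀ᵐ x ∂(volume.restrict (Metric.ball (0 : Plane) R)), p x) :
    ∀ᵐ x : Plane, p x := by
  have h2 : ∀ᵐ x : Plane, ∀ n : ℕ, x ∈ Metric.ball (0 : Plane) n → p x := by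
    rw [ae_all_iff]
    intro n
    exact (ae_restrict_iff' measurableSet_ball).1 (h n)
  filter_upwards [h2] with x hx
  obtain ⟨n, hn⟩ := exists_nat_gt ‖x‖
  exact hx n (by simpa using hn)

lemma ae_integrable_gradG (ν : Measure Plane) [IsFiniteMeasure ν] :
    ∀ᵐ x : Plane, Integrable (fun y => gradG (x - y)) ν :=
  ae_of_ae_ball fun R => (integrable_gradG_prod ν R).prod_right_ae

lemma integrable_smul_gradG_prod (hσ : IsSign σ) (R : ℝ) :
    Integrable (fun p : Plane × Plane => σ p.2 • gradG (p.1 - p.2))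
      ((volume.restrict (Metric.ball (0 : Plane) R)).prod ν) := by
  have hs : IsSign fun p : Plane × Plane => σ p.2 :=
    ⟨hσ.1.comp measurable_snd, fun p => hσ.2 p.2⟩
  refine (integrable_norm_iff ?_).1
    ((integrable_gradG_prod ν R).norm.congr (.of_forall fun p => ?_))
  · exact (hs.1.smul (measurable_gradG.comp
      (measurable_fst.sub measurable_snd))).aestronglyMeasurable
  · exact (hs.norm_smul (fun p : Plane × Plane => gradG (p.1 - p.2)) p).symm

lemma locallyIntegrable_field (hσ : IsSign σ) : LocallyIntegrable (field ν σ) :=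
  locallyIntegrable_of_ball fun R => (integrable_smul_gradG_prod hσ R).integral_prod_left

lemma aestronglyMeasurable_field (hσ : IsSign σ) : AEStronglyMeasurable (field ν σ) volume :=
  (locallyIntegrable_field hσ).aestronglyMeasurable

lemma coord_integral {X : Type*} [MeasurableSpace X] {m : Measure X} {f : X → Plane}
    (hf : Integrable f m) (j : Fin 2) : (∫ x, f x ∂m) j = ∫ x, f x j ∂m :=
  ((EuclideanSpace.proj (𝕜 := ℝ) j).integral_comp_comm hf).symm

lemma ae_field_coord (hσ : IsSign σ) (j : Fin 2) :
    ∀ᵐ x : Plane, field ν σ x j = ∫ y, σ y * gradG (x - y) j ∂ν := by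
  filter_upwards [ae_integrable_gradG ν] with x hx
  exact coord_integral (hσ.integrable_smul hx) j

lemma locallyIntegrable_field_coord (hσ : IsSign σ) (j : Fin 2) :
    LocallyIntegrable fun x => field ν σ x j := by
  have := (locallyIntegrable_field (ν := ν) hσ)
  intro x
  obtain ⟨U, hU, hi⟩ := this x
  exact ⟨U, hU, (EuclideanSpace.proj (𝕜 := ℝ) j).integrable_comp hi⟩

lemma tsupport_subset_ball {W : Type*} [Zero W] {ψ : Plane → W} (hc : HasCompactSupport ψ) :
    ∃ R : ℝ, 0 < R ∧ tsupport ψ ⊆ Metric.ball 0 R := by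
  obtain ⟨R, hR⟩ := hc.isBounded.subset_ball (0 : Plane)
  exact ⟨max R 1, by positivity, hR.trans (Metric.ball_subset_ball (le_max_left _ _))⟩

lemma integrable_kernel_pairing (hσ : IsSign σ) {ψ : Plane → ℝ} (hψ : Continuous ψ)
    (hc : HasCompactSupport ψ) (j : Fin 2) :
    Integrable (fun p : Plane × Plane => ψ p.1 * (σ p.2 * gradG (p.1 - p.2) j))
      ((volume : Measure Plane).prod ν) := by
  obtain ⟨R, -, hR⟩ := tsupport_subset_ball hc
  obtain ⟨M, hM⟩ := hψ.bounded_above_of_compact_support hc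
  have h1 := (EuclideanSpace.proj (𝕜 := ℝ) j).integrable_comp (integrable_smul_gradG_prod (ν := ν) hσ R)
  have h2 : Integrable (fun p : Plane × Plane => ψ p.1 * (σ p.2 * gradG (p.1 - p.2) j))
      ((volume.restrict (Metric.ball (0 : Plane) R)).prod ν) := by
    have := h1.bdd_mul (f := fun p : Plane × Plane => ψ p.1) (c := M)
      (hψ.comp continuous_fst).aestronglyMeasurable (.of_forall fun p => hM p.1)
    simpa using this
  have h3 : ((volume.restrict (Metric.ball (0 : Plane) R)).prod ν) =
      ((volume : Measure Plane).prod ν).restrict (Metric.ball (0 : Plane) R ×ˢ Set.univ) := by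
    rw [← Measure.prod_restrict, Measure.restrict_univ]
  rw [h3] at h2
  refine (integrableOn_iff_integrable_of_support_subset ?_).1 h2
  intro p hp
  refine ⟨hR (subset_tsupport _ ?_), trivial⟩
  intro h0
  simp [h0] at hp

/-- Fubini for the pairing of the field with a continuous compactly supported function. -/
lemma integral_mul_field (hσ : IsSign σ) {ψ : Plane → ℝ} (hψ : Continuous ψ)
    (hc : HasCompactSupport ψ) (j : Fin 2) :
    ∫ x, ψ x * field ν σ x j = ∫ y, σ y * (∫ x, ψ x * gradG (x - y) j) ∂ν := by
  have h := integrable_kernel_pairing (ν := ν) hσ hψ hc j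
  have h1 : ∫ x, ψ x * field ν σ x j = ∫ x, ∫ y, ψ x * (σ y * gradG (x - y) j) ∂ν := by
    refine integral_congr_ae ?_
    filter_upwards [ae_field_coord (ν := ν) hσ j] with x hx
    rw [hx, integral_const_mul]
  rw [h1, integral_integral_swap h]
  congr 1
  ext y
  rw [← integral_const_mul]
  congr 1
  ext x
  ring

lemma integrable_pairing_right (hσ : IsSign σ) {ψ : Plane → ℝ} (hψ : Continuous ψ)
    (hc : HasCompactSupport ψ) (j : Fin 2) :
    Integrable (fun y => σ y * ∫ x, ψ x * gradG (x - y) j) ν := by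
  refine (integrable_kernel_pairing (ν := ν) hσ hψ hc j).integral_prod_right.congr
    (.of_forall fun y => ?_)
  simp only
  rw [← integral_const_mul]
  congr 1
  ext x
  ring

lemma integral_mul_gradG_shift (ψ : Plane → ℝ) (y : Plane) (j : Fin 2) :
    ∫ x, ψ x * gradG (x - y) j = ∫ x, gradG x j * ψ (x + y) := by
  rw [← integral_sub_right_eq_self (fun x => gradG x j * ψ (x + y)) y]
  congr 1; ext x; simp [mul_comm]

lemma pd_comp_add_right (ψ : Plane → ℝ) (y x : Plane) (j : Fin 2) :
    pd j (fun x => ψ (x + y)) x = pd j ψ (x + y) := by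
  simp only [pd]; rw [fderiv_comp_add_right]

lemma HasCompactSupport_comp_add {ψ : Plane → ℝ} (hc : HasCompactSupport ψ) (y : Plane) :
    HasCompactSupport fun x => ψ (x + y) :=
  hc.comp_homeomorph (Homeomorph.addRight y)

lemma locallyIntegrable_gradG_coord (j : Fin 2) : LocallyIntegrable fun x => gradG x j := by
  intro x
  obtain ⟨U, hU, hi⟩ := locallyIntegrable_gradG x
  exact ⟨U, hU, (EuclideanSpace.proj (𝕜 := ℝ) j).integrable_comp hi⟩

lemma integrable_gradG_coord_mul {ψ : Plane → ℝ} (hψ : Continuous ψ)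
    (hc : HasCompactSupport ψ) (j : Fin 2) : Integrable fun x => gradG x j * ψ x :=
  (locallyIntegrable_gradG_coord j).integrable_mul_test hψ hc

/-- `-div (∇g ∗ (σ ν)) = c_d σ ν` in the sense of distributions. -/
lemma integral_field_div (hσ : IsSign σ) {ψ : Plane → ℝ} (hψ : ContDiff ℝ 1 ψ)
    (hc : HasCompactSupport ψ) :
    (∫ x, pd 0 ψ x * field ν σ x 0) + (∫ x, pd 1 ψ x * field ν σ x 1) =
      cd * ∫ y, σ y * ψ y ∂ν := by
  rw [integral_mul_field hσ (continuous_pd hψ 0) (hasCompactSupport_pd hc 0),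
    integral_mul_field hσ (continuous_pd hψ 1) (hasCompactSupport_pd hc 1),
    ← integral_add (integrable_pairing_right hσ (continuous_pd hψ 0) (hasCompactSupport_pd hc 0) 0)
      (integrable_pairing_right hσ (continuous_pd hψ 1) (hasCompactSupport_pd hc 1) 1),
    ← integral_const_mul]
  congr 1
  ext y
  have hy : ContDiff ℝ 1 fun x => ψ (x + y) := hψ.comp (contDiff_id.add contDiff_const)
  have hyc := HasCompactSupport_comp_add hc y
  have h := integral_gradG_pd hy hyc
  rw [integral_add (integrable_gradG_coord_mul (continuous_pd hy 0) (hasCompactSupport_pd hyc 0) 0)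
    (integrable_gradG_coord_mul (continuous_pd hy 1) (hasCompactSupport_pd hyc 1) 1)] at h
  simp only [pd_comp_add_right, zero_add] at h
  rw [integral_mul_gradG_shift, integral_mul_gradG_shift, ← mul_add, h]
  ring

/-- `∇g` is curl free in the sense of distributions. -/
lemma integral_gradG_curl {ψ : Plane → ℝ} (hψ : ContDiff ℝ 2 ψ) (hc : HasCompactSupport ψ)
    (i j : Fin 2) : ∫ x, gradG x i * pd j ψ x = ∫ x, gradG x j * pd i ψ x := by
  have h1 := integral_g_pd (contDiff_pd (m := 1) hψ (by norm_num) j) (hasCompactSupport_pd hc j) i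
  have h2 := integral_g_pd (contDiff_pd (m := 1) hψ (by norm_num) i) (hasCompactSupport_pd hc i) j
  simp only [pd_comm hψ i j] at h1
  linarith

lemma integral_field_curl (hσ : IsSign σ) {ψ : Plane → ℝ} (hψ : ContDiff ℝ 2 ψ)
    (hc : HasCompactSupport ψ) :
    ∫ x, pd 1 ψ x * field ν σ x 0 = ∫ x, pd 0 ψ x * field ν σ x 1 := by
  have h1 : ContDiff ℝ 1 ψ := hψ.of_le (by norm_num)
  rw [integral_mul_field hσ (continuous_pd h1 1) (hasCompactSupport_pd hc 1),
    integral_mul_field hσ (continuous_pd h1 0) (hasCompactSupport_pd hc 0)]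
  congr 1
  ext y
  have hy : ContDiff ℝ 2 fun x => ψ (x + y) := hψ.comp (contDiff_id.add contDiff_const)
  have h := integral_gradG_curl hy (HasCompactSupport_comp_add hc y) 0 1
  simp only [pd_comp_add_right] at h
  rw [integral_mul_gradG_shift, integral_mul_gradG_shift, h]

end Kernel

/-! ### Convolutions of test functions with `∇g`: equation, decay and local energy. -/

/-- Convolution of real functions. -/
def conv (f ψ : Plane → ℝ) (x : Plane) : ℝ := ∫ z, f z * ψ (x - z)

lemma conv_eq (f ψ : Plane → ℝ) :
    conv f ψ = convolution f ψ (ContinuousLinearMap.mul ℝ ℝ) volume := rfl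

lemma contDiff_conv {f ψ : Plane → ℝ} (hf : LocallyIntegrable f) (hψ : IsTest ψ) :
    ContDiff ℝ ∞ (conv f ψ) := by
  rw [conv_eq]
  exact hψ.2.contDiff_convolution_right (n := ⊤) _ hf hψ.1

lemma pd_conv {f ψ : Plane → ℝ} (hf : LocallyIntegrable f) (hψ : ContDiff ℝ 1 ψ)
    (hc : HasCompactSupport ψ) (j : Fin 2) : pd j (conv f ψ) = conv f (pd j ψ) := by
  ext x
  have h := hc.hasFDerivAt_convolution_right (ContinuousLinearMap.mul ℝ ℝ) hf hψ x
  rw [pd, conv_eq, h.fderiv, convolution, ContinuousLinearMap.integral_apply]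
  · rfl
  · exact (hc.fderiv ℝ).convolutionExists_right _ hf (hψ.continuous_fderiv (by norm_num)) x

/-- `Δ (∂_j g ∗ ψ) = -c_d ∂_j ψ`. -/
lemma laplacian_conv_gradG {ψ : Plane → ℝ} (hψ : IsTest ψ) (j : Fin 2) (x : Plane) :
    pd 0 (pd 0 (conv (fun z => gradG z j) ψ)) x + pd 1 (pd 1 (conv (fun z => gradG z j) ψ)) x =
      -(cd * pd j ψ x) := by
  have hl := locallyIntegrable_gradG_coord
  have h1 : ∀ {f : Plane → ℝ}, IsTest f → ContDiff ℝ 1 f := fun hf => contDiff_infty.1 hf.1 1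
  have hrefl : ∀ {f : Plane → ℝ}, IsTest f → IsTest fun z => f (x - z) := fun {f} hf =>
    ⟨hf.1.comp (contDiff_const.sub contDiff_id), hf.2.comp_homeomorph (Homeomorph.subLeft x)⟩
  have hpd : ∀ {f : Plane → ℝ} (i : Fin 2) (z : Plane), IsTest f →
      pd i (fun z => f (x - z)) z = -pd i f (x - z) := by
    intro f i z hf
    simp only [pd]
    rw [show (fun z => f (x - z)) = f ∘ fun z => x - z from rfl,
      fderiv_comp z ((hf.1.differentiable (by simp)) _) (by fun_prop)]
    have : fderiv ℝ (fun z : Plane => x - z) z = -ContinuousLinearMap.id ℝ Plane := by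
      rw [fderiv_const_sub, fderiv_fun_id]
    rw [this]
    simp
  -- Curl-freeness trades `∂_j g` against `∂_i ∂_i ψ` for `∂_i g` against `∂_i ∂_j ψ`; summing over
  -- `i` leaves `div ∇g` tested with `∂_j ψ`.
  have hswap : ∀ i, conv (fun z => gradG z j) (pd i (pd i ψ)) x =
      -∫ z, gradG z i * pd i (fun z => pd j ψ (x - z)) z := by
    intro i
    have hc := integral_gradG_curl (contDiff_infty.1 (hrefl (hψ.pderiv i)).1 2)
      (hrefl (hψ.pderiv i)).2 j i
    simp only [hpd i _ (hψ.pderiv i), hpd j _ (hψ.pderiv i)] at hc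
    simp only [hpd i _ (hψ.pderiv j)]
    simp only [mul_neg, integral_neg, neg_inj, neg_neg] at hc ⊢
    rw [conv, hc]
    congr 1
    ext z
    rw [pd_comm (contDiff_infty.1 hψ.1 2)]
  have hint : ∀ i, Integrable fun z => gradG z i * pd i (fun z => pd j ψ (x - z)) z := fun i =>
    integrable_gradG_coord_mul (continuous_pd (h1 (hrefl (hψ.pderiv j))) i)
      (hasCompactSupport_pd (hrefl (hψ.pderiv j)).2 i) i
  rw [pd_conv (hl j) (h1 hψ) hψ.2, pd_conv (hl j) (h1 hψ) hψ.2,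
    pd_conv (hl j) (h1 (hψ.pderiv 0)) (hψ.pderiv 0).2,
    pd_conv (hl j) (h1 (hψ.pderiv 1)) (hψ.pderiv 1).2, hswap, hswap, ← neg_add,
    ← integral_add (hint 0) (hint 1),
    integral_gradG_pd (h1 (hrefl (hψ.pderiv j))) (hrefl (hψ.pderiv j)).2, sub_zero]

end

/-- Jensen's inequality for powers. -/
lemma lintegral_rpow_le {X : Type*} [MeasurableSpace X] (m : Measure X) {p : ℝ} (hp : 1 < p)
    {f : X → ℝ≥0∞} (hf : AEMeasurable f m) :
    (∫⁻ x, f x ∂m) ^ p ≤ m Set.univ ^ (p - 1) * ∫⁻ x, f x ^ p ∂m := by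
  have hpq : p.HolderConjugate (p.conjExponent) := Real.HolderConjugate.conjExponent hp
  have h := ENNReal.lintegral_mul_le_Lp_mul_Lq m hpq hf (aemeasurable_const (b := (1 : ℝ≥0∞)))
  simp only [Pi.mul_apply, mul_one, ENNReal.one_rpow, lintegral_const, one_mul] at h
  have hp0 : 0 < p := by linarith
  calc _ ≤ ((∫⁻ x, f x ^ p ∂m) ^ (1 / p) * m Set.univ ^ (1 / p.conjExponent)) ^ p := by
        gcongr
    _ = m Set.univ ^ (p - 1) * ∫⁻ x, f x ^ p ∂m := by
        rw [ENNReal.mul_rpow_of_nonneg _ _ hp0.le, ← ENNReal.rpow_mul, ← ENNReal.rpow_mul,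
          one_div_mul_cancel hp0.ne', ENNReal.rpow_one, mul_comm]
        congr 2
        rw [Real.conjExponent]
        field_simp

lemma ofReal_integral_sq {f : Plane → ℝ} {m : Measure Plane} (hf : MemLp f 2 m) :
    ENNReal.ofReal (∫ x, f x ^ 2 ∂m) = ∫⁻ x, ‖f x‖ₑ ^ (2 : ℝ) ∂m := by
  rw [ofReal_integral_eq_lintegral_ofReal hf.integrable_sq (.of_forall fun x => sq_nonneg _)]
  congr 1
  ext x
  rw [← ofReal_norm, ENNReal.ofReal_rpow_of_nonneg (norm_nonneg _) (by norm_num)]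
  simp

lemma _root_.Continuous.memLp_two {f : Plane → ℝ} (hf : Continuous f) (hc : HasCompactSupport f) :
    MemLp f 2 := hf.memLp_of_hasCompactSupport hc

lemma _root_.HasCompactSupport.of_forall_eq_zero {χ f : Plane → ℝ} (hχ : HasCompactSupport χ)
    (h : ∀ x, χ x = 0 → f x = 0) : HasCompactSupport f :=
  hχ.mono fun x hx h0 => hx (h x h0)

lemma isFiniteMeasure_restrict_ball (R : ℝ) :
    IsFiniteMeasure ((volume : Measure Plane).restrict (Metric.ball 0 R)) :=
  ⟨by rw [Measure.restrict_apply_univ]; exact measure_ball_lt_top⟩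

lemma enorm_conv_gradG_le (ψ : Plane → ℝ) (j : Fin 2) (y : Plane) :
    ‖conv (fun z => gradG z j) ψ y‖ₑ ≤ ∫⁻ x, ‖gradG (y - x)‖ₑ * ‖ψ x‖ₑ := by
  calc _ ≤ ∫⁻ z, ‖gradG z j * ψ (y - z)‖ₑ := enorm_integral_le_lintegral_enorm _
    _ ≤ ∫⁻ z, ‖gradG z‖ₑ * ‖ψ (y - z)‖ₑ := by
        gcongr with z
        rw [enorm_mul]
        gcongr
        rw [enorm_le_iff_norm_le]
        exact abs_coord_le _ j
    _ = ∫⁻ x, ‖gradG (y - x)‖ₑ * ‖ψ x‖ₑ := by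
        rw [← lintegral_sub_left_eq_self _ y]
        simp

lemma enorm_gradG_sub_comm (x y : Plane) : ‖gradG (x - y)‖ₑ = ‖gradG (y - x)‖ₑ := by
  rw [← neg_sub, gradG_neg, enorm_neg]

lemma measurable_enorm_gradG_sub : Measurable fun p : Plane × Plane => ‖gradG (p.1 - p.2)‖ₑ :=
  (measurable_gradG.comp (measurable_fst.sub measurable_snd)).enorm

/-- `L²` bound for the convolution with `∇g` on bounded sets. -/
lemma exists_integral_conv_sq_le (R R' : ℝ) : ∃ C : ℝ, 0 ≤ C ∧ ∀ (j : Fin 2) (ψ : Plane → ℝ),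
    IsTest ψ → tsupport ψ ⊆ Metric.ball 0 R →
      ∫ x in Metric.ball (0 : Plane) R', conv (fun z => gradG z j) ψ x ^ 2 ≤ C * ∫ x, ψ x ^ 2 := by
  obtain ⟨C₁, hC₁⟩ := exists_lintegral_gradG_le R
  obtain ⟨C₂, hC₂⟩ := exists_lintegral_gradG_le R'
  refine ⟨C₁ * C₂, by positivity, fun j ψ hψ hs => ?_⟩
  set B := Metric.ball (0 : Plane) R
  set B' := Metric.ball (0 : Plane) R'
  have hψm : Measurable fun x => ‖ψ x‖ₑ := hψ.1.continuous.measurable.enorm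
  have hk : ∀ y : Plane, Measurable fun x : Plane => ‖gradG (y - x)‖ₑ := fun y =>
    (measurable_gradG.comp (measurable_const.sub measurable_id)).enorm
  -- A Schur test: Jensen for the weight `|∇g(y - x)| dx` on `B`, whose mass is at most `C₁`,
  -- followed by Tonelli with the bound `C₂` in `y`.
  have hpt : ∀ y, ‖conv (fun z => gradG z j) ψ y‖ₑ ^ (2 : ℝ) ≤
      C₁ * ∫⁻ x, ‖gradG (y - x)‖ₑ * ‖ψ x‖ₑ ^ (2 : ℝ) := by
    intro y
    have h1 : ∫⁻ x, ‖gradG (y - x)‖ₑ * ‖ψ x‖ₑ =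
        ∫⁻ x, ‖ψ x‖ₑ ∂((volume.restrict B).withDensity fun x => ‖gradG (y - x)‖ₑ) := by
      rw [lintegral_withDensity_eq_lintegral_mul _ (hk y) hψm]
      symm
      apply setLIntegral_eq_of_support_subset
      intro x hx
      have : ψ x ≠ 0 := by
        intro h0
        simp [h0] at hx
      exact hs (subset_tsupport _ this)
    have h2 : (∫⁻ x, ‖ψ x‖ₑ ^ (2 : ℝ) ∂((volume.restrict B).withDensity fun x => ‖gradG (y - x)‖ₑ)) ≤
        ∫⁻ x, ‖gradG (y - x)‖ₑ * ‖ψ x‖ₑ ^ (2 : ℝ) := by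
      rw [lintegral_withDensity_eq_lintegral_mul _ (hk y) (hψm.pow_const _)]
      exact setLIntegral_le_lintegral _ _
    have h3 : ((volume.restrict B).withDensity fun x => ‖gradG (y - x)‖ₑ) Set.univ ≤ C₁ := by
      rw [withDensity_apply _ MeasurableSet.univ, Measure.restrict_univ]
      simpa only [enorm_gradG_sub_comm] using hC₁ y
    calc _ ≤ (∫⁻ x, ‖gradG (y - x)‖ₑ * ‖ψ x‖ₑ) ^ (2 : ℝ) := by
          gcongr; exact enorm_conv_gradG_le ψ j y
      _ ≤ _ := by
          rw [h1]
          refine (lintegral_rpow_le _ one_lt_two hψm.aemeasurable).trans ?_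
          rw [show (2 : ℝ) - 1 = 1 by norm_num, ENNReal.rpow_one]
          gcongr
  have hw : Continuous (conv (fun z => gradG z j) ψ) :=
    (contDiff_conv (locallyIntegrable_gradG_coord j) hψ).continuous
  have hwL : MemLp (conv (fun z => gradG z j) ψ) 2 (volume.restrict B') := by
    have := isFiniteMeasure_restrict_ball R'
    obtain ⟨M, hM⟩ := (isCompact_closedBall (0 : Plane) R').exists_bound_of_continuousOn hw.continuousOn
    refine MemLp.of_bound hw.aestronglyMeasurable M ?_
    exact (ae_restrict_iff' measurableSet_ball).2
      (.of_forall fun x hx => hM x (Metric.ball_subset_closedBall hx))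
  have hψL := hψ.1.continuous.memLp_two hψ.2
  have hψ0 : 0 ≤ ∫ x, ψ x ^ 2 := integral_nonneg fun x => sq_nonneg _
  rw [← ENNReal.ofReal_le_ofReal_iff (by positivity), ofReal_integral_sq hwL,
    ENNReal.ofReal_mul (by positivity), ofReal_integral_sq hψL, ENNReal.ofReal_mul (by positivity),
    ENNReal.ofReal_coe_nnreal, ENNReal.ofReal_coe_nnreal]
  have hm2 : Measurable fun p : Plane × Plane => ‖gradG (p.1 - p.2)‖ₑ * ‖ψ p.2‖ₑ ^ (2 : ℝ) :=
    measurable_enorm_gradG_sub.mul ((hψm.comp measurable_snd).pow_const _)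
  calc _ ≤ ∫⁻ y in B', C₁ * ∫⁻ x, ‖gradG (y - x)‖ₑ * ‖ψ x‖ₑ ^ (2 : ℝ) := by
        gcongr with y; exact hpt y
    _ = C₁ * ∫⁻ x, ∫⁻ y in B', ‖gradG (y - x)‖ₑ * ‖ψ x‖ₑ ^ (2 : ℝ) := by
        rw [lintegral_const_mul' _ _ ENNReal.coe_ne_top, lintegral_lintegral_swap hm2.aemeasurable]
    _ ≤ C₁ * ∫⁻ x, C₂ * ‖ψ x‖ₑ ^ (2 : ℝ) := by
        gcongr with x
        rw [lintegral_mul_const' _ _ (by finiteness)]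
        gcongr
        exact hC₂ x
    _ = C₁ * C₂ * ∫⁻ x, ‖ψ x‖ₑ ^ (2 : ℝ) := by
        rw [lintegral_const_mul' _ _ ENNReal.coe_ne_top, mul_assoc]

/-- Far field bound for the convolution with `∇g`. -/
lemma abs_conv_gradG_le_of_far {R : ℝ} {ψ : Plane → ℝ} (hψ : IsTest ψ)
    (hs : tsupport ψ ⊆ Metric.ball 0 R) (j : Fin 2) {y : Plane} (hy : R + 1 ≤ ‖y‖) :
    |conv (fun z => gradG z j) ψ y| ≤ √(volume.real (Metric.ball (0 : Plane) R)) * √(∫ x, ψ x ^ 2) := by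
  have hψi : Integrable ψ := hψ.1.continuous.integrable_of_hasCompactSupport hψ.2
  have h1 : |conv (fun z => gradG z j) ψ y| ≤ ∫ x, |ψ x| := by
    rw [← Real.norm_eq_abs, ← integral_sub_left_eq_self (fun x => |ψ x|) volume y]
    refine norm_integral_le_of_norm_le ?_ (.of_forall fun z => ?_)
    · exact (hψi.abs.comp_sub_left y)
    · rw [norm_mul, Real.norm_eq_abs, Real.norm_eq_abs]
      by_cases h0 : ψ (y - z) = 0
      · simp [h0]
      · have hz : ‖y - z‖ < R := by simpa using hs (subset_tsupport _ h0)
        have hz1 : 1 ≤ ‖z‖ := by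
          have := norm_le_norm_add_norm_sub' y z
          linarith
        have : |gradG z j| ≤ 1 := by
          refine (abs_coord_le _ j).trans ?_
          rw [norm_gradG]
          exact inv_le_one_of_one_le₀ hz1
        exact mul_le_of_le_one_left (abs_nonneg _) this
  refine h1.trans ?_
  have h2 : ∫ x, |ψ x| = ∫ x in Metric.ball (0 : Plane) R, |ψ x| * 1 := by
    simp only [mul_one]
    refine (setIntegral_eq_integral_of_forall_compl_eq_zero fun x hx => ?_).symm
    rw [image_eq_zero_of_notMem_tsupport fun h => hx (hs h), abs_zero]
  rw [h2]
  have hψL := (hψ.1.continuous.memLp_two hψ.2).restrict (Metric.ball (0 : Plane) R)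
  have := isFiniteMeasure_restrict_ball R
  have h3 := integral_mul_le_Lp_mul_Lq_of_nonneg (μ := volume.restrict (Metric.ball (0 : Plane) R))
    Real.HolderConjugate.two_two (f := fun x => |ψ x|) (g := fun _ => 1)
    (.of_forall fun x => abs_nonneg _) (.of_forall fun x => zero_le_one)
    (by rw [ENNReal.ofReal_ofNat]; exact hψL.norm) (memLp_const 1)
  refine h3.trans ?_
  rw [mul_comm]
  simp only [one_pow, integral_const, smul_eq_mul, mul_one, ← Real.sqrt_eq_rpow,
    Real.rpow_two, sq_abs, measureReal_restrict_apply_univ]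
  exact mul_le_mul_of_nonneg_left (Real.sqrt_le_sqrt (setIntegral_le_integral
    (hψ.1.continuous.memLp_two hψ.2).integrable_sq (.of_forall fun x => sq_nonneg _)))
    (Real.sqrt_nonneg _)

/-- The localized energy identity. -/
lemma integral_pd_mul_sq {χ w : Plane → ℝ} (hχ : IsTest χ) (hw : ContDiff ℝ ∞ w) (j : Fin 2) :
    ∫ x, pd j (fun x => χ x * w x) x ^ 2 =
      (∫ x, pd j χ x ^ 2 * w x ^ 2) - ∫ x, χ x ^ 2 * w x * pd j (pd j w) x := by
  have hχd : Differentiable ℝ χ := hχ.1.differentiable (by simp)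
  have hwd : Differentiable ℝ w := hw.differentiable (by simp)
  have hw' : ContDiff ℝ ∞ (pd j w) := contDiff_pd hw (by simp) j
  have hw'd : Differentiable ℝ (pd j w) := hw'.differentiable (by simp)
  have hχ' := hχ.pderiv j
  have hw'' : ContDiff ℝ ∞ (pd j (pd j w)) := contDiff_pd hw' (by simp) j
  -- The identity is `∫ ∂_j (χ² w ∂_j w) = 0` with the square completed.
  set F : Plane → ℝ := fun x => χ x * χ x * (w x * pd j w x) with hF
  have hFc : HasCompactSupport F := (hχ.2.mul_right (f' := χ)).mul_right
  have hFd : ContDiff ℝ 1 F :=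
    contDiff_infty.1 ((hχ.1.mul hχ.1).mul (hw.mul hw')) 1
  have hpt : ∀ x, pd j F x = pd j (fun x => χ x * w x) x ^ 2 - pd j χ x ^ 2 * w x ^ 2 +
      χ x ^ 2 * w x * pd j (pd j w) x := by
    intro x
    rw [hF, pd_mul (f := fun x => χ x * χ x) (h := fun x => w x * pd j w x)
      ((hχd x).mul (hχd x)) ((hwd x).mul (hw'd x)), pd_mul (hχd x) (hχd x), pd_mul (hwd x) (hw'd x),
      pd_mul (hχd x) (hwd x)]
    ring
  have hu : IsTest fun x => χ x * w x := ⟨hχ.1.mul hw, hχ.2.mul_right⟩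
  have hi1 : Integrable fun x => pd j (fun x => χ x * w x) x ^ 2 :=
    ((hu.pderiv j).1.continuous.memLp_two (hu.pderiv j).2).integrable_sq
  have hi2 : Integrable fun x => pd j χ x ^ 2 * w x ^ 2 := by
    refine ((hχ'.1.continuous.pow 2).mul (hw.continuous.pow 2)).integrable_of_hasCompactSupport ?_
    exact hχ'.2.of_forall_eq_zero fun x hx => by simp [hx]
  have hi3 : Integrable fun x => χ x ^ 2 * w x * pd j (pd j w) x := by
    refine (((hχ.1.continuous.pow 2).mul hw.continuous).mul
      hw''.continuous).integrable_of_hasCompactSupport ?_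
    exact hχ.2.of_forall_eq_zero fun x hx => by simp [hx]
  have h0 := integral_pd_eq_zero hFd hFc j
  simp only [hpt] at h0
  have hi12 : Integrable fun x => pd j (fun x => χ x * w x) x ^ 2 - pd j χ x ^ 2 * w x ^ 2 :=
    hi1.sub hi2
  rw [integral_add hi12 hi3, integral_sub hi1 hi2] at h0
  linarith

/-- `H¹` bound for a localization of the convolution with `∇g`. -/
lemma exists_energy_le {R R' : ℝ} {χ : Plane → ℝ} (hχ : IsTest χ) (h1 : ∀ x, |χ x| ≤ 1)
    (hχR : ∀ x ∈ Metric.ball (0 : Plane) R, χ x = 1) (hs' : tsupport χ ⊆ Metric.ball 0 R') :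
    ∃ C : ℝ, 0 ≤ C ∧ ∀ (i : Fin 2) (ψ : Plane → ℝ), IsTest ψ → tsupport ψ ⊆ Metric.ball 0 R →
      ∫ x, ((χ x * conv (fun z => gradG z i) ψ x) ^ 2 +
        (pd 0 (fun x => χ x * conv (fun z => gradG z i) ψ x) x ^ 2 +
          pd 1 (fun x => χ x * conv (fun z => gradG z i) ψ x) x ^ 2)) ≤ C * ∫ x, ψ x ^ 2 := by
  obtain ⟨C, hC0, hC⟩ := exists_integral_conv_sq_le R R'
  obtain ⟨M₀, hM₀⟩ := (hχ.pderiv 0).1.continuous.bounded_above_of_compact_support (hχ.pderiv 0).2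
  obtain ⟨M₁, hM₁⟩ := (hχ.pderiv 1).1.continuous.bounded_above_of_compact_support (hχ.pderiv 1).2
  -- The terms bound `∫ (χ w)²`, the contribution of `∇χ`, and the source term. The factor `2` comes
  -- from absorbing half of the Dirichlet energy.
  refine ⟨C + 2 * (M₀ ^ 2 + M₁ ^ 2) * C + cd ^ 2, by positivity, fun i ψ hψ hs => ?_⟩
  set w := conv (fun z => gradG z i) ψ with hw_def
  have hw : ContDiff ℝ ∞ w := contDiff_conv (locallyIntegrable_gradG_coord i) hψ
  have hW := hC i ψ hψ hs
  rw [← hw_def] at hW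
  set W := ∫ x in Metric.ball (0 : Plane) R', w x ^ 2
  set A := ∫ x, ψ x ^ 2
  have hu : IsTest fun x => χ x * w x := ⟨hχ.1.mul hw, hχ.2.mul_right⟩
  set u := fun x => χ x * w x with hu_def
  have hI : ∀ {f : Plane → ℝ}, IsTest f → Integrable fun x => f x ^ 2 := fun {f} hf =>
    (hf.1.continuous.memLp_two hf.2).integrable_sq
  have hWi : IntegrableOn (fun x => w x ^ 2) (Metric.ball (0 : Plane) R') :=
    ((hw.continuous.pow 2).locallyIntegrable.integrableOn_isCompact
      (isCompact_closedBall (0 : Plane) R')).mono_set Metric.ball_subset_closedBall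
  have hloc : ∀ (a : Plane → ℝ) (M : ℝ), tsupport a ⊆ tsupport χ → (∀ x, ‖a x‖ ≤ M) →
      ∫ x, a x ^ 2 * w x ^ 2 ≤ M ^ 2 * W := by
    intro a M ha hM
    rw [← setIntegral_eq_integral_of_forall_compl_eq_zero (s := Metric.ball (0 : Plane) R'),
      ← integral_const_mul]
    · refine integral_mono_of_nonneg (.of_forall fun x => by positivity) (hWi.const_mul _)
        (.of_forall fun x => ?_)
      simp only
      gcongr ?_ * _
      exact sq_le_sq' (abs_le.1 (hM x)).1 (abs_le.1 (hM x)).2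
    · intro x hx
      rw [image_eq_zero_of_notMem_tsupport fun h => hx (hs' (ha h))]
      simp
  have hu2 : ∫ x, u x ^ 2 ≤ W := by
    simp only [hu_def, mul_pow]
    simpa using hloc χ 1 subset_rfl (fun x => h1 x)
  have e0 := integral_pd_mul_sq hχ hw 0
  have e1 := integral_pd_mul_sq hχ hw 1
  rw [← hu_def] at e0 e1
  have b0 := hloc (pd 0 χ) M₀ (tsupport_pd_subset χ 0) hM₀
  have b1 := hloc (pd 1 χ) M₁ (tsupport_pd_subset χ 1) hM₁
  have hi3 : ∀ j, Integrable fun x => χ x ^ 2 * w x * pd j (pd j w) x := by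
    intro j
    have hw'' : ContDiff ℝ ∞ (pd j (pd j w)) :=
      contDiff_pd (contDiff_pd (m := ∞) hw (by simp) j) (by simp) j
    refine (((hχ.1.continuous.pow 2).mul hw.continuous).mul
      hw''.continuous).integrable_of_hasCompactSupport ?_
    exact hχ.2.of_forall_eq_zero fun x hx => by simp [hx]
  -- Since `Δw = -c_d ∂_i ψ` is supported where `χ = 1`, the factor `χ² w` may be replaced by `u`;
  -- integrating by parts then puts the derivative on `u`.
  have hlap : (∫ x, χ x ^ 2 * w x * pd 0 (pd 0 w) x) + (∫ x, χ x ^ 2 * w x * pd 1 (pd 1 w) x) =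
      cd * ∫ x, pd i u x * ψ x := by
    rw [← integral_add (hi3 0) (hi3 1)]
    have hpt : ∀ x, χ x ^ 2 * w x * pd 0 (pd 0 w) x + χ x ^ 2 * w x * pd 1 (pd 1 w) x =
        -cd * (u x * pd i ψ x) := by
      intro x
      rw [← mul_add, laplacian_conv_gradG hψ i x]
      by_cases hx : x ∈ Metric.ball (0 : Plane) R
      · rw [hu_def]; simp only [hχR x hx]; ring
      · rw [image_eq_zero_of_notMem_tsupport fun h => hx (hs (tsupport_pd_subset ψ i h))]
        ring
    simp only [hpt]
    rw [integral_const_mul, integral_mul_pd (contDiff_infty.1 hu.1 1) (contDiff_infty.1 hψ.1 1) hψ.2]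
    ring
  -- Young's inequality, with weight `1/2` on the energy so that it can be absorbed.
  have hcross : -(cd * ∫ x, pd i u x * ψ x) ≤ 1 / 2 * (∫ x, pd i u x ^ 2) + 1 / 2 * cd ^ 2 * A := by
    have hm : Integrable fun x => pd i u x * ψ x :=
      ((hu.pderiv i).1.continuous.mul hψ.1.continuous).integrable_of_hasCompactSupport hψ.2.mul_left
    rw [← integral_const_mul, ← integral_const_mul, ← integral_const_mul, ← integral_neg,
      ← integral_add ((hI (hu.pderiv i)).const_mul _) ((hI hψ).const_mul _)]
    refine integral_mono (hm.const_mul cd).neg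
      (((hI (hu.pderiv i)).const_mul _).add ((hI hψ).const_mul _)) fun x => ?_
    nlinarith [sq_nonneg (pd i u x + cd * ψ x)]
  have hD0 : 0 ≤ ∫ x, pd 0 u x ^ 2 := integral_nonneg fun x => sq_nonneg _
  have hD1 : 0 ≤ ∫ x, pd 1 u x ^ 2 := integral_nonneg fun x => sq_nonneg _
  have hDi : (∫ x, pd i u x ^ 2) ≤ (∫ x, pd 0 u x ^ 2) + ∫ x, pd 1 u x ^ 2 := by
    fin_cases i
    · exact le_add_of_nonneg_right hD1
    · exact le_add_of_nonneg_left hD0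
  have iu : Integrable fun x => pd 0 u x ^ 2 + pd 1 u x ^ 2 :=
    (hI (hu.pderiv 0)).add (hI (hu.pderiv 1))
  have hgoal : ∫ x, (u x ^ 2 + (pd 0 u x ^ 2 + pd 1 u x ^ 2)) =
      (∫ x, u x ^ 2) + ((∫ x, pd 0 u x ^ 2) + ∫ x, pd 1 u x ^ 2) := by
    rw [integral_add (hI hu) iu, integral_add (hI (hu.pderiv 0)) (hI (hu.pderiv 1))]
  have hfin : (∫ x, (u x ^ 2 + (pd 0 u x ^ 2 + pd 1 u x ^ 2))) ≤
      W + 2 * (M₀ ^ 2 + M₁ ^ 2) * W + cd ^ 2 * A := by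
    rw [hgoal]; linarith
  refine hfin.trans ?_
  have : (0 : ℝ) ≤ M₀ ^ 2 + M₁ ^ 2 := by positivity
  nlinarith [mul_le_mul_of_nonneg_left hW this]

/-- A function which acts continuously on test functions for the `L²` norm is in `L²`. -/
lemma memLp_two_of_forall_test {f : Plane → ℝ} (hf : LocallyIntegrable f) {U : Set Plane}
    (hU : IsOpen U) {C : ℝ}
    (h : ∀ ψ : Plane → ℝ, IsTest ψ → tsupport ψ ⊆ U →
      |∫ x, ψ x * f x| ≤ C * √(∫ x, ψ x ^ 2)) :
    MemLp f 2 (volume.restrict U) := by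
  let T : Submodule ℝ (Plane → ℝ) :=
    { carrier := {ψ | IsTest ψ ∧ tsupport ψ ⊆ U}
      add_mem' := fun {a b} ha hb => ⟨⟨ha.1.1.add hb.1.1, ha.1.2.add hb.1.2⟩,
        (tsupport_add a b).trans (Set.union_subset ha.2 hb.2)⟩
      zero_mem' := ⟨⟨contDiff_const, HasCompactSupport.zero⟩, by simp [tsupport]⟩
      smul_mem' := fun c a ha => ⟨⟨contDiff_const.smul ha.1.1, ha.1.2.smul_left⟩,
        (tsupport_smul_subset_right (fun _ => c) a).trans ha.2⟩ }
  have hL : ∀ ψ : T, MemLp ψ.1 2 volume := fun ψ => ψ.2.1.1.continuous.memLp_two ψ.2.1.2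
  have hfi : ∀ ψ : T, Integrable fun x => ψ.1 x * f x := fun ψ => by
    simpa [mul_comm] using hf.integrable_mul_test ψ.2.1.1.continuous ψ.2.1.2
  let ι : T →ₗ[ℝ] Lp ℝ 2 (volume : Measure Plane) :=
    { toFun := fun ψ => (hL ψ).toLp ψ.1
      map_add' := fun a b => MemLp.toLp_add (hL a) (hL b)
      map_smul' := fun c a => MemLp.toLp_const_smul c (hL a) }
  let ℓ : T →ₗ[ℝ] ℝ :=
    { toFun := fun ψ => ∫ x, ψ.1 x * f x
      map_add' := fun a b => by
        rw [← integral_add (hfi a) (hfi b)]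
        congr 1; ext x; simp [add_mul]
      map_smul' := fun c a => by
        rw [RingHom.id_apply, smul_eq_mul, ← integral_const_mul]
        congr 1; ext x; simp [mul_assoc] }
  -- Continuous functions equal almost everywhere are equal, so the functional `ℓ` descends to the
  -- image of the test functions in `L²`.
  have hι : Function.Injective ι := by
    intro a b hab
    have h1 : a.1 =ᵐ[volume] b.1 := (MemLp.toLp_eq_toLp_iff (hL a) (hL b)).1 hab
    exact Subtype.ext ((Continuous.ae_eq_iff_eq volume a.2.1.1.continuous b.2.1.1.continuous).1 h1)
  have hnorm : ∀ ψ : T, ‖ι ψ‖ = √(∫ x, ψ.1 x ^ 2) := by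
    intro ψ
    change ‖(hL ψ).toLp ψ.1‖ = _
    rw [eq_comm, Real.sqrt_eq_iff_mul_self_eq (integral_nonneg fun x => sq_nonneg _) (norm_nonneg _),
      ← pow_two, ← real_inner_self_eq_norm_sq, L2.inner_def]
    refine integral_congr_ae ?_
    filter_upwards [(hL ψ).coeFn_toLp] with x hx
    rw [hx]; simp [pow_two]
  let e : T ≃ₗ[ℝ] LinearMap.range ι := LinearEquiv.ofInjective ι hι
  let ℓ' : StrongDual ℝ (LinearMap.range ι) :=
    LinearMap.mkContinuous (ℓ ∘ₗ e.symm.toLinearMap) C (fun v => by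
      obtain ⟨ψ, rfl⟩ := e.surjective v
      have h2 := h ψ.1 ψ.2.1 ψ.2.2
      rw [← hnorm] at h2
      rw [LinearMap.comp_apply, LinearEquiv.coe_coe, LinearEquiv.symm_apply_apply]
      exact h2)
  -- Hahn–Banach extends the functional to all of `L²` and Riesz represents it by `F`; then `f - F`
  -- annihilates every test function supported in `U`, hence vanishes on `U`.
  obtain ⟨L, hLext, -⟩ := exists_extension_norm_eq _ ℓ'
  set F := (InnerProductSpace.toDual ℝ (Lp ℝ 2 (volume : Measure Plane))).symm L with hF
  have hFm : MemLp F 2 volume := Lp.memLp F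
  have hFi : LocallyIntegrable F := hFm.locallyIntegrable (by norm_num)
  have hpair : ∀ ψ : T, ∫ x, ψ.1 x * f x = ∫ x, ψ.1 x * F x := by
    intro ψ
    have h1 : L (ι ψ) = ∫ x, ψ.1 x * f x := by
      have h3 := hLext (e ψ)
      have h4 : ((e ψ : LinearMap.range ι) : Lp ℝ 2 (volume : Measure Plane)) = ι ψ := rfl
      rw [h4] at h3
      rw [h3]
      simp [ℓ', ℓ]
    rw [← h1, ← InnerProductSpace.toDual_symm_apply (𝕜 := ℝ) (y := L), ← hF, L2.inner_def]
    refine integral_congr_ae ?_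
    filter_upwards [(hL ψ).coeFn_toLp] with x hx
    change ⟪F x, ((hL ψ).toLp ψ.1) x⟫ = _
    rw [hx]; simp
  have hae : ∀ᵐ x : Plane, x ∈ U → (f x - F x) = 0 := by
    refine hU.ae_eq_zero_of_integral_contDiff_smul_eq_zero
      ((hf.sub hFi).locallyIntegrableOn U) fun ψ h1 h2 h3 => ?_
    have hp := hpair ⟨ψ, ⟨h1, h2⟩, h3⟩
    have hFi' : Integrable fun x => ψ x * F x := by
      simpa [mul_comm] using hFi.integrable_mul_test h1.continuous h2
    simp only [smul_eq_mul, mul_sub]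
    rw [integral_sub (hfi ⟨ψ, ⟨h1, h2⟩, h3⟩) hFi']
    exact sub_eq_zero.2 hp
  refine (hFm.restrict U).ae_eq ?_
  filter_upwards [(ae_restrict_iff' hU.measurableSet).2 hae] with x hx
  exact (sub_eq_zero.1 hx).symm

/-! ### Local square integrability of the field and absence of atoms. -/

section

variable {μ : SignedMeasure Plane} {ν : Measure Plane} {σ : Plane → ℝ}

lemma abs_integral_mul_le_sqrt {X : Type*} [MeasurableSpace X] {m : Measure X} {f h : X → ℝ}
    (hf : MemLp f 2 m) (hh : MemLp h 2 m) :
    |∫ x, f x * h x ∂m| ≤ √(∫ x, f x ^ 2 ∂m) * √(∫ x, h x ^ 2 ∂m) := by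
  have h3 := integral_mul_le_Lp_mul_Lq_of_nonneg (μ := m)
    Real.HolderConjugate.two_two (f := fun x => |f x|) (g := fun x => |h x|)
    (.of_forall fun x => abs_nonneg _) (.of_forall fun x => abs_nonneg _)
    (by rw [ENNReal.ofReal_ofNat]; exact hf.norm) (by rw [ENNReal.ofReal_ofNat]; exact hh.norm)
  simp only [← Real.sqrt_eq_rpow, Real.rpow_two, sq_abs] at h3
  refine (abs_integral_le_integral_abs).trans (le_trans (le_of_eq ?_) h3)
  simp only [abs_mul]

lemma conv_gradG_eq (ψ : Plane → ℝ) (j : Fin 2) (y : Plane) :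
    ∫ x, ψ x * gradG (x - y) j = -conv (fun z => gradG z j) ψ y := by
  rw [conv, ← integral_sub_left_eq_self (fun z => gradG z j * ψ (y - z)) volume y, ← integral_neg]
  congr 1; ext x
  rw [← neg_sub, gradG_neg, sub_sub_cancel]
  simp [mul_comm]

lemma exists_test_eq_one {R : ℝ} (hR : 0 < R) : ∃ χ : Plane → ℝ, IsTest χ ∧ (∀ x, |χ x| ≤ 1) ∧
    (∀ x ∈ Metric.ball (0 : Plane) R, χ x = 1) ∧ tsupport χ ⊆ Metric.ball 0 (R + 2) := by
  let b : ContDiffBump (0 : Plane) := ⟨R, R + 1, hR, by linarith⟩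
  refine ⟨b, ⟨b.contDiff, b.hasCompactSupport⟩, fun x => ?_, fun x hx => ?_, ?_⟩
  · rw [abs_of_nonneg b.nonneg]; exact b.le_one
  · exact b.one_of_mem_closedBall (Metric.ball_subset_closedBall hx)
  · rw [b.tsupport_eq]
    exact Metric.closedBall_subset_ball (by change R + 1 < R + 2; linarith)

/-- `∇g ∗ μ` is square integrable on balls. -/
lemma MemHNegOneLoc.memLp_field_coord (hμ : MemHNegOneLoc μ) (h : PolarDecomp μ ν σ) {R : ℝ}
    (hR : 0 < R) (j : Fin 2) :
    MemLp (fun x => field ν σ x j) 2 (volume.restrict (Metric.ball 0 R)) := by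
  have := h.isFiniteMeasure
  have hσ := h.isSign
  -- The margin `1` keeps the points where `χ ≠ 1` at distance at least `1` from the support of `ψ`,
  -- as the far field bound requires.
  obtain ⟨χ, hχ, hχ1, hχR, hχs⟩ := exists_test_eq_one (R := R + 1) (by linarith)
  have hχR' : ∀ x ∈ Metric.ball (0 : Plane) R, χ x = 1 := fun x hx =>
    hχR x (Metric.ball_subset_ball (by linarith) hx)
  obtain ⟨C₁, hC₁0, hC₁⟩ := hμ.exists_abs_integral_le h hχ
  obtain ⟨C₂, hC₂0, hC₂⟩ := exists_energy_le hχ hχ1 hχR' hχs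
  set K := √(volume.real (Metric.ball (0 : Plane) R)) with hK
  refine memLp_two_of_forall_test (locallyIntegrable_field_coord hσ j) Metric.isOpen_ball
    (C := C₁ * √C₂ + K * ν.real Set.univ) fun ψ hψ hs => ?_
  rw [integral_mul_field hσ hψ.1.continuous hψ.2]
  simp only [conv_gradG_eq]
  set w := conv (fun z => gradG z j) ψ with hw_def
  have hw : ContDiff ℝ ∞ w := contDiff_conv (locallyIntegrable_gradG_coord j) hψ
  have hu : IsTest fun x => χ x * w x := ⟨hχ.1.mul hw, hχ.2.mul_right⟩
  set A := ∫ x, ψ x ^ 2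
  have hfar : ∀ y, |(1 - χ y ^ 2) * w y| ≤ K * √A := by
    intro y
    by_cases hy : y ∈ Metric.ball (0 : Plane) (R + 1)
    · rw [hχR y hy]; simp; positivity
    · have hy' : R + 1 ≤ ‖y‖ := by simpa using hy
      rw [abs_mul]
      have h2 : |1 - χ y ^ 2| ≤ 1 := by
        have h3 := (sq_le_one_iff_abs_le_one _).2 (hχ1 y)
        rw [abs_le]; constructor <;> nlinarith [sq_nonneg (χ y)]
      exact (mul_le_of_le_one_left (abs_nonneg _) h2).trans (abs_conv_gradG_le_of_far hψ hs j hy')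
  have hcf : Continuous fun y => (1 - χ y ^ 2) * w y :=
    (continuous_const.sub (hχ.1.continuous.pow 2)).mul hw.continuous
  have hif : Integrable (fun y => (1 - χ y ^ 2) * w y) ν :=
    Integrable.of_bound hcf.aestronglyMeasurable (K * √A) (.of_forall hfar)
  have hin : Integrable (fun y => χ y * (χ y * w y)) ν :=
    (hχ.1.continuous.mul hu.1.continuous).integrable_of_hasCompactSupport hχ.2.mul_right
  -- In `1 = χ² + (1 - χ²)` one factor `χ` localizes `μ` and the other localizes `w`, so that `χ μ ∈
  -- H⁻¹` is paired with `χ w ∈ H¹`.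
  have hsplit : ∫ y, σ y * -w y ∂ν = -((∫ y, σ y * (χ y * (χ y * w y)) ∂ν) +
      ∫ y, σ y * ((1 - χ y ^ 2) * w y) ∂ν) := by
    have i1 : Integrable (fun y => σ y * (χ y * (χ y * w y))) ν := hσ.integrable_smul hin
    have i2 : Integrable (fun y => σ y * ((1 - χ y ^ 2) * w y)) ν := hσ.integrable_smul hif
    rw [← integral_add i1 i2, ← integral_neg]
    congr 1; ext y; ring
  have hE := hC₂ j ψ hψ hs
  have hnear := hC₁ _ hu
  have hfar' : |∫ y, σ y * ((1 - χ y ^ 2) * w y) ∂ν| ≤ K * √A * ν.real Set.univ := by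
    rw [← Real.norm_eq_abs]
    refine norm_integral_le_of_norm_le_const (.of_forall fun y => ?_)
    rw [norm_mul, Real.norm_eq_abs (σ y), hσ.abs_eq, one_mul]
    exact hfar y
  rw [hsplit, abs_neg]
  calc _ ≤ _ := abs_add_le _ _
    _ ≤ C₁ * √(C₂ * A) + K * √A * ν.real Set.univ := by
        refine add_le_add (hnear.trans ?_) hfar'
        exact mul_le_mul_of_nonneg_left (Real.sqrt_le_sqrt hE) hC₁0
    _ = _ := by rw [Real.sqrt_mul hC₂0]; ring

lemma norm_le_sum_abs_coord (v : Plane) : ‖v‖ ≤ |v 0| + |v 1| := by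
  refine abs_le_of_sq_le_sq' ?_ (by positivity) |>.2
  rw [norm_sq_eq_coord]
  nlinarith [sq_abs (v 0), sq_abs (v 1), mul_nonneg (abs_nonneg (v 0)) (abs_nonneg (v 1))]

lemma memLp_of_coord {X : Plane → Plane} {m : Measure Plane} {p : ℝ≥0∞}
    (hm : AEStronglyMeasurable X m) (h : ∀ j, MemLp (fun x => X x j) p m) : MemLp X p m := by
  refine ((h 0).norm.add (h 1).norm).mono hm (.of_forall fun x => ?_)
  refine (norm_le_sum_abs_coord _).trans (le_abs_self _)

lemma MemHNegOneLoc.memLp_field (hμ : MemHNegOneLoc μ) (h : PolarDecomp μ ν σ) {R : ℝ}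
    (hR : 0 < R) : MemLp (field ν σ) 2 (volume.restrict (Metric.ball 0 R)) :=
  have := h.isFiniteMeasure
  memLp_of_coord (aestronglyMeasurable_field h.isSign).restrict fun j => hμ.memLp_field_coord h hR j

lemma memLpLoc_of_ball {W : Type*} [NormedAddCommGroup W] {X : Plane → W} {p : ℝ≥0∞}
    (h : ∀ R : ℝ, 0 < R → MemLp X p (volume.restrict (Metric.ball 0 R))) : MemLpLoc X p := by
  intro K hK
  obtain ⟨R, hR⟩ := hK.isBounded.subset_ball (0 : Plane)
  exact (h (max R 1) (by positivity)).mono_measure (Measure.restrict_mono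
    (hR.trans (Metric.ball_subset_ball (le_max_left _ _))) le_rfl)

lemma MemHNegOneLoc.memLpLoc_gradGConv (hμ : MemHNegOneLoc μ) : MemLpLoc (gradGConv μ) 2 := by
  obtain ⟨ν, σ, h⟩ := exists_polarDecomp μ
  rw [h.gradGConv_eq]
  exact memLpLoc_of_ball fun R hR => hμ.memLp_field h hR

/-- A measure in `H^{-1}_loc` has no atoms. -/
lemma MemHNegOneLoc.measure_singleton (hμ : MemHNegOneLoc μ) (h : PolarDecomp μ ν σ) (a : Plane) :
    ν {a} = 0 := by
  have := h.isFiniteMeasure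
  have hσ := h.isSign
  let b : ContDiffBump (0 : Plane) := ⟨1, 2, one_pos, one_lt_two⟩
  have hb : IsTest b := ⟨b.contDiff, b.hasCompactSupport⟩
  let φ : ℕ → Plane → ℝ := fun n x => b (((n : ℝ) + 1) • (x - a))
  have hn0 : ∀ n : ℕ, (0 : ℝ) < n + 1 := fun n => by positivity
  have hφd : ∀ n, ContDiff ℝ ∞ (φ n) := fun n =>
    b.contDiff.comp (ContDiff.const_smul _ (contDiff_id.sub contDiff_const))
  -- The support has radius `2 / (n + 1)`; the larger `3` allows an open ball.
  have hsupp : ∀ (n : ℕ) (x : Plane), x ∉ Metric.ball a (3 / (n + 1)) →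
      ((n : ℝ) + 1) • (x - a) ∉ tsupport b := by
    intro n x hx hx'
    rw [b.tsupport_eq, mem_closedBall_zero_iff, norm_smul, Real.norm_of_nonneg (hn0 n).le] at hx'
    apply hx
    rw [mem_ball_iff_norm, lt_div_iff₀ (hn0 n), mul_comm]
    exact hx'.trans_lt (by norm_num [b])
  have hφc : ∀ n, HasCompactSupport (φ n) := fun n => by
    refine HasCompactSupport.of_support_subset_isCompact (isCompact_closedBall a (3 / (n + 1)))
      fun x hx => ?_
    by_contra hx'
    exact hx (image_eq_zero_of_notMem_tsupport (f := b)
      (hsupp n x fun h => hx' (Metric.ball_subset_closedBall h)))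
  have hpd : ∀ n j x, pd j (φ n) x = (n + 1) * pd j b (((n : ℝ) + 1) • (x - a)) := by
    intro n j x
    have h1 : HasFDerivAt (fun x : Plane => ((n : ℝ) + 1) • (x - a))
        (((n : ℝ) + 1) • ContinuousLinearMap.id ℝ Plane) x :=
      by
      exact HasFDerivAt.const_smul (f := fun x : Plane => x - a) ((hasFDerivAt_id x).sub_const a)
        ((n : ℝ) + 1)
    have h2 := ((b.contDiff (n := 1)).differentiable (by norm_num)
      (((n : ℝ) + 1) • (x - a))).hasFDerivAt.comp x h1
    simp only [pd]
    rw [show φ n = b ∘ fun x : Plane => ((n : ℝ) + 1) • (x - a) from rfl, h2.fderiv]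
    simp
  -- Scale invariance in dimension two: the factor `(n + 1)²` from the squared gradient cancels the
  -- Jacobian.
  have hsq : ∀ n j, ∫ x, pd j (φ n) x ^ 2 = ∫ x, pd j b x ^ 2 := by
    intro n j
    simp only [hpd, mul_pow]
    rw [integral_const_mul, integral_sub_right_eq_self
      (fun x => pd j b (((n : ℝ) + 1) • x) ^ 2) a,
      Measure.integral_comp_smul volume (fun x => pd j b x ^ 2)]
    have h3 : ((n : ℝ) + 1) ≠ 0 := (hn0 n).ne'
    simp only [finrank_euclideanSpace, Fintype.card_fin, smul_eq_mul]
    rw [abs_of_nonneg (by positivity)]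
    field_simp
  have hball : ∀ n : ℕ, Metric.ball a (3 / ((n : ℝ) + 1)) ⊆ Metric.ball 0 (‖a‖ + 4) := by
    intro n x hx
    rw [mem_ball_iff_norm] at hx
    rw [mem_ball_zero_iff]
    have h3 : (3 : ℝ) / (n + 1) ≤ 3 := div_le_self (by norm_num) (by linarith [n.cast_nonneg (α := ℝ)])
    linarith [norm_le_norm_add_norm_sub' x a]
  have hX : ∀ j, MemLp (fun x => field ν σ x j) 2 (volume.restrict (Metric.ball 0 (‖a‖ + 4))) :=
    fun j => hμ.memLp_field_coord h (by positivity) j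
  -- Cauchy–Schwarz: the gradient norm is constant in `n`, while the `L²` mass of the field on the
  -- shrinking balls tends to zero.
  have hterm : ∀ j, Tendsto (fun n => ∫ x, pd j (φ n) x * field ν σ x j) atTop (𝓝 0) := by
    intro j
    have h4 : Tendsto (fun n : ℕ => ∫ x in Metric.ball a (3 / ((n : ℝ) + 1)), field ν σ x j ^ 2)
        atTop (𝓝 0) := by
      have hi := (hX j).integrable_sq
      have e : ∀ n : ℕ, ∫ x in Metric.ball a (3 / ((n : ℝ) + 1)), field ν σ x j ^ 2 =
          ∫ x in Metric.ball a (3 / ((n : ℝ) + 1)), field ν σ x j ^ 2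
            ∂(volume.restrict (Metric.ball 0 (‖a‖ + 4))) := fun n => by
        rw [Measure.restrict_restrict measurableSet_ball, Set.inter_eq_left.2 (hball n)]
      simp only [e]
      refine hi.tendsto_setIntegral_nhds_zero ?_
      refine tendsto_of_tendsto_of_tendsto_of_le_of_le tendsto_const_nhds ?_ (fun n => zero_le)
        (fun n => Measure.restrict_le_self _)
      simp only [EuclideanSpace.volume_ball_fin_two]
      have h5 : Tendsto (fun n : ℕ => (3 : ℝ) / (n + 1)) atTop (𝓝 0) := by
        simpa [div_eq_mul_inv] using (tendsto_one_div_add_atTop_nhds_zero_nat (𝕜 := ℝ)).const_mul 3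
      have h6 := ENNReal.tendsto_ofReal (h5.pow 2)
      simp only [ENNReal.ofReal_pow (div_nonneg (by norm_num : (0:ℝ) ≤ 3) (hn0 _).le)] at h6
      simpa using ENNReal.Tendsto.mul_const (b := ENNReal.ofReal Real.pi) h6
        (Or.inr ENNReal.ofReal_ne_top)
    refine squeeze_zero_norm (a := fun n : ℕ => √(∫ x, pd j b x ^ 2) *
      √(∫ x in Metric.ball a (3 / ((n : ℝ) + 1)), field ν σ x j ^ 2)) (fun n => ?_) ?_
    · have hz : ∀ x, x ∉ Metric.ball a (3 / ((n : ℝ) + 1)) → pd j (φ n) x = 0 := fun x hx => by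
        rw [hpd, image_eq_zero_of_notMem_tsupport fun h => hsupp n x hx (tsupport_pd_subset _ j h),
          mul_zero]
      have hL : MemLp (pd j (φ n)) 2 :=
        (continuous_pd (contDiff_infty.1 (hφd n) 1) j).memLp_two (hasCompactSupport_pd (hφc n) j)
      rw [← setIntegral_eq_integral_of_forall_compl_eq_zero
        (s := Metric.ball a (3 / ((n : ℝ) + 1))) (fun x hx => by rw [hz x hx, zero_mul]),
        ← hsq n j, Real.norm_eq_abs]
      refine (abs_integral_mul_le_sqrt (hL.restrict _)
        ((hX j).mono_measure (Measure.restrict_mono (hball n) le_rfl))).trans ?_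
      exact mul_le_mul_of_nonneg_right (Real.sqrt_le_sqrt (setIntegral_le_integral
        hL.integrable_sq (.of_forall fun x => sq_nonneg _))) (Real.sqrt_nonneg _)
    · simpa using (h4.sqrt).const_mul (√(∫ x, pd j b x ^ 2))
  have hlim0 : Tendsto (fun n => cd * ∫ y, σ y * φ n y ∂ν) atTop (𝓝 0) := by
    have := (hterm 0).add (hterm 1)
    simp only [integral_field_div hσ (contDiff_infty.1 (hφd _) 1) (hφc _), add_zero] at this
    exact this
  have hlim1 : Tendsto (fun n => ∫ y, σ y * φ n y ∂ν) atTop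
      (𝓝 (∫ y, ({a} : Set Plane).indicator σ y ∂ν)) := by
    refine tendsto_integral_of_dominated_convergence (fun _ => 1)
      (fun n => (hσ.1.mul (hφd n).continuous.measurable).aestronglyMeasurable)
      (integrable_const _) (fun n => .of_forall fun y => ?_) (.of_forall fun y => ?_)
    · rw [norm_mul, Real.norm_eq_abs, hσ.abs_eq, one_mul, Real.norm_of_nonneg b.nonneg]
      exact b.le_one
    · by_cases hy : y = a
      · subst hy
        have : ∀ n, φ n y = 1 := fun n => by
          simp only [φ, sub_self, smul_zero]
          exact b.one_of_mem_closedBall (by simp [b])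
        simp [this]
      · rw [Set.indicator_of_notMem (by simpa using hy)]
        have hya : 0 < ‖y - a‖ := norm_pos_iff.2 (sub_ne_zero.2 hy)
        obtain ⟨N, hN⟩ := exists_nat_gt (3 / ‖y - a‖)
        refine tendsto_const_nhds.congr' ?_
        filter_upwards [eventually_ge_atTop N] with n hn
        have : φ n y = 0 := image_eq_zero_of_notMem_tsupport (f := b) (hsupp n y ?_)
        · rw [this, mul_zero]
        · rw [mem_ball_iff_norm, not_lt, div_le_iff₀ (hn0 n)]
          rw [div_lt_iff₀ hya] at hN
          have : (N : ℝ) ≤ n := by exact_mod_cast hn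
          nlinarith
  have hval : ∫ y, ({a} : Set Plane).indicator σ y ∂ν = ν.real {a} * σ a := by
    rw [integral_indicator (measurableSet_singleton a), Measure.restrict_singleton,
      integral_smul_measure, integral_dirac]
    rfl
  have h0 := tendsto_nhds_unique (hlim1.const_mul cd) hlim0
  rw [hval] at h0
  have hcd : cd ≠ 0 := by unfold cd; positivity
  have hsa : σ a ≠ 0 := by rcases hσ.2 a with h | h <;> rw [h] <;> norm_num
  have h1 : ν.real {a} = 0 := by
    simpa [hcd, hsa] using h0
  exact (measureReal_eq_zero_iff).1 h1

lemma MemHNegOneLoc.measure_diagonal (hμ : MemHNegOneLoc μ) (h : PolarDecomp μ ν σ) :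
    (ν.prod ν) (Set.diagonal Plane) = 0 := by
  have := h.isFiniteMeasure
  rw [Measure.prod_apply measurableSet_diagonal]
  refine (lintegral_congr fun x => ?_).trans lintegral_zero
  rw [show (Prod.mk x ⁻¹' Set.diagonal Plane) = {x} by ext y; simp [eq_comm]]
  exact hμ.measure_singleton h x

end

/-! ### Mollification and convergence in `L²_loc`. -/

/-- Continuity of translations in `L²`. -/
lemma tendsto_lintegral_translate_sub {f : Plane → ℝ} (hf : MemLp f 2) :
    Tendsto (fun s : Plane => ∫⁻ x, ‖f (x - s) - f x‖ₑ ^ (2 : ℝ)) (𝓝 0) (𝓝 0) := by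
  let G : C(Plane, C(Plane, Plane)) :=
    (ContinuousMap.mk (fun p : Plane × Plane => p.2 - p.1) (by fun_prop)).curry
  have hG : ∀ s : Plane, MeasurePreserving (G s) volume volume := fun s =>
    measurePreserving_sub_right volume s
  have h1 : Tendsto (fun s => Lp.compMeasurePreserving (G s) (hG s) (hf.toLp f)) (𝓝 0)
      (𝓝 (Lp.compMeasurePreserving (G 0) (hG 0) (hf.toLp f))) :=
    Filter.Tendsto.compMeasurePreservingLp tendsto_const_nhds (G.continuous.tendsto 0) hG (hG 0)
      (by norm_num)
  have h2 := (tendsto_iff_edist_tendsto_0.1 h1).ennrpow_const 2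
  rw [ENNReal.zero_rpow_of_pos (by norm_num)] at h2
  refine h2.congr fun s => ?_
  rw [Lp.toLp_compMeasurePreserving, Lp.toLp_compMeasurePreserving, Lp.edist_toLp_toLp,
    eLpNorm_eq_lintegral_rpow_enorm_toReal (by norm_num) (by norm_num), ← ENNReal.rpow_mul]
  simp [G]

/-- A smooth probability density supported in the unit ball. -/
def unitBump : ContDiffBump (0 : Plane) := ⟨1 / 2, 1, by norm_num, by norm_num⟩

/-- The standard mollifier. -/
def stdMoll : Plane → ℝ := unitBump.normed volume

/-- The probability measure whose density is the standard mollifier. -/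
def mollMeasure : Measure Plane := volume.withDensity fun x => ENNReal.ofReal (stdMoll x)

/-- The mollifier at scale `r`. -/
def moll (r : ℝ) (x : Plane) : ℝ := (r ^ 2)⁻¹ * stdMoll (r⁻¹ • x)

lemma isTest_stdMoll : IsTest stdMoll :=
  ⟨unitBump.contDiff_normed, unitBump.hasCompactSupport_normed⟩

lemma stdMoll_nonneg (x : Plane) : 0 ≤ stdMoll x := unitBump.nonneg_normed x

lemma integral_mollMeasure {W : Type*} [NormedAddCommGroup W] [NormedSpace ℝ W] (f : Plane → W) :
    ∫ x, f x ∂mollMeasure = ∫ x, stdMoll x • f x := by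
  rw [mollMeasure, integral_withDensity_eq_integral_toReal_smul
    isTest_stdMoll.1.continuous.measurable.ennreal_ofReal (.of_forall fun x => ENNReal.ofReal_lt_top)]
  simp [ENNReal.toReal_ofReal (stdMoll_nonneg _)]

instance : IsProbabilityMeasure mollMeasure := by
  constructor
  have hi : Integrable stdMoll := unitBump.integrable_normed
  rw [mollMeasure, withDensity_apply _ MeasurableSet.univ, Measure.restrict_univ,
    ← ofReal_integral_eq_lintegral_ofReal hi (.of_forall stdMoll_nonneg)]
  rw [show ∫ x, stdMoll x = 1 from unitBump.integral_normed]
  simp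

lemma stdMoll_eq_zero {x : Plane} (hx : 1 < ‖x‖) : stdMoll x = 0 := by
  refine image_eq_zero_of_notMem_tsupport fun h => ?_
  rw [stdMoll, unitBump.tsupport_normed_eq, mem_closedBall_zero_iff] at h
  exact absurd h (not_le.2 hx)

lemma ae_norm_le_mollMeasure : ∀ᵐ s ∂mollMeasure, ‖s‖ ≤ 1 := by
  rw [mollMeasure, ae_withDensity_iff isTest_stdMoll.1.continuous.measurable.ennreal_ofReal]
  refine .of_forall fun x hx => ?_
  by_contra h
  exact hx (by rw [stdMoll_eq_zero (not_le.1 h), ENNReal.ofReal_zero])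

lemma isTest_moll {r : ℝ} (hr : 0 < r) : IsTest (moll r) := by
  refine ⟨contDiff_const.mul (isTest_stdMoll.1.comp (contDiff_const_smul _)), ?_⟩
  refine HasCompactSupport.mul_left (isTest_stdMoll.2.comp_homeomorph
    (Homeomorph.smulOfNeZero (r⁻¹) (inv_ne_zero hr.ne')))

/-- Rescaling turns mollification at any scale into an average against one fixed probability
measure, with `r` appearing only in the argument. -/
lemma integral_mul_moll {r : ℝ} (hr : 0 < r) (f : Plane → ℝ) :
    ∫ x, f x * moll r x = ∫ s, f (r • s) ∂mollMeasure := by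
  rw [integral_mollMeasure]
  have h := Measure.integral_comp_smul volume (fun x => f x * moll r x) r
  have h2 : ∀ x : Plane, f (r • x) * moll r (r • x) = (r ^ 2)⁻¹ * (stdMoll x • f (r • x)) := by
    intro x
    rw [moll, smul_smul, inv_mul_cancel₀ hr.ne', one_smul, smul_eq_mul]
    ring
  simp only [h2, finrank_euclideanSpace, Fintype.card_fin, smul_eq_mul] at h
  rw [integral_const_mul, abs_of_nonneg (by positivity)] at h
  exact (mul_left_cancel₀ (by positivity) h).symm

lemma conv_moll {r : ℝ} (hr : 0 < r) (f : Plane → ℝ) (x : Plane) :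
    conv f (moll r) x = ∫ s, f (x - r • s) ∂mollMeasure := by
  rw [conv, ← integral_sub_left_eq_self (fun z => f z * moll r (x - z)) volume x,
    ← integral_mul_moll hr fun u => f (x - u)]
  simp

lemma integrable_mollMeasure_sub {r : ℝ} (hr : 0 < r) {f : Plane → ℝ} (hf : LocallyIntegrable f)
    (x : Plane) : Integrable (fun s => f (x - r • s)) mollMeasure := by
  rw [mollMeasure, integrable_withDensity_iff_integrable_smul'
    isTest_stdMoll.1.continuous.measurable.ennreal_ofReal (.of_forall fun x => ENNReal.ofReal_lt_top)]
  have h1 : Integrable fun z => f z * moll r (x - z) :=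
    hf.integrable_mul_test ((isTest_moll hr).1.continuous.comp (continuous_const.sub continuous_id))
      ((isTest_moll hr).2.comp_homeomorph (Homeomorph.subLeft x))
  have h2 := ((h1.comp_sub_left x).comp_smul hr.ne').const_mul (r ^ 2)
  refine h2.congr (.of_forall fun s => ?_)
  simp only [sub_sub_cancel, moll, smul_smul, inv_mul_cancel₀ hr.ne', one_smul,
    ENNReal.toReal_ofReal (stdMoll_nonneg _), smul_eq_mul]
  field_simp

lemma memLp_ball_of_continuous {f : Plane → ℝ} (hf : Continuous f) (p : ℝ≥0∞) (R : ℝ) :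
    MemLp f p (volume.restrict (Metric.ball 0 R)) := by
  have := isFiniteMeasure_restrict_ball R
  obtain ⟨M, hM⟩ := (isCompact_closedBall (0 : Plane) R).exists_bound_of_continuousOn hf.continuousOn
  refine MemLp.of_bound hf.aestronglyMeasurable M ?_
  exact (ae_restrict_iff' measurableSet_ball).2
    (.of_forall fun x hx => hM x (Metric.ball_subset_closedBall hx))

/-- For `r < 1` only values of `f` on the ball of radius `R + 1` matter, so `f` may be truncated to
a global `L²` function. Jensen and Tonelli then bound the error by an average of `L²` translation
errors. Genuine measurability makes the translated difference jointly measurable, as Tonelli needs.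
-/
lemma tendsto_integral_conv_moll_sub_sq_of_measurable {f : Plane → ℝ} (hfm : Measurable f)
    (hf : LocallyIntegrable f) (h2 : ∀ R : ℝ, 0 < R → MemLp f 2 (volume.restrict (Metric.ball 0 R)))
    {R : ℝ} (hR : 0 < R) :
    Tendsto (fun r => ∫ x in Metric.ball (0 : Plane) R, (conv f (moll r) x - f x) ^ 2)
      (𝓝[>] 0) (𝓝 0) := by
  set f' : Plane → ℝ := (Metric.ball (0 : Plane) (R + 1)).indicator f with hf'
  have hf'm : Measurable f' := hfm.indicator measurableSet_ball
  have hf'2 : MemLp f' 2 := (memLp_indicator_iff_restrict measurableSet_ball).2 (h2 (R + 1) (by linarith))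
  have hΩ := tendsto_lintegral_translate_sub hf'2
  rw [Metric.tendsto_nhds]
  intro ε hε
  have hΩε := hΩ.eventually (gt_mem_nhds (ENNReal.ofReal_pos.2 (half_pos hε)))
  obtain ⟨d, hd, hΩd⟩ := Metric.eventually_nhds_iff.1 hΩε
  filter_upwards [Ioo_mem_nhdsGT (lt_min hd one_pos)] with r hr
  have hr0 : 0 < r := hr.1
  have hrd : r < d := hr.2.trans_le (min_le_left _ _)
  have hr1 : r < 1 := hr.2.trans_le (min_le_right _ _)
  have hcL : MemLp (fun x => conv f (moll r) x - f x) 2 (volume.restrict (Metric.ball 0 R)) :=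
    (memLp_ball_of_continuous (contDiff_conv hf (isTest_moll hr0)).continuous 2 R).sub (h2 R hR)
  have hpt : ∀ x ∈ Metric.ball (0 : Plane) R, ‖conv f (moll r) x - f x‖ₑ ^ (2 : ℝ) ≤
      ∫⁻ s, ‖f' (x - r • s) - f' x‖ₑ ^ (2 : ℝ) ∂mollMeasure := by
    intro x hx
    have hxR : x ∈ Metric.ball (0 : Plane) (R + 1) := Metric.ball_subset_ball (by linarith) hx
    have e1 : conv f (moll r) x - f x = ∫ s, (f' (x - r • s) - f' x) ∂mollMeasure := by
      rw [conv_moll hr0]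
      have e2 : ∀ᵐ s ∂mollMeasure, f' (x - r • s) - f' x = f (x - r • s) - f x := by
        filter_upwards [ae_norm_le_mollMeasure] with s hs
        have : x - r • s ∈ Metric.ball (0 : Plane) (R + 1) := by
          rw [mem_ball_zero_iff] at hx ⊢
          have h3 : ‖r • s‖ ≤ 1 := by
            rw [norm_smul, Real.norm_of_nonneg hr0.le]
            nlinarith [norm_nonneg s]
          linarith [norm_sub_le x (r • s)]
        rw [hf', Set.indicator_of_mem this, Set.indicator_of_mem hxR]
      rw [integral_congr_ae e2, integral_sub (integrable_mollMeasure_sub hr0 hf x)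
        (integrable_const _)]
      simp
    rw [e1]
    have hm : AEMeasurable (fun s => ‖f' (x - r • s) - f' x‖ₑ) mollMeasure :=
      ((hf'm.comp (by fun_prop : Measurable fun s : Plane => x - r • s)).sub
        measurable_const).enorm.aemeasurable
    have h4 := lintegral_rpow_le mollMeasure one_lt_two hm
    rw [measure_univ, ENNReal.one_rpow, one_mul] at h4
    refine le_trans ?_ h4
    gcongr
    exact enorm_integral_le_lintegral_enorm _
  have hle : ENNReal.ofReal (∫ x in Metric.ball (0 : Plane) R, (conv f (moll r) x - f x) ^ 2) ≤
      ENNReal.ofReal (ε / 2) := by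
    rw [ofReal_integral_sq hcL]
    have hm : Measurable fun p : Plane × Plane => ‖f' (p.1 - r • p.2) - f' p.1‖ₑ ^ (2 : ℝ) :=
      (((hf'm.comp (by fun_prop : Measurable fun p : Plane × Plane => p.1 - r • p.2)).sub
        (hf'm.comp measurable_fst)).enorm).pow_const _
    calc _ ≤ ∫⁻ x in Metric.ball (0 : Plane) R,
          ∫⁻ s, ‖f' (x - r • s) - f' x‖ₑ ^ (2 : ℝ) ∂mollMeasure :=
          setLIntegral_mono' measurableSet_ball hpt
      _ ≤ ∫⁻ x, ∫⁻ s, ‖f' (x - r • s) - f' x‖ₑ ^ (2 : ℝ) ∂mollMeasure := setLIntegral_le_lintegral _ _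
      _ = ∫⁻ s, ∫⁻ x, ‖f' (x - r • s) - f' x‖ₑ ^ (2 : ℝ) ∂volume ∂mollMeasure :=
          lintegral_lintegral_swap hm.aemeasurable
      _ ≤ ∫⁻ _, ENNReal.ofReal (ε / 2) ∂mollMeasure := by
          refine lintegral_mono_ae ?_
          filter_upwards [ae_norm_le_mollMeasure] with s hs
          refine (hΩd ?_).le
          rw [dist_zero_right, norm_smul, Real.norm_of_nonneg hr0.le]
          nlinarith [norm_nonneg s]
      _ = _ := by simp
  rw [ENNReal.ofReal_le_ofReal_iff (by positivity)] at hle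
  rw [Real.dist_eq, sub_zero, abs_of_nonneg (integral_nonneg fun x => sq_nonneg _)]
  linarith

/-- Mollifications converge in `L²_loc`. -/
lemma tendsto_integral_conv_moll_sub_sq {f : Plane → ℝ}
    (hf : LocallyIntegrable f) (h2 : ∀ R : ℝ, 0 < R → MemLp f 2 (volume.restrict (Metric.ball 0 R)))
    {R : ℝ} (hR : 0 < R) :
    Tendsto (fun r => ∫ x in Metric.ball (0 : Plane) R, (conv f (moll r) x - f x) ^ 2)
      (𝓝[>] 0) (𝓝 0) := by
  have hm := hf.aestronglyMeasurable
  have hae := hm.ae_eq_mk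
  have hconv : ∀ r, conv f (moll r) = conv (hm.mk f) (moll r) := fun r => by
    ext x
    refine integral_congr_ae ?_
    filter_upwards [hae] with z hz
    rw [hz]
  have h := tendsto_integral_conv_moll_sub_sq_of_measurable hm.stronglyMeasurable_mk.measurable
    (hf.congr hae) (fun R hR => (h2 R hR).ae_eq (ae_restrict_of_ae hae)) hR
  refine h.congr fun r => ?_
  rw [hconv]
  refine integral_congr_ae (ae_restrict_of_ae ?_)
  filter_upwards [hae] with z hz
  rw [hz]

/-- Cauchy–Schwarz on each term of `F H - f h = (F - f)(H - h) + (F - f) h + f (H - h)`. -/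
lemma tendsto_integral_mul_of_L2 {X ι : Type*} [MeasurableSpace X] {m : Measure X} {l : Filter ι}
    {f h : X → ℝ} {F H : ι → X → ℝ} (hf : MemLp f 2 m) (hh : MemLp h 2 m)
    (hF : ∀ᶠ i in l, MemLp (F i) 2 m) (hH : ∀ᶠ i in l, MemLp (H i) 2 m)
    (hFf : Tendsto (fun i => ∫ x, (F i x - f x) ^ 2 ∂m) l (𝓝 0))
    (hHh : Tendsto (fun i => ∫ x, (H i x - h x) ^ 2 ∂m) l (𝓝 0)) :
    Tendsto (fun i => ∫ x, F i x * H i x ∂m) l (𝓝 (∫ x, f x * h x ∂m)) := by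
  rw [tendsto_iff_norm_sub_tendsto_zero]
  have hb : Tendsto (fun i => √(∫ x, (F i x - f x) ^ 2 ∂m) * √(∫ x, (H i x - h x) ^ 2 ∂m) +
      √(∫ x, (F i x - f x) ^ 2 ∂m) * √(∫ x, h x ^ 2 ∂m) +
      √(∫ x, f x ^ 2 ∂m) * √(∫ x, (H i x - h x) ^ 2 ∂m)) l (𝓝 0) := by
    simpa using ((hFf.sqrt.mul hHh.sqrt).add (hFf.sqrt.mul_const _)).add (hHh.sqrt.const_mul _)
  refine squeeze_zero' (.of_forall fun i => norm_nonneg _) ?_ hb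
  filter_upwards [hF, hH] with i hFi hHi
  have hd1 : MemLp (fun x => F i x - f x) 2 m := hFi.sub hf
  have hd2 : MemLp (fun x => H i x - h x) 2 m := hHi.sub hh
  have i1 : Integrable (fun x => (F i x - f x) * (H i x - h x)) m := hd1.integrable_mul hd2
  have i2 : Integrable (fun x => (F i x - f x) * h x) m := hd1.integrable_mul hh
  have i3 : Integrable (fun x => f x * (H i x - h x)) m := hf.integrable_mul hd2
  have i12 : Integrable (fun x => (F i x - f x) * (H i x - h x) + (F i x - f x) * h x) m := i1.add i2
  have e : (∫ x, F i x * H i x ∂m) - ∫ x, f x * h x ∂m =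
      (∫ x, (F i x - f x) * (H i x - h x) ∂m) + (∫ x, (F i x - f x) * h x ∂m) +
        ∫ x, f x * (H i x - h x) ∂m := by
    have j1 : Integrable (fun x => F i x * H i x) m := hFi.integrable_mul hHi
    have j2 : Integrable (fun x => f x * h x) m := hf.integrable_mul hh
    rw [← integral_sub j1 j2, ← integral_add i1 i2, ← integral_add i12 i3]
    congr 1; ext x; ring
  rw [e, Real.norm_eq_abs]
  exact (abs_add_three _ _ _).trans (add_le_add (add_le_add (abs_integral_mul_le_sqrt hd1 hd2)
    (abs_integral_mul_le_sqrt hd1 hh)) (abs_integral_mul_le_sqrt hf hd2))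

/-! ### The stress tensor identity for smooth curl-free fields. -/

lemma IsTest.coord {φ : Plane → Plane} (hφ : IsTest φ) (i : Fin 2) : IsTest fun x => φ x i :=
  ⟨(EuclideanSpace.proj (𝕜 := ℝ) i).contDiff.comp hφ.1,
    hφ.2.comp_left (g := fun v : Plane => v i) (by simp)⟩

lemma jac_eq_pd {φ : Plane → Plane} (hφ : IsTest φ) (x : Plane) (i j : Fin 2) :
    jac φ x i j = pd j (fun x => φ x i) x := by
  have h := (EuclideanSpace.proj (𝕜 := ℝ) i).hasFDerivAt.comp x
    ((hφ.1.differentiable (by simp)) x).hasFDerivAt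
  rw [pd, show (fun x => φ x i) = (EuclideanSpace.proj (𝕜 := ℝ) i) ∘ φ from rfl, h.fderiv]
  rfl

lemma frob_eq (A B : Matrix (Fin 2) (Fin 2) ℝ) :
    frob A B = A 0 0 * B 0 0 + A 0 1 * B 0 1 + (A 1 0 * B 1 0 + A 1 1 * B 1 1) := by
  simp [frob, Matrix.trace, Matrix.mul_apply, Fin.sum_univ_two]
  ring

/-- In the plane `[Y, Y]` is symmetric and trace-free, so only the products `Y₀²`, `Y₁²` and `Y₀ Y₁`
occur, each with a test function as coefficient. -/
lemma frob_jac_stress {φ : Plane → Plane} (hφ : IsTest φ) (Y : Plane → Plane) (x : Plane) :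
    frob (jac φ x) (stress Y x) =
      (pd 0 (fun x => φ x 0) x - pd 1 (fun x => φ x 1) x) * (Y x 0 * Y x 0) -
      (pd 0 (fun x => φ x 0) x - pd 1 (fun x => φ x 1) x) * (Y x 1 * Y x 1) +
      2 * ((pd 1 (fun x => φ x 0) x + pd 0 (fun x => φ x 1) x) * (Y x 0 * Y x 1)) := by
  rw [frob_eq]
  simp only [jac_eq_pd hφ, stress, norm_sq_eq_coord]
  simp
  ring

/-- The identity `∫ Dφ : [Y, Y] = -2 ∫ φ · Y div Y` for smooth curl-free fields. -/
lemma integral_frob_jac_stress {φ Y : Plane → Plane} (hφ : IsTest φ)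
    (hY : ∀ j, ContDiff ℝ ∞ fun x => Y x j)
    (hcurl : ∀ x, pd 1 (fun x => Y x 0) x = pd 0 (fun x => Y x 1) x) :
    ∫ x, frob (jac φ x) (stress Y x) =
      -2 * ∫ x, ⟪φ x, Y x⟫ * (pd 0 (fun x => Y x 0) x + pd 1 (fun x => Y x 1) x) := by
  set a := fun x => φ x 0 with ha_def
  set b := fun x => φ x 1 with hb_def
  set u := fun x => Y x 0 with hu_def
  set v := fun x => Y x 1 with hv_def
  have ha : IsTest a := hφ.coord 0
  have hb : IsTest b := hφ.coord 1
  have hu : ContDiff ℝ ∞ u := hY 0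
  have hv : ContDiff ℝ ∞ v := hY 1
  have d : ∀ {f : Plane → ℝ}, ContDiff ℝ ∞ f → Differentiable ℝ f := fun hf =>
    hf.differentiable (by simp)
  have c1 : ∀ {f : Plane → ℝ}, ContDiff ℝ ∞ f → ContDiff ℝ 1 f := fun hf => contDiff_infty.1 hf 1
  have key : ∀ (c p q : Plane → ℝ) (j : Fin 2), IsTest c → ContDiff ℝ ∞ p → ContDiff ℝ ∞ q →
      (Integrable fun x => (pd j c x * (p x * q x) + c x * (pd j p x * q x + p x * pd j q x))) ∧
      ∫ x, (pd j c x * (p x * q x) + c x * (pd j p x * q x + p x * pd j q x)) = 0 := by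
    intro c p q j hc hp hq
    have ht : IsTest fun x => c x * (p x * q x) := ⟨hc.1.mul (hp.mul hq), hc.2.mul_right⟩
    have e : ∀ x, pd j (fun x => c x * (p x * q x)) x =
        pd j c x * (p x * q x) + c x * (pd j p x * q x + p x * pd j q x) := fun x => by
      rw [pd_mul (h := fun x => p x * q x) (d hc.1 x) ((d hp x).mul (d hq x)),
        pd_mul (d hp x) (d hq x)]
    simp only [← e]
    exact ⟨(ht.pderiv j).1.continuous.integrable_of_hasCompactSupport (ht.pderiv j).2,
      integral_pd_eq_zero (c1 ht.1) ht.2 j⟩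
  have hadd : ∀ {f h : Plane → ℝ} (t : ℝ), (Integrable f ∧ ∫ x, f x = 0) →
      (Integrable h ∧ ∫ x, h x = 0) →
      (Integrable (fun x => f x + t * h x) ∧ ∫ x, (f x + t * h x) = 0) := fun t hf hh =>
    ⟨hf.1.add (hh.1.const_mul t), by
      rw [integral_add hf.1 (hh.1.const_mul t), integral_const_mul, hf.2, hh.2]; simp⟩
  -- The combination is `∑ ∂_j (φ_i [Y, Y]_{ij})`, with rows `(u² - v², 2uv)` and `(2uv, v² - u²)`.
  have hall := hadd 2 (hadd 1 (hadd (-1) (hadd 2 (hadd (-1) (key a u u 0 ha hu hu)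
    (key a v v 0 ha hv hv)) (key a u v 1 ha hu hv)) (key b u u 1 hb hu hu))
    (key b v v 1 hb hv hv)) (key b u v 0 hb hu hv)
  have hcont : Continuous fun x => ⟪φ x, Y x⟫ * (pd 0 u x + pd 1 v x) := by
    simp only [inner_eq_coord]
    exact ((ha.1.continuous.mul hu.continuous).add (hb.1.continuous.mul hv.continuous)).mul
      ((continuous_pd (c1 hu) 0).add (continuous_pd (c1 hv) 1))
  have hi : Integrable fun x => ⟪φ x, Y x⟫ * (pd 0 u x + pd 1 v x) :=
    hcont.integrable_of_hasCompactSupport (hφ.2.mono fun x hx h0 => hx (by simp [h0]))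
  have hadd' : ∀ {f : Plane → ℝ}, (Integrable f ∧ ∫ x, f x = 0) →
      (∀ x, frob (jac φ x) (stress Y x) = f x + -2 * (⟪φ x, Y x⟫ * (pd 0 u x + pd 1 v x))) →
      ∫ x, frob (jac φ x) (stress Y x) = -2 * ∫ x, ⟪φ x, Y x⟫ * (pd 0 u x + pd 1 v x) := by
    intro f hf he
    simp only [he]
    rw [integral_add hf.1 (hi.const_mul (-2)), integral_const_mul, hf.2, zero_add]
  refine hadd' hall fun x => ?_
  have hc := hcurl x
  rw [frob_jac_stress hφ, inner_eq_coord]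
  change (pd 0 a x - pd 1 b x) * (u x * u x) - (pd 0 a x - pd 1 b x) * (v x * v x) +
    2 * ((pd 1 a x + pd 0 b x) * (u x * v x)) = _
  change pd 1 u x = pd 0 v x at hc
  rw [hc]
  simp only [ha_def, hb_def, hu_def, hv_def]
  ring

/-! ### The smeared identity and its limit. -/

section

variable {μ : SignedMeasure Plane} {ν : Measure Plane} {σ : Plane → ℝ}

/-- By homogeneity `|∇g(y - r s)| = r⁻¹ |∇g(s - y / r)|`, and the mollifier is bounded with support
in the unit ball. The constant depends on `r`, which is fixed wherever the bound is used. -/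
lemma exists_lintegral_gradG_moll_le {r : ℝ} (hr : 0 < r) :
    ∃ C : ℝ≥0, ∀ y : Plane, ∫⁻ s, ‖gradG (y - r • s)‖ₑ ∂mollMeasure ≤ C := by
  obtain ⟨C, hC⟩ := exists_lintegral_gradG_le 2
  obtain ⟨M, hM⟩ := isTest_stdMoll.1.continuous.bounded_above_of_compact_support isTest_stdMoll.2
  refine ⟨(M * r⁻¹).toNNReal * C, fun y => ?_⟩
  have hm : Measurable fun s : Plane => ‖gradG (y - r • s)‖ₑ :=
    (measurable_gradG.comp (by fun_prop : Measurable fun s : Plane => y - r • s)).enorm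
  rw [mollMeasure, lintegral_withDensity_eq_lintegral_mul _
    isTest_stdMoll.1.continuous.measurable.ennreal_ofReal hm]
  calc _ ≤ ∫⁻ s, (Metric.ball (0 : Plane) 2).indicator
        (fun s => ENNReal.ofReal (M * r⁻¹) * ‖gradG (s - r⁻¹ • y)‖ₑ) s := by
        refine lintegral_mono fun s => ?_
        by_cases hs : s ∈ Metric.ball (0 : Plane) 2
        · rw [Set.indicator_of_mem hs, Pi.mul_apply]
          have hM' : stdMoll s ≤ M := (le_abs_self _).trans (hM s)
          have hM0 : 0 ≤ M := (stdMoll_nonneg s).trans hM'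
          have e : ‖gradG (y - r • s)‖ = r⁻¹ * ‖gradG (s - r⁻¹ • y)‖ := by
            rw [norm_gradG, norm_gradG, ← mul_inv]
            congr 1
            rw [← norm_neg (s - _), ← Real.norm_of_nonneg hr.le, ← norm_smul, neg_sub, smul_sub,
              smul_smul, Real.norm_of_nonneg hr.le, mul_inv_cancel₀ hr.ne', one_smul]
          rw [← ofReal_norm, ← ofReal_norm, e, ← ENNReal.ofReal_mul (stdMoll_nonneg s),
            ← ENNReal.ofReal_mul (by positivity)]
          refine ENNReal.ofReal_le_ofReal ?_
          rw [mul_assoc]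
          exact mul_le_mul_of_nonneg_right hM' (by positivity)
        · rw [Set.indicator_of_notMem hs, Pi.mul_apply, stdMoll_eq_zero]
          · simp
          · rw [mem_ball_zero_iff, not_lt] at hs
            linarith
    _ = ENNReal.ofReal (M * r⁻¹) * ∫⁻ s in Metric.ball (0 : Plane) 2, ‖gradG (s - r⁻¹ • y)‖ₑ := by
        rw [lintegral_indicator measurableSet_ball, lintegral_const_mul' _ _ ENNReal.ofReal_ne_top]
    _ ≤ _ := by
        rw [ENNReal.coe_mul]
        exact mul_le_mul_right (hC _) _

/-- The smeared product of a measure with the mollifier. -/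
def smear (ν : Measure Plane) : Measure (Plane × Plane) := ν.prod mollMeasure

/-- The translation of a point by a rescaled mollifier variable. -/
def shift (r : ℝ) (p : Plane × Plane) : Plane := p.1 + r • p.2

lemma continuous_shift (r : ℝ) : Continuous (shift r) := by unfold shift; fun_prop

@[fun_prop]
lemma measurable_shift (r : ℝ) : Measurable (shift r) := (continuous_shift r).measurable

instance [IsFiniteMeasure ν] : IsFiniteMeasure (smear ν) := by unfold smear; infer_instance

lemma exists_lintegral_gradG_smear_le [IsFiniteMeasure ν] {r : ℝ} (hr : 0 < r) :
    ∃ C : ℝ≥0, ∀ x : Plane, ∫⁻ q, ‖gradG (x - shift r q)‖ₑ ∂smear ν ≤ C := by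
  obtain ⟨C, hC⟩ := exists_lintegral_gradG_moll_le hr
  refine ⟨C * (ν Set.univ).toNNReal, fun x => ?_⟩
  have hm : Measurable fun q : Plane × Plane => ‖gradG (x - shift r q)‖ₑ :=
    (measurable_gradG.comp (by fun_prop)).enorm
  rw [smear, lintegral_prod _ hm.aemeasurable]
  calc _ ≤ ∫⁻ _, C ∂ν := lintegral_mono fun y => by
        simpa only [shift, sub_add_eq_sub_sub] using hC (x - y)
    _ = _ := by
        rw [lintegral_const, ENNReal.coe_mul, ENNReal.coe_toNNReal (measure_ne_top _ _)]

lemma integrable_gradG_smear [IsFiniteMeasure ν] {r : ℝ} (hr : 0 < r) (x : Plane) :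
    Integrable (fun q => gradG (x - shift r q)) (smear ν) := by
  obtain ⟨C, hC⟩ := exists_lintegral_gradG_smear_le (ν := ν) hr
  exact ⟨(measurable_gradG.comp (by fun_prop)).aestronglyMeasurable,
    (hC x).trans_lt ENNReal.coe_lt_top⟩

lemma IsSign.comp_fst {Y : Type*} [MeasurableSpace Y] (hσ : IsSign σ) :
    IsSign fun p : Plane × Y => σ p.1 :=
  ⟨hσ.1.comp measurable_fst, fun p => hσ.2 p.1⟩

/-- The mollification of `field ν σ`. -/
def mollField (ν : Measure Plane) (σ : Plane → ℝ) (r : ℝ) (x : Plane) : Plane :=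
  WithLp.toLp 2 fun j => conv (fun x => field ν σ x j) (moll r) x

/-- The mollification of the measure `σ ν`. -/
def mollDensity (ν : Measure Plane) (σ : Plane → ℝ) (r : ℝ) (x : Plane) : ℝ :=
  ∫ y, σ y * moll r (x - y) ∂ν

section

variable [IsFiniteMeasure ν] {r : ℝ}

lemma isTest_reflect {f : Plane → ℝ} (hf : IsTest f) (x : Plane) : IsTest fun z => f (x - z) :=
  ⟨hf.1.comp (contDiff_const.sub contDiff_id), hf.2.comp_homeomorph (Homeomorph.subLeft x)⟩

lemma pd_reflect {f : Plane → ℝ} (hf : IsTest f) (x z : Plane) (j : Fin 2) :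
    pd j (fun z => f (x - z)) z = -pd j f (x - z) := by
  have h := ((hf.1.differentiable (by simp)) (x - z)).hasFDerivAt.comp z
    ((hasFDerivAt_id z).const_sub x)
  simp only [pd]
  rw [show (fun z => f (x - z)) = f ∘ HSub.hSub x from rfl, h.fderiv]
  simp

/-- Mollifying the field amounts to smearing the charges, and this makes the mollified field an
absolutely convergent integral at every point. -/
lemma mollField_coord_eq (hσ : IsSign σ) (hr : 0 < r) (x : Plane) (j : Fin 2) :
    mollField ν σ r x j = ∫ q, σ q.1 * gradG (x - shift r q) j ∂smear ν := by
  have ht := isTest_reflect (isTest_moll hr) x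
  have hi : Integrable (fun q : Plane × Plane => σ q.1 * gradG (x - shift r q) j)
      (ν.prod mollMeasure) :=
    hσ.comp_fst.integrable_smul
      ((EuclideanSpace.proj (𝕜 := ℝ) j).integrable_comp (integrable_gradG_smear hr x))
  rw [smear, integral_prod _ hi]
  change conv (fun x => field ν σ x j) (moll r) x = _
  rw [conv]
  simp only [mul_comm _ (moll r _)]
  rw [integral_mul_field hσ ht.1.continuous ht.2]
  congr 1; ext y
  rw [integral_const_mul]
  congr 1
  rw [← integral_sub_left_eq_self (fun z => moll r (x - z) * gradG (z - y) j) volume x]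
  simp only [sub_sub_cancel, mul_comm (moll r _)]
  rw [integral_mul_moll hr fun z => gradG (x - z - y) j]
  simp only [shift, sub_add_eq_sub_sub, sub_right_comm x _ y]

lemma mollField_eq (hσ : IsSign σ) (hr : 0 < r) (x : Plane) :
    mollField ν σ r x = ∫ q, σ q.1 • gradG (x - shift r q) ∂smear ν := by
  ext j
  rw [mollField_coord_eq hσ hr, coord_integral (hσ.comp_fst.integrable_smul
    (integrable_gradG_smear hr x))]
  simp

lemma contDiff_mollField (hσ : IsSign σ) (hr : 0 < r) (j : Fin 2) :
    ContDiff ℝ ∞ fun x => mollField ν σ r x j :=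
  contDiff_conv (locallyIntegrable_field_coord hσ j) (isTest_moll hr)

lemma pd_mollField (hσ : IsSign σ) (hr : 0 < r) (i j : Fin 2) (x : Plane) :
    pd i (fun x => mollField ν σ r x j) x =
      -∫ z, pd i (fun z => moll r (x - z)) z * field ν σ z j := by
  change pd i (conv (fun x => field ν σ x j) (moll r)) x = _
  rw [pd_conv (locallyIntegrable_field_coord hσ j) (contDiff_infty.1 (isTest_moll hr).1 1)
    (isTest_moll hr).2, conv, ← integral_neg]
  congr 1; ext z
  rw [pd_reflect (isTest_moll hr)]
  ring

/-- The distributional divergence of the field, tested with the mollifier reflected about `x`. -/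
lemma div_mollField (hσ : IsSign σ) (hr : 0 < r) (x : Plane) :
    pd 0 (fun x => mollField ν σ r x 0) x + pd 1 (fun x => mollField ν σ r x 1) x =
      -cd * mollDensity ν σ r x := by
  have ht := isTest_reflect (isTest_moll hr) x
  rw [pd_mollField hσ hr, pd_mollField hσ hr, ← neg_add,
    integral_field_div hσ (contDiff_infty.1 ht.1 1) ht.2, mollDensity, neg_mul]

lemma curl_mollField (hσ : IsSign σ) (hr : 0 < r) (x : Plane) :
    pd 1 (fun x => mollField ν σ r x 0) x = pd 0 (fun x => mollField ν σ r x 1) x := by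
  have ht := isTest_reflect (isTest_moll hr) x
  rw [pd_mollField hσ hr, pd_mollField hσ hr, integral_field_curl hσ (contDiff_infty.1 ht.1 2) ht.2]

lemma integral_mul_mollDensity (hσ : IsSign σ) (hr : 0 < r) {u : Plane → ℝ} (hu : Continuous u)
    (hc : HasCompactSupport u) :
    ∫ x, u x * mollDensity ν σ r x = ∫ p, σ p.1 * u (shift r p) ∂smear ν := by
  obtain ⟨M, hM⟩ := (isTest_moll hr).1.continuous.bounded_above_of_compact_support (isTest_moll hr).2
  obtain ⟨M', hM'⟩ := hu.bounded_above_of_compact_support hc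
  have hi : Integrable (fun p : Plane × Plane => u p.1 * (σ p.2 * moll r (p.1 - p.2)))
      ((volume : Measure Plane).prod ν) := by
    have h1 := (hu.integrable_of_hasCompactSupport (μ := volume) hc).mul_prod
      (hσ.integrable (m := ν))
    refine (h1.mul_bdd (c := M) (f := fun p => u p.1 * σ p.2)
      (g := fun p : Plane × Plane => moll r (p.1 - p.2)) ?_ (.of_forall fun p => hM _)).congr
      (.of_forall fun p => ?_)
    · exact ((isTest_moll hr).1.continuous.comp (by fun_prop)).aestronglyMeasurable
    · simp only; ring
  have hi2 : Integrable (fun p : Plane × Plane => σ p.1 * u (shift r p)) (ν.prod mollMeasure) :=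
    hσ.comp_fst.integrable_smul (Integrable.of_bound
      (hu.comp (continuous_shift r)).aestronglyMeasurable M' (.of_forall fun p => hM' _))
  rw [smear, integral_prod _ hi2]
  simp only [mollDensity, ← integral_const_mul]
  rw [integral_integral_swap hi]
  congr 1; ext y
  rw [integral_const_mul]
  simp only [mul_left_comm (u _) (σ y)]
  rw [integral_const_mul]
  congr 1
  rw [← integral_add_right_eq_self (fun x => u x * moll r (x - y)) y]
  simp only [add_sub_cancel_right]
  rw [integral_mul_moll hr fun x => u (x + y)]
  simp only [shift, add_comm]

end

/-- The Lipschitz bound on `φ` cancels the singularity `|x - y|⁻¹`; on the diagonal the kernel is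
`0`. -/
lemma exists_abs_symKernel_gradG_le {φ : Plane → Plane} (hφ : IsTest φ) :
    ∃ M : ℝ, 0 ≤ M ∧ ∀ z, |symKernel gradG φ z| ≤ M := by
  obtain ⟨L, hL⟩ := ContDiff.lipschitzWith_of_hasCompactSupport hφ.2 hφ.1 (by simp)
  refine ⟨L, L.2, fun z => ?_⟩
  refine (abs_real_inner_le_norm _ _).trans ?_
  rw [norm_gradG]
  have h := hL.dist_le_mul z.1 z.2
  rw [dist_eq_norm, dist_eq_norm] at h
  rcases eq_or_ne ‖z.1 - z.2‖ 0 with h0 | h0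
  · rw [h0]; simp
  · rw [inv_mul_le_iff₀ (lt_of_le_of_ne (norm_nonneg _) h0.symm), mul_comm]
    exact h

lemma measurable_symKernel {Y φ : Plane → Plane} (hY : Measurable Y) (hφ : Measurable φ) :
    Measurable (symKernel Y φ) :=
  (hY.comp (measurable_fst.sub measurable_snd)).inner
    ((hφ.comp measurable_fst).sub (hφ.comp measurable_snd))

lemma continuousAt_symKernel_gradG {φ : Plane → Plane} (hφ : Continuous φ) {z : Plane × Plane}
    (hz : z.1 ≠ z.2) : ContinuousAt (symKernel gradG φ) z := by
  have h1 : ContinuousAt (fun z : Plane × Plane => gradG (z.1 - z.2)) z :=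
    ContinuousAt.comp (f := fun z : Plane × Plane => z.1 - z.2)
      (continuousAt_gradG (sub_ne_zero.2 hz)) (by fun_prop)
  exact h1.inner (𝕜 := ℝ) ((hφ.comp continuous_fst).sub (hφ.comp continuous_snd)).continuousAt

lemma integrable_symKernel_gradG [IsFiniteMeasure ν] {φ : Plane → Plane} (hφ : IsTest φ) :
    Integrable (symKernel gradG φ) (ν.prod ν) := by
  obtain ⟨M, -, hM⟩ := exists_abs_symKernel_gradG_le hφ
  exact Integrable.of_bound (measurable_symKernel measurable_gradG
    hφ.1.continuous.measurable).aestronglyMeasurable M (.of_forall hM)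

/-- The smeared interaction. -/
def smearedPairing (ν : Measure Plane) (σ : Plane → ℝ) (φ : Plane → Plane) (r : ℝ) : ℝ :=
  ∫ z, σ z.1.1 * (σ z.2.1 * symKernel gradG φ (shift r z.1, shift r z.2)) ∂(smear ν).prod (smear ν)

/-- Symmetrization: the double integral is added to its copy with the two variables exchanged, and
oddness of `∇g` produces `φ(x) - φ(y)`. At positive `r` the unsymmetrized kernel is itself
integrable, so this is plain Fubini. -/
lemma two_mul_integral_inner_mollField [IsFiniteMeasure ν] (hσ : IsSign σ) {r : ℝ} (hr : 0 < r)
    {φ : Plane → Plane} (hφ : IsTest φ) :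
    2 * ∫ x, ⟪φ x, mollField ν σ r x⟫ * mollDensity ν σ r x = smearedPairing ν σ φ r := by
  have hYc : Continuous (mollField ν σ r) := by
    refine (PiLp.continuous_toLp 2 _).comp (continuous_pi fun j => ?_)
    exact (contDiff_mollField hσ hr j).continuous
  have hu : Continuous fun x => ⟪φ x, mollField ν σ r x⟫ := hφ.1.continuous.inner hYc
  have hc : HasCompactSupport fun x => ⟪φ x, mollField ν σ r x⟫ :=
    hφ.2.mono fun x hx h0 => hx (by simp [h0])
  rw [integral_mul_mollDensity hσ hr hu hc]
  obtain ⟨M, hM⟩ := hφ.1.continuous.bounded_above_of_compact_support hφ.2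
  have hM0 : 0 ≤ M := (norm_nonneg _).trans (hM 0)
  set H : (Plane × Plane) × (Plane × Plane) → ℝ := fun z =>
    σ z.1.1 * (σ z.2.1 * ⟪φ (shift r z.1), gradG (shift r z.1 - shift r z.2)⟫) with hH
  have hin : ∀ p, ⟪φ (shift r p), mollField ν σ r (shift r p)⟫ =
      ∫ q, σ q.1 * ⟪φ (shift r p), gradG (shift r p - shift r q)⟫ ∂smear ν := by
    intro p
    rw [mollField_eq hσ hr, ← integral_inner (hσ.comp_fst.integrable_smul
      (integrable_gradG_smear hr _))]
    simp only [inner_smul_right]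
  have hm1 : Measurable fun z : (Plane × Plane) × (Plane × Plane) => σ z.1.1 :=
    hσ.1.comp (measurable_fst.comp measurable_fst)
  have hm2 : Measurable fun z : (Plane × Plane) × (Plane × Plane) => σ z.2.1 :=
    hσ.1.comp (measurable_fst.comp measurable_snd)
  have hT1 : Measurable fun z : (Plane × Plane) × (Plane × Plane) => shift r z.1 :=
    (measurable_shift r).comp measurable_fst
  have hT2 : Measurable fun z : (Plane × Plane) × (Plane × Plane) => shift r z.2 :=
    (measurable_shift r).comp measurable_snd
  have hk : Integrable (fun z : (Plane × Plane) × (Plane × Plane) =>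
      gradG (shift r z.1 - shift r z.2)) ((smear ν).prod (smear ν)) := by
    obtain ⟨C, hC⟩ := exists_lintegral_gradG_smear_le (ν := ν) hr
    have hm : Measurable fun z : (Plane × Plane) × (Plane × Plane) =>
        gradG (shift r z.1 - shift r z.2) := measurable_gradG.comp (hT1.sub hT2)
    refine ⟨hm.aestronglyMeasurable, ?_⟩
    rw [HasFiniteIntegral, lintegral_prod _ hm.enorm.aemeasurable]
    calc _ ≤ ∫⁻ _, C ∂smear ν := lintegral_mono fun p => hC _
      _ < ⊤ := by
        rw [lintegral_const]
        exact ENNReal.mul_lt_top ENNReal.coe_lt_top (measure_lt_top _ _)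
  have hHi : Integrable H ((smear ν).prod (smear ν)) := by
    refine (hk.norm.const_mul M).mono (hm1.mul (hm2.mul
      ((hφ.1.continuous.measurable.comp hT1).inner
        (measurable_gradG.comp (hT1.sub hT2))))).aestronglyMeasurable (.of_forall fun z => ?_)
    rw [hH, norm_mul, norm_mul, Real.norm_eq_abs (σ _), Real.norm_eq_abs (σ _), hσ.abs_eq, hσ.abs_eq,
      one_mul, one_mul, norm_mul, Real.norm_of_nonneg hM0, norm_norm]
    exact (norm_inner_le_norm _ _).trans (mul_le_mul_of_nonneg_right (hM _) (norm_nonneg _))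
  have e1 : ∫ p, σ p.1 * ⟪φ (shift r p), mollField ν σ r (shift r p)⟫ ∂smear ν =
      ∫ z, H z ∂(smear ν).prod (smear ν) := by
    rw [integral_prod _ hHi]
    simp only [hin, hH, integral_const_mul]
  rw [e1, two_mul]
  nth_rewrite 2 [← integral_prod_swap]
  have hHs : Integrable (fun z => H z.swap) ((smear ν).prod (smear ν)) := hHi.swap
  rw [← integral_add hHi hHs, smearedPairing]
  congr 1; ext z
  simp only [hH, Prod.fst_swap, Prod.snd_swap, symKernel]
  rw [← neg_sub (shift r z.1) (shift r z.2), gradG_neg, inner_neg_right, inner_sub_right,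
    real_inner_comm (gradG _), real_inner_comm (gradG _)]
  ring

/-- The smeared form of the identity. -/
lemma integral_frob_mollField [IsFiniteMeasure ν] (hσ : IsSign σ) {r : ℝ} (hr : 0 < r)
    {φ : Plane → Plane} (hφ : IsTest φ) :
    ∫ x, frob (jac φ x) (stress (mollField ν σ r) x) = cd * smearedPairing ν σ φ r := by
  rw [integral_frob_jac_stress hφ (contDiff_mollField hσ hr) (curl_mollField hσ hr),
    ← two_mul_integral_inner_mollField hσ hr hφ]
  simp only [div_mollField hσ hr]
  have : ∀ x, ⟪φ x, mollField ν σ r x⟫ * (-cd * mollDensity ν σ r x) =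
      -cd * (⟪φ x, mollField ν σ r x⟫ * mollDensity ν σ r x) := fun x => by ring
  simp only [this]
  rw [integral_const_mul]
  ring

/-- Dominated convergence on a fixed product space: the kernel is bounded and continuous off the
diagonal, and the unshifted points avoid the diagonal almost surely. -/
lemma tendsto_smearedPairing [IsFiniteMeasure ν] (hσ : IsSign σ)
    (hd : (ν.prod ν) (Set.diagonal Plane) = 0) {φ : Plane → Plane} (hφ : IsTest φ) :
    Tendsto (smearedPairing ν σ φ) (𝓝[>] 0)
      (𝓝 (∫ z, σ z.1 * σ z.2 * symKernel gradG φ z ∂ν.prod ν)) := by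
  obtain ⟨M, hM0, hM⟩ := exists_abs_symKernel_gradG_le hφ
  have hK := measurable_symKernel measurable_gradG hφ.1.continuous.measurable
  have hmap : (smear ν).map Prod.fst = ν := by
    rw [smear, Measure.map_fst_prod, measure_univ, one_smul]
  have hmp : MeasurePreserving (Prod.map Prod.fst Prod.fst :
      (Plane × Plane) × (Plane × Plane) → Plane × Plane) ((smear ν).prod (smear ν)) (ν.prod ν) := by
    refine ⟨measurable_fst.prodMap measurable_fst, ?_⟩
    rw [← Measure.map_prod_map _ _ measurable_fst measurable_fst, hmap]
  have hm1 : Measurable fun z : (Plane × Plane) × (Plane × Plane) => σ z.1.1 :=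
    hσ.1.comp (measurable_fst.comp measurable_fst)
  have hm2 : Measurable fun z : (Plane × Plane) × (Plane × Plane) => σ z.2.1 :=
    hσ.1.comp (measurable_fst.comp measurable_snd)
  have hlim : ∫ z, σ z.1 * σ z.2 * symKernel gradG φ z ∂ν.prod ν =
      ∫ z, σ z.1.1 * (σ z.2.1 * symKernel gradG φ (z.1.1, z.2.1)) ∂(smear ν).prod (smear ν) := by
    have hm : Measurable fun z : Plane × Plane => σ z.1 * σ z.2 * symKernel gradG φ z :=
      ((hσ.1.comp measurable_fst).mul (hσ.1.comp measurable_snd)).mul hK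
    rw [← hmp.map_eq, integral_map hmp.measurable.aemeasurable hm.aestronglyMeasurable]
    congr 1; ext z
    simp only [Prod.map_fst, Prod.map_snd, mul_assoc]
    rfl
  rw [hlim]
  have hne : ∀ᵐ z ∂(smear ν).prod (smear ν), z.1.1 ≠ z.2.1 := by
    have h0 : ∀ᵐ z ∂ν.prod ν, z.1 ≠ z.2 := by
      rw [ae_iff]; simpa [Set.diagonal] using hd
    exact hmp.quasiMeasurePreserving.ae h0
  refine tendsto_integral_filter_of_dominated_convergence (fun _ => M) (.of_forall fun r => ?_)
    (.of_forall fun r => .of_forall fun z => ?_) (integrable_const _) ?_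
  · exact (hm1.mul (hm2.mul (hK.comp (((measurable_shift r).comp measurable_fst).prodMk
      ((measurable_shift r).comp measurable_snd))))).aestronglyMeasurable
  · rw [norm_mul, norm_mul, Real.norm_eq_abs, Real.norm_eq_abs, hσ.abs_eq, hσ.abs_eq, one_mul, one_mul]
    exact hM _
  · filter_upwards [hne] with z hz
    refine Tendsto.const_mul _ (Tendsto.const_mul _ ?_)
    have hc : Tendsto (fun r : ℝ => (shift r z.1, shift r z.2)) (𝓝[>] 0) (𝓝 (z.1.1, z.2.1)) := by
      have : Continuous fun r : ℝ => (shift r z.1, shift r z.2) := by unfold shift; fun_prop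
      have h := this.tendsto 0
      simp only [shift, zero_smul, add_zero] at h
      exact h.mono_left nhdsWithin_le_nhds
    exact (continuousAt_symKernel_gradG hφ.1.continuous (z := (z.1.1, z.2.1)) hz).tendsto.comp hc

lemma tendsto_integral_mul_mollField [IsFiniteMeasure ν] (hσ : IsSign σ)
    (h2 : ∀ (R : ℝ) (j : Fin 2), 0 < R →
      MemLp (fun x => field ν σ x j) 2 (volume.restrict (Metric.ball 0 R)))
    {c : Plane → ℝ} (hc : Continuous c) (hcc : HasCompactSupport c) (i j : Fin 2) :
    Integrable (fun x => c x * (field ν σ x i * field ν σ x j)) ∧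
    (∀ r, 0 < r → Integrable fun x => c x * (mollField ν σ r x i * mollField ν σ r x j)) ∧
    Tendsto (fun r => ∫ x, c x * (mollField ν σ r x i * mollField ν σ r x j)) (𝓝[>] 0)
      (𝓝 (∫ x, c x * (field ν σ x i * field ν σ x j))) := by
  obtain ⟨R, hR, hs⟩ := tsupport_subset_ball hcc
  obtain ⟨M, hM⟩ := hc.bounded_above_of_compact_support hcc
  have hz : ∀ x, x ∉ Metric.ball (0 : Plane) R → c x = 0 := fun x hx =>
    image_eq_zero_of_notMem_tsupport fun h => hx (hs h)
  have hcL : ∀ {f : Plane → ℝ}, MemLp f 2 (volume.restrict (Metric.ball 0 R)) →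
      MemLp (fun x => c x * f x) 2 (volume.restrict (Metric.ball 0 R)) := fun {f} hf => by
    refine hf.of_le_mul (c := M) (hc.aestronglyMeasurable.mul hf.1) (.of_forall fun x => ?_)
    rw [norm_mul]
    exact mul_le_mul_of_nonneg_right (hM x) (norm_nonneg _)
  have e : ∀ f h : Plane → ℝ, ∫ x, c x * (f x * h x) =
      ∫ x in Metric.ball (0 : Plane) R, c x * f x * h x := fun f h => by
    rw [← setIntegral_eq_integral_of_forall_compl_eq_zero (s := Metric.ball (0 : Plane) R)
      fun x hx => by rw [hz x hx, zero_mul]]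
    simp only [mul_assoc]
  have hint : ∀ {f h : Plane → ℝ}, MemLp f 2 (volume.restrict (Metric.ball 0 R)) →
      MemLp h 2 (volume.restrict (Metric.ball 0 R)) → Integrable fun x => c x * (f x * h x) := by
    intro f h hf hh
    have h1 : IntegrableOn (fun x => c x * f x * h x) (Metric.ball 0 R) := (hcL hf).integrable_mul hh
    refine ((integrableOn_iff_integrable_of_support_subset ?_).1 h1).congr
      (.of_forall fun x => mul_assoc _ _ _)
    intro x hx
    by_contra h0
    exact hx (by simp [hz x h0])
  have hml : ∀ r, 0 < r → ∀ j, MemLp (fun x => mollField ν σ r x j) 2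
      (volume.restrict (Metric.ball 0 R)) := fun r hr j =>
    memLp_ball_of_continuous (contDiff_mollField hσ hr j).continuous 2 R
  have hlim : ∀ j, Tendsto (fun r => ∫ x in Metric.ball (0 : Plane) R,
      (mollField ν σ r x j - field ν σ x j) ^ 2) (𝓝[>] 0) (𝓝 0) := fun j =>
    tendsto_integral_conv_moll_sub_sq (locallyIntegrable_field_coord hσ j)
      (fun R hR => h2 R j hR) hR
  refine ⟨hint (h2 R i hR) (h2 R j hR), fun r hr => hint (hml r hr i) (hml r hr j), ?_⟩
  simp only [e (fun x => mollField ν σ _ x i) (fun x => mollField ν σ _ x j),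
    e (fun x => field ν σ x i) (fun x => field ν σ x j)]
  refine tendsto_integral_mul_of_L2 (hcL (h2 R i hR)) (h2 R j hR) ?_ ?_ ?_ (hlim j)
  · filter_upwards [self_mem_nhdsWithin] with r hr using hcL (hml r hr i)
  · filter_upwards [self_mem_nhdsWithin] with r hr using hml r hr j
  · refine squeeze_zero' (.of_forall fun r => integral_nonneg fun x => sq_nonneg _) ?_
      (by simpa using (hlim i).const_mul (M ^ 2))
    filter_upwards [self_mem_nhdsWithin] with r hr
    rw [← integral_const_mul]
    refine integral_mono_of_nonneg (.of_forall fun x => sq_nonneg _)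
      (((hml r hr i).sub (h2 R i hR)).integrable_sq.const_mul _) (.of_forall fun x => ?_)
    simp only
    rw [← mul_sub, mul_pow]
    exact mul_le_mul_of_nonneg_right (sq_le_sq' (abs_le.1 (hM x)).1 (abs_le.1 (hM x)).2)
      (sq_nonneg _)

lemma integrable_and_tendsto_frob [IsFiniteMeasure ν] (hσ : IsSign σ)
    (h2 : ∀ (R : ℝ) (j : Fin 2), 0 < R →
      MemLp (fun x => field ν σ x j) 2 (volume.restrict (Metric.ball 0 R)))
    {φ : Plane → Plane} (hφ : IsTest φ) :
    Integrable (fun x => frob (jac φ x) (stress (field ν σ) x)) ∧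
    Tendsto (fun r => ∫ x, frob (jac φ x) (stress (mollField ν σ r) x)) (𝓝[>] 0)
      (𝓝 (∫ x, frob (jac φ x) (stress (field ν σ) x))) := by
  have ha := hφ.coord 0
  have hb := hφ.coord 1
  have hA : IsTest fun x => pd 0 (fun x => φ x 0) x - pd 1 (fun x => φ x 1) x :=
    ⟨(ha.pderiv 0).1.sub (hb.pderiv 1).1, (ha.pderiv 0).2.sub (hb.pderiv 1).2⟩
  have hB : IsTest fun x => pd 1 (fun x => φ x 0) x + pd 0 (fun x => φ x 1) x :=
    ⟨(ha.pderiv 1).1.add (hb.pderiv 0).1, (ha.pderiv 1).2.add (hb.pderiv 0).2⟩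
  obtain ⟨i1, m1, t1⟩ := tendsto_integral_mul_mollField hσ h2 hA.1.continuous hA.2 0 0
  obtain ⟨i2, m2, t2⟩ := tendsto_integral_mul_mollField hσ h2 hA.1.continuous hA.2 1 1
  obtain ⟨i3, m3, t3⟩ := tendsto_integral_mul_mollField hσ h2 hB.1.continuous hB.2 0 1
  simp only [frob_jac_stress hφ]
  have comb : ∀ {f h k : Plane → ℝ}, Integrable f → Integrable h → Integrable k →
      (Integrable fun x => f x - h x + 2 * k x) ∧
      ∫ x, (f x - h x + 2 * k x) = (∫ x, f x) - (∫ x, h x) + 2 * ∫ x, k x := by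
    intro f h k hf hh hk
    have h12 : Integrable fun x => f x - h x := hf.sub hh
    exact ⟨h12.add (hk.const_mul 2), by
      rw [integral_add h12 (hk.const_mul 2), integral_sub hf hh, integral_const_mul]⟩
  refine ⟨(comb i1 i2 i3).1, ?_⟩
  rw [(comb i1 i2 i3).2]
  refine ((t1.sub t2).add (t3.const_mul 2)).congr' ?_
  filter_upwards [self_mem_nhdsWithin] with r hr
  exact (comb (m1 r hr) (m2 r hr) (m3 r hr)).2.symm

/-- The identity of part (i), in terms of the polar decomposition. -/
lemma MemHNegOneLoc.integral_frob_field (hμ : MemHNegOneLoc μ) (h : PolarDecomp μ ν σ)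
    {φ : Plane → Plane} (hφ : IsTest φ) :
    Integrable (fun x => frob (jac φ x) (stress (field ν σ) x)) ∧
    ∫ x, frob (jac φ x) (stress (field ν σ) x) =
      cd * ∫ z, σ z.1 * σ z.2 * symKernel gradG φ z ∂ν.prod ν := by
  have := h.isFiniteMeasure
  obtain ⟨hi, ht⟩ := integrable_and_tendsto_frob h.isSign
    (fun R j hR => hμ.memLp_field_coord h hR j) hφ
  refine ⟨hi, tendsto_nhds_unique ht ?_⟩
  refine ((tendsto_smearedPairing h.isSign (hμ.measure_diagonal h) hφ).const_mul cd).congr' ?_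
  filter_upwards [self_mem_nhdsWithin] with r hr
  exact (integral_frob_mollField h.isSign hr hφ).symm

end

/-! ### The two formulations as identities of distributions, and finite-part divergence. -/

section

variable {μ : SignedMeasure Plane} {ν : Measure Plane} {σ : Plane → ℝ}

lemma MemHNegOneLoc.tensorSq_restrict (hμ : MemHNegOneLoc μ) :
    (tensorSq μ).restrict (Set.diagonal Plane)ᶜ = tensorSq μ := by
  obtain ⟨ν, σ, h⟩ := exists_polarDecomp μ
  have := h.isFiniteMeasure
  ext A hA
  rw [VectorMeasure.restrict_apply _ measurableSet_diagonal.compl hA, h.tensorSq_eq,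
    withDensityᵥ_apply h.isSign_prod.integrable (hA.inter measurableSet_diagonal.compl),
    withDensityᵥ_apply h.isSign_prod.integrable hA]
  refine setIntegral_congr_set ?_
  exact inter_ae_eq_left_of_ae_eq_univ (ae_eq_univ.2 (by simpa using hμ.measure_diagonal h))

lemma continuous_gradient {F : Plane → ℝ} (hF : ContDiff ℝ 1 F) : Continuous (gradient F) :=
  (InnerProductSpace.toDual ℝ Plane).symm.continuous.comp (hF.continuous_fderiv (by norm_num))

lemma integrable_inner_of_isTest [IsFiniteMeasure ν] {b φ : Plane → Plane} (hb : Continuous b)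
    (hφ : IsTest φ) : Integrable (fun x => ⟪b x, φ x⟫) ν :=
  (hb.inner hφ.1.continuous).integrable_of_hasCompactSupport
    (hφ.2.mono fun x hx h0 => hx (by simp [h0]))

lemma PolarDecomp.potentialForce_eq (h : PolarDecomp μ ν σ) {V : Plane → ℝ} (hV : ContDiff ℝ 1 V)
    {φ : Plane → Plane} (hφ : IsTest φ) :
    potentialForce V μ φ = ∫ x, σ x * ⟪gradient V x, φ x⟫ ∂ν :=
  have := h.isFiniteMeasure
  h.integral_eq (integrable_inner_of_isTest (continuous_gradient hV) hφ)

lemma PolarDecomp.force_integrable (h : PolarDecomp μ ν σ) {F : Plane → ℝ} (hF : ForceDefined F μ)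
    {φ : Plane → Plane} (hφ : IsTest φ) : Integrable (symKernel (gradient F) φ) (ν.prod ν) := by
  have := hF φ hφ
  rwa [VectorMeasure.Integrable, h.tensorSq_variation] at this

lemma PolarDecomp.force_eq (h : PolarDecomp μ ν σ) {F : Plane → ℝ} (hF : ForceDefined F μ)
    {φ : Plane → Plane} (hφ : IsTest φ) :
    force F μ φ = 1 / 2 * ∫ z, σ z.1 * σ z.2 * symKernel (gradient F) φ z ∂ν.prod ν := by
  rw [force, h.tensorSq_integral (h.force_integrable hF hφ)]

/-- The vorticity formulation as an identity between distributions. -/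
lemma MemHNegOneLoc.vorticityCritical_iff (hμ : MemHNegOneLoc μ) (h : PolarDecomp μ ν σ)
    {F : Plane → ℝ} (V : Plane → ℝ) (hF : ForceDefined F μ) :
    VorticityCritical F V μ ↔ ∀ φ, IsTest φ →
      1 / 2 * (∫ z, σ z.1 * σ z.2 * symKernel gradG φ z ∂ν.prod ν) +
        (force F μ φ + potentialForce V μ φ) = 0 := by
  have := h.isFiniteMeasure
  refine forall_congr' fun φ => forall_congr' fun hφ => ?_
  have e : symKernel (fun x => gradG x + gradient F x) φ =
      fun z => symKernel gradG φ z + symKernel (gradient F) φ z := by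
    ext z; simp only [symKernel, inner_add_left]
  have hi := integrable_symKernel_gradG (ν := ν) hφ
  have hi' := h.force_integrable hF hφ
  have hsum : Integrable (fun z => symKernel gradG φ z + symKernel (gradient F) φ z) (ν.prod ν) :=
    hi.add hi'
  have j1 : Integrable (fun z => σ z.1 * σ z.2 * symKernel gradG φ z) (ν.prod ν) :=
    h.isSign_prod.integrable_smul hi
  have j2 : Integrable (fun z => σ z.1 * σ z.2 * symKernel (gradient F) φ z) (ν.prod ν) :=
    h.isSign_prod.integrable_smul hi'
  rw [hμ.tensorSq_restrict, e, h.tensorSq_integral hsum, h.force_eq hF hφ]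
  simp only [mul_add]
  rw [integral_add j1 j2, potentialForce, mul_add, add_assoc]

/-- The distributional divergence of the stress tensor. -/
lemma MemHNegOneLoc.hasDiv_stress (hμ : MemHNegOneLoc μ) (h : PolarDecomp μ ν σ) :
    HasDiv (stress (gradGConv μ)) fun φ =>
      -(cd * ∫ z, σ z.1 * σ z.2 * symKernel gradG φ z ∂ν.prod ν) := by
  intro φ hφ
  rw [h.gradGConv_eq, (hμ.integral_frob_field h hφ).2]

lemma locallyIntegrable_of_memLpLoc {f : Plane → ℝ} {p : ℝ≥0∞} (hp : 1 ≤ p) (hf : MemLpLoc f p) :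
    LocallyIntegrable f :=
  locallyIntegrable_of_ball fun R => by
    have h := hf _ (isCompact_closedBall 0 R)
    have : IsFiniteMeasure (volume.restrict (Metric.closedBall (0 : Plane) R)) :=
      ⟨by rw [Measure.restrict_apply_univ]; exact measure_closedBall_lt_top⟩
    exact IntegrableOn.mono_set (h.integrable hp) Metric.ball_subset_closedBall

lemma integrable_frob_jac {A : Plane → Matrix (Fin 2) (Fin 2) ℝ}
    (hA : ∀ i j, LocallyIntegrable fun x => A x i j) {φ : Plane → Plane} (hφ : IsTest φ) :
    Integrable fun x => frob (jac φ x) (A x) := by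
  have hi : ∀ i j, Integrable fun x => pd j (fun x => φ x i) x * A x i j := fun i j => by
    have ht := (hφ.coord i).pderiv j
    simpa only [mul_comm] using (hA i j).integrable_mul_test ht.1.continuous ht.2
  simp only [frob_eq, jac_eq_pd hφ]
  exact ((hi 0 0).add (hi 0 1)).add ((hi 1 0).add (hi 1 1))

lemma frob_add (A B C : Matrix (Fin 2) (Fin 2) ℝ) : frob A (B + C) = frob A B + frob A C := by
  simp [frob, mul_add]

/-- Both divergences carry the common nonzero factor `-2 c_d`. Allowing any admissible `R` lets one
computation serve both implications. -/
lemma MemHNegOneLoc.hasDiv_stress_add_iff (hμ : MemHNegOneLoc μ) (h : PolarDecomp μ ν σ)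
    {R : Plane → Matrix (Fin 2) (Fin 2) ℝ} {T : (Plane → Plane) → ℝ}
    (hR : ∀ i j, LocallyIntegrable fun x => R x i j) (hT : HasDiv R fun φ => -2 * cd * T φ) :
    HasDiv (fun x => stress (gradGConv μ) x + R x) (fun _ => 0) ↔ ∀ φ, IsTest φ →
      1 / 2 * (∫ z, σ z.1 * σ z.2 * symKernel gradG φ z ∂ν.prod ν) + T φ = 0 := by
  refine forall_congr' fun φ => forall_congr' fun hφ => ?_
  have h1 := hμ.hasDiv_stress h φ hφ
  have h2 := hT φ hφ
  have hi : Integrable (fun x => frob (jac φ x) (stress (gradGConv μ) x)) := by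
    rw [h.gradGConv_eq]; exact (hμ.integral_frob_field h hφ).1
  simp only [frob_add]
  rw [integral_add hi (integrable_frob_jac hR hφ), neg_add, h1, h2]
  have hcd : cd ≠ 0 := by unfold cd; positivity
  rw [show -(cd * ∫ z, σ z.1 * σ z.2 * symKernel gradG φ z ∂ν.prod ν) + -2 * cd * T φ =
    -2 * cd * (1 / 2 * (∫ z, σ z.1 * σ z.2 * symKernel gradG φ z ∂ν.prod ν) + T φ) by ring]
  simp [hcd]

lemma MemHNegOneLoc.vorticityCritical_of_velocityCritical (hμ : MemHNegOneLoc μ)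
    {F V : Plane → ℝ} (hF : ForceDefined F μ) (hv : VelocityCritical F V μ) :
    VorticityCritical F V μ := by
  obtain ⟨ν, σ, h⟩ := exists_polarDecomp μ
  obtain ⟨R, ⟨⟨p, hp1, -, hR⟩, hdiv⟩, -, -, h0⟩ := hv
  exact (hμ.vorticityCritical_iff h V hF).2 ((hμ.hasDiv_stress_add_iff h
    (fun i j => locallyIntegrable_of_memLpLoc hp1 (hR i j)) hdiv).1 h0)

/-- A locally integrable field with vanishing distributional divergence is divergence-free in
finite part. -/
lemma divFreeFinitePart_of_integral_eq_zero {Y : Plane → Plane} (hY : LocallyIntegrable Y)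
    (h0 : ∀ ψ : Plane → ℝ, IsTest ψ → ∫ x, ⟪Y x, gradient ψ x⟫ = 0) : DivFreeFinitePart Y := by
  -- Complements of large balls miss each compact set once `δ` is small, and their own complements
  -- are bounded, so local integrability suffices.
  refine ⟨hY.aestronglyMeasurable, fun δ => (Metric.ball 0 δ⁻¹)ᶜ,
    fun δ _ => measurableSet_ball.compl, fun K hK => ?_, fun δ _ => ?_, fun δ _ ζ hζ => ?_⟩
  · obtain ⟨R, hR⟩ := hK.isBounded.subset_ball (0 : Plane)
    refine tendsto_const_nhds.congr' ?_
    filter_upwards [tendsto_inv_nhdsGT_zero.eventually_ge_atTop R] with δ hδ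
    have he : K ∩ (Metric.ball 0 δ⁻¹)ᶜ = ∅ := by
      rw [← Set.sdiff_eq, Set.sdiff_eq_empty]
      exact hR.trans (Metric.ball_subset_ball hδ)
    rw [he, eq_comm, ← nonpos_iff_eq_zero]
    refine (iInf_le_of_le (fun _ => 0) (iInf_le_of_le (fun _ => 0)
      (iInf_le_of_le (Set.empty_subset _) ?_)))
    simp
  · rw [compl_compl]
    exact (hY.integrableOn_isCompact (isCompact_closedBall 0 δ⁻¹)).mono_set
      Metric.ball_subset_closedBall
  · set S : Set Plane := (Metric.ball 0 δ⁻¹)ᶜ with hS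
    have hSc : IsClosed S := Metric.isOpen_ball.isClosed_compl
    -- Since `S` reaches beyond the support of `ζ`, the value `0` lies in `ζ(S)`; hence `ζ(S)` is a
    -- compact set with `0` adjoined, and is closed.
    obtain ⟨p, hpS, hp0⟩ : ∃ p ∈ S, ζ p = 0 := by
      obtain ⟨R, hR0, hR⟩ := tsupport_subset_ball hζ.2
      obtain ⟨p, hp⟩ := exists_norm_eq (E := Plane) (le_max_of_le_left hR0.le : 0 ≤ max R δ⁻¹)
      refine ⟨p, by simp [hS, hp], image_eq_zero_of_notMem_tsupport fun h => ?_⟩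
      have := mem_ball_zero_iff.1 (hR h)
      rw [hp] at this
      exact absurd this (not_lt.2 (le_max_left _ _))
    have himg : IsClosed (ζ '' S) := by
      have e : ζ '' S = ζ '' (S ∩ tsupport ζ) ∪ {0} := by
        ext t
        constructor
        · rintro ⟨x, hx, rfl⟩
          by_cases hxs : x ∈ tsupport ζ
          · exact Or.inl ⟨x, ⟨hx, hxs⟩, rfl⟩
          · exact Or.inr (image_eq_zero_of_notMem_tsupport hxs)
        · rintro (⟨x, hx, rfl⟩ | rfl)
          · exact ⟨x, hx.1, rfl⟩
          · exact ⟨p, hpS, hp0⟩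
      rw [e]
      exact ((hζ.2.isCompact.inter_left hSc).image hζ.1.continuous).isClosed.union isClosed_singleton
    obtain ⟨f, hfs, hf, hf01⟩ := himg.isOpen_compl.exists_contDiff_support_eq (n := ⊤)
    have hf0 : ∀ t, t ∈ ζ '' S → f t = 0 := fun t ht => by
      by_contra h
      have : t ∈ Function.support f := h
      rw [hfs] at this
      exact this ht
    -- As `f` takes values in `[0, 1]` and vanishes exactly on `ζ(S)`, these smooth functions
    -- converge pointwise to the indicator of the complement of `ζ(S)`.
    let k : ℕ → ℝ → ℝ := fun n t => 1 - (1 - f t) ^ n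
    have hk : ∀ n, ContDiff ℝ ∞ (k n) := fun n =>
      contDiff_const.sub ((contDiff_const.sub hf).pow n)
    have hk01 : ∀ n t, |k n t| ≤ 1 := fun n t => by
      have h1 := hf01 (Set.mem_range_self t)
      have h2 : 0 ≤ (1 - f t) ^ n := pow_nonneg (by linarith [h1.2]) n
      have h3 : (1 - f t) ^ n ≤ 1 := pow_le_one₀ (by linarith [h1.2]) (by linarith [h1.1])
      rw [abs_le]; constructor <;> simp only [k] <;> linarith
    -- Starting the primitive at `0` gives `Φ n 0 = 0`, so `Φ n ∘ ζ` keeps compact support and is an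
    -- admissible test function.
    let Φ : ℕ → ℝ → ℝ := fun n t => ∫ s in (0 : ℝ)..t, k n s
    have hΦd : ∀ n t, HasDerivAt (Φ n) (k n t) t := fun n t =>
      ((hk n).continuous.integral_hasStrictDerivAt 0 t).hasDerivAt
    have hΦ : ∀ n, ContDiff ℝ ∞ (Φ n) := fun n => by
      rw [contDiff_infty_iff_deriv]
      refine ⟨fun t => (hΦd n t).differentiableAt, ?_⟩
      rw [show deriv (Φ n) = k n from funext fun t => (hΦd n t).deriv]
      exact hk n
    have hζd : Differentiable ℝ ζ := hζ.1.differentiable (by simp)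
    have hgrad : ∀ n x, gradient (Φ n ∘ ζ) x = k n (ζ x) • gradient ζ x := fun n x => by
      have := (hΦd n (ζ x)).comp_hasFDerivAt x (hζd x).hasFDerivAt
      simp only [gradient]
      rw [this.fderiv, map_smul]
    have hz : ∀ n, ∫ x, k n (ζ x) * ⟪Y x, gradient ζ x⟫ = 0 := fun n => by
      have ht : IsTest (Φ n ∘ ζ) := ⟨(hΦ n).comp hζ.1, hζ.2.comp_left (by simp [Φ])⟩
      have := h0 _ ht
      simpa only [hgrad, inner_smul_right] using this
    have hYi : Integrable fun x => ⟪Y x, gradient ζ x⟫ := by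
      have hY' : ∀ j, LocallyIntegrable fun x => Y x j := fun j x => by
        obtain ⟨U, hU, hi⟩ := hY x
        exact ⟨U, hU, (EuclideanSpace.proj (𝕜 := ℝ) j).integrable_comp hi⟩
      simp only [inner_eq_coord, gradient_coord]
      exact ((hY' 0).integrable_mul_test (hζ.pderiv 0).1.continuous (hζ.pderiv 0).2).add
        ((hY' 1).integrable_mul_test (hζ.pderiv 1).1.continuous (hζ.pderiv 1).2)
    have hmeas : MeasurableSet (ζ ⁻¹' (ζ '' S))ᶜ :=
      ((himg.preimage hζ.1.continuous).isOpen_compl).measurableSet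
    rw [← integral_indicator hmeas]
    refine tendsto_nhds_unique (f := fun n : ℕ => ∫ x, k n (ζ x) * ⟪Y x, gradient ζ x⟫)
      (l := atTop) ?_ ((tendsto_const_nhds (x := (0 : ℝ))).congr fun n => (hz n).symm)
    refine tendsto_integral_of_dominated_convergence (fun x => ‖⟪Y x, gradient ζ x⟫‖)
      (fun n => ((hk n).continuous.comp hζ.1.continuous).aestronglyMeasurable.mul
        hYi.aestronglyMeasurable) hYi.norm (fun n => .of_forall fun x => ?_) (.of_forall fun x => ?_)
    · rw [norm_mul]
      exact mul_le_of_le_one_left (norm_nonneg _) (hk01 n _)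
    · by_cases hx : x ∈ (ζ ⁻¹' (ζ '' S))ᶜ
      · rw [Set.indicator_of_mem hx]
        have hfx : f (ζ x) ≠ 0 := by
          have : ζ x ∈ Function.support f := by rw [hfs]; exact hx
          exact this
        have h1 := hf01 (Set.mem_range_self (ζ x))
        have h2 : Tendsto (fun n : ℕ => (1 - f (ζ x)) ^ n) atTop (𝓝 0) :=
          tendsto_pow_atTop_nhds_zero_of_lt_one (by linarith [h1.2])
            (by linarith [lt_of_le_of_ne h1.1 hfx.symm])
        simpa using (h2.const_sub 1).mul_const ⟪Y x, gradient ζ x⟫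
      · rw [Set.indicator_of_notMem hx]
        have : ζ x ∈ ζ '' S := by simpa using hx
        simp [k, hf0 _ this]

lemma IsTest.smul_single {ψ : Plane → ℝ} (hψ : IsTest ψ) (i : Fin 2) :
    IsTest fun x => ψ x • (EuclideanSpace.single i 1 : Plane) :=
  ⟨hψ.1.smul contDiff_const, hψ.2.smul_right⟩

/-- The test field `ψ e_i` isolates row `i`. -/
lemma integral_row_eq_zero {A : Plane → Matrix (Fin 2) (Fin 2) ℝ} (hA : HasDiv A fun _ => 0)
    (i : Fin 2) {ψ : Plane → ℝ} (hψ : IsTest ψ) : ∫ x, ⟪row A i x, gradient ψ x⟫ = 0 := by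
  have h := hA _ (hψ.smul_single i)
  rw [neg_eq_zero] at h
  rw [← h]
  congr 1; ext x
  rw [inner_eq_coord, frob_eq]
  simp only [jac_eq_pd (hψ.smul_single i), gradient_coord, row]
  have hz : ∀ j, pd j (fun _ : Plane => (0 : ℝ)) x = 0 := fun j => by simp [pd]
  fin_cases i <;> simp [hz] <;> ring

lemma divFreeFinitePart_row {A : Plane → Matrix (Fin 2) (Fin 2) ℝ}
    (hi : ∀ i j, LocallyIntegrable fun x => A x i j) (hA : HasDiv A fun _ => 0) (i : Fin 2) :
    DivFreeFinitePart (row A i) := by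
  refine divFreeFinitePart_of_integral_eq_zero (locallyIntegrable_of_ball fun R => ?_)
    fun ψ hψ => integral_row_eq_zero hA i hψ
  have hj : ∀ j, IntegrableOn (fun x => A x i j) (Metric.ball 0 R) := fun j =>
    ((hi i j).integrableOn_isCompact (isCompact_closedBall 0 R)).mono_set
      Metric.ball_subset_closedBall
  have e : row A i = fun x => A x i 0 • (EuclideanSpace.single 0 1 : Plane) +
      A x i 1 • (EuclideanSpace.single 1 1 : Plane) := by
    ext x j; fin_cases j <;> simp [row]
  rw [e]
  exact ((hj 0).smul_const _).add ((hj 1).smul_const _)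

end

/-! ### Half-plane kernels: inverting the divergence for locally finite sources. -/

section

variable {ν : Measure Plane}

/-- The indicator of the half-plane `{v | 0 < y · v}`, with the value `1/2` on its boundary. -/
def cone (y v : Plane) : ℝ := if 0 < ⟪y, v⟫ then 1 else if ⟪y, v⟫ = 0 then 1 / 2 else 0

/-- The boundary value `1/2` makes this hold at every point, including for `y = 0`. -/
lemma cone_add_cone_neg (y v : Plane) : cone y v + cone y (-v) = 1 := by
  unfold cone
  rw [inner_neg_right]
  rcases lt_trichotomy ⟪y, v⟫ 0 with h | h | h
  · simp [h, h.not_gt, h.ne]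
  · simp [h]; norm_num
  · simp [h, h.not_gt, h.ne']

lemma abs_cone_le (y v : Plane) : |cone y v| ≤ 1 := by
  unfold cone; split_ifs <;> norm_num [abs_of_pos]

lemma cone_smul (y : Plane) {t : ℝ} (ht : 0 < t) (v : Plane) : cone y (t • v) = cone y v := by
  unfold cone; simp [inner_smul_right, ht, ht.ne']

lemma measurable_cone_uncurry : Measurable fun p : Plane × Plane => cone p.1 p.2 := by
  have h : Measurable fun p : Plane × Plane => ⟪p.1, p.2⟫ := measurable_fst.inner measurable_snd
  exact Measurable.ite (measurableSet_lt measurable_const h) measurable_const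
    (Measurable.ite (h (measurableSet_singleton 0)) measurable_const measurable_const)

/-- Here `y · (x - y) ≤ |y| (|x| - |y|) < 0`: a source at `y` does not act at points closer to the
origin than `y`. -/
lemma cone_sub_eq_zero {x y : Plane} (h : ‖x‖ < ‖y‖) : cone y (x - y) = 0 := by
  have h1 : ⟪y, x - y⟫ < 0 := by
    rw [inner_sub_right, real_inner_self_eq_norm_sq]
    nlinarith [real_inner_le_norm y x, norm_nonneg x]
  simp [cone, h1.not_gt, h1.ne]

/-- Radial integration reduces the claim to the angular mass `π` of a half-plane, half of `c_d`.
Rather than computing an arc, the proof compares with the reflected half-plane, using an even bump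
with value `1` at the origin. -/
lemma integral_cone_radial (y : Plane) {ψ : Plane → ℝ} (hψ : ContDiff ℝ 1 ψ)
    (hc : HasCompactSupport ψ) :
    ∫ v, cone y v * ((‖v‖ ^ 2)⁻¹ * fderiv ℝ ψ v v) = -(Real.pi * ψ 0) := by
  have hm : Measurable (cone y) := measurable_cone_uncurry.comp measurable_prodMk_left
  have hC := abs_cone_le y
  rw [integral_radial hm hC (fun r hr x => cone_smul y hr x) hψ hc]
  congr 2
  have hb1 : ContDiff ℝ 1 unitBump := unitBump.contDiff
  have hbc := unitBump.hasCompactSupport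
  have hb0 : unitBump (0 : Plane) = 1 := unitBump.one_of_mem_closedBall (by simp [unitBump])
  have h1 := integral_radial hm hC (fun r hr x => cone_smul y hr x) hb1 hbc
  have h2 := integral_radial (a := fun _ => 1) (C := 1) measurable_const (by simp)
    (by simp) hb1 hbc
  have heven : ∀ v, fderiv ℝ unitBump (-v) (-v) = fderiv ℝ unitBump v v := fun v => by
    have e : (fun x => unitBump (-x)) = unitBump := by
      ext x; exact unitBump.neg x
    have h := ((hb1.differentiable (by norm_num)) (-v)).hasFDerivAt.comp v (hasFDerivAt_id v).neg
    have h' : fderiv ℝ unitBump v = _ := (HasFDerivAt.fderiv (f := fun x => unitBump (-x)) h) ▸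
      congrArg (fun f => fderiv ℝ f v) e.symm
    rw [h']; simp
  have h3 : ∫ v, cone y (-v) * ((‖v‖ ^ 2)⁻¹ * fderiv ℝ unitBump v v) =
      ∫ v, cone y v * ((‖v‖ ^ 2)⁻¹ * fderiv ℝ unitBump v v) := by
    rw [← integral_neg_eq_self]
    simp only [heven, norm_neg, neg_neg]
  have h4 := integral_add (integrable_radial hm hC hb1 hbc) (integrable_radial
    (hm.comp measurable_neg) (fun v => hC (-v)) hb1 hbc)
  simp only [Function.comp_apply, ← add_mul, cone_add_cone_neg] at h4
  rw [h3, h2, h1, hb0] at h4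
  simp only [integral_const, smul_eq_mul, mul_one, toSphere_univ] at h4
  unfold cd at h4
  linarith

/-- The kernel supported in a half-plane whose divergence is `-π δ_y`. -/
def halfKernel (j : Fin 2) (x y : Plane) : ℝ := cone y (x - y) * gradG (x - y) j

lemma measurable_halfKernel (j : Fin 2) : Measurable fun p : Plane × Plane => halfKernel j p.1 p.2 := by
  have hs : Measurable fun p : Plane × Plane => p.1 - p.2 := measurable_fst.sub measurable_snd
  exact (measurable_cone_uncurry.comp (measurable_snd.prodMk hs)).mul
    ((EuclideanSpace.proj (𝕜 := ℝ) j).continuous.measurable.comp (measurable_gradG.comp hs))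

lemma abs_halfKernel_le (j : Fin 2) (x y : Plane) : |halfKernel j x y| ≤ ‖gradG (x - y)‖ := by
  rw [halfKernel, abs_mul]
  exact (mul_le_of_le_one_left (abs_nonneg _) (abs_cone_le _ _)).trans (abs_coord_le _ _)

lemma integrable_halfKernel_mul_pd (y : Plane) {ψ : Plane → ℝ} (hψ : Continuous ψ)
    (hc : HasCompactSupport ψ) (j : Fin 2) : Integrable fun x => ψ x * halfKernel j x y := by
  have h1 : LocallyIntegrable fun x => ‖gradG (x - y)‖ := by
    refine locallyIntegrable_of_ball fun R => ?_
    obtain ⟨C, hC⟩ := exists_lintegral_gradG_le R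
    refine ⟨(measurable_gradG.comp (measurable_id.sub_const y)).norm.aestronglyMeasurable, ?_⟩
    simpa [HasFiniteIntegral] using (hC y).trans_lt ENNReal.coe_lt_top
  refine (h1.integrable_mul_test hψ hc).mono (hψ.measurable.mul ((measurable_halfKernel j).comp
    measurable_prodMk_right)).aestronglyMeasurable (.of_forall fun x => ?_)
  rw [norm_mul, norm_mul, norm_norm, mul_comm]
  exact mul_le_mul_of_nonneg_right (abs_halfKernel_le j x y) (norm_nonneg _)

lemma integral_halfKernel_pd (y : Plane) {ψ : Plane → ℝ} (hψ : ContDiff ℝ 1 ψ)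
    (hc : HasCompactSupport ψ) :
    (∫ x, pd 0 ψ x * halfKernel 0 x y) + (∫ x, pd 1 ψ x * halfKernel 1 x y) = Real.pi * ψ y := by
  rw [← integral_add (integrable_halfKernel_mul_pd y (continuous_pd hψ 0) (hasCompactSupport_pd hc 0) 0)
    (integrable_halfKernel_mul_pd y (continuous_pd hψ 1) (hasCompactSupport_pd hc 1) 1),
    ← integral_add_right_eq_self _ y]
  have hψy : ContDiff ℝ 1 fun x => ψ (x + y) := hψ.comp (contDiff_id.add contDiff_const)
  have h := integral_cone_radial y hψy (HasCompactSupport_comp_add hc y)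
  rw [zero_add] at h
  rw [← neg_inj, ← h, ← integral_neg]
  congr 1; ext v
  rw [halfKernel, halfKernel, add_sub_cancel_right, fderiv_apply_eq_pd, pd_comp_add_right,
    pd_comp_add_right, gradG_coord, gradG_coord]
  ring

/-- The field `β ν` convolved with the half-plane kernels. -/
def halfField (ν : Measure Plane) (β : Plane → ℝ) (j : Fin 2) (x : Plane) : ℝ :=
  ∫ y, halfKernel j x y * β y ∂ν

section

variable [IsFiniteMeasure ν] {β : Plane → ℝ}

/-- For `x` in the ball of radius `R` only sources `y` in the same ball contribute, so `β` may be
truncated there; the uniform bound on `∇g` then finishes the estimate. -/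
lemma integrable_halfKernel_prod (hβ : ∀ R : ℝ, IntegrableOn β (Metric.ball 0 R) ν) (j : Fin 2)
    (R : ℝ) : Integrable (fun p : Plane × Plane => halfKernel j p.1 p.2 * β p.2)
      ((volume.restrict (Metric.ball (0 : Plane) R)).prod ν) := by
  obtain ⟨C, hC⟩ := exists_lintegral_gradG_le R
  set β' : Plane → ℝ := (Metric.ball (0 : Plane) R).indicator β with hβ'
  have hi : Integrable β' ν := (integrable_indicator_iff measurableSet_ball).2 (hβ R)
  have hm : Measurable fun p : Plane × Plane => gradG (p.1 - p.2) :=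
    measurable_gradG.comp (measurable_fst.sub measurable_snd)
  have hbm : AEStronglyMeasurable (fun p : Plane × Plane => β' p.2)
      ((volume.restrict (Metric.ball (0 : Plane) R)).prod ν) := hi.aestronglyMeasurable.comp_snd
  have h1 : Integrable (fun p : Plane × Plane => ‖gradG (p.1 - p.2)‖ * β' p.2)
      ((volume.restrict (Metric.ball (0 : Plane) R)).prod ν) := by
    have hgm : AEStronglyMeasurable (fun p : Plane × Plane => ‖gradG (p.1 - p.2)‖ * β' p.2)
        ((volume.restrict (Metric.ball (0 : Plane) R)).prod ν) :=
      hm.norm.aestronglyMeasurable.mul hbm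
    refine ⟨hgm, ?_⟩
    rw [HasFiniteIntegral, lintegral_prod_symm _ hgm.enorm]
    calc _ ≤ ∫⁻ y, C * ‖β' y‖ₑ ∂ν := by
          refine lintegral_mono fun y => ?_
          simp only [enorm_mul, enorm_norm]
          rw [lintegral_mul_const' _ _ enorm_ne_top]
          exact mul_le_mul_left (hC y) _
      _ < ⊤ := by
          rw [lintegral_const_mul' _ _ ENNReal.coe_ne_top]
          exact ENNReal.mul_lt_top ENNReal.coe_lt_top hi.2
  have hx : ∀ᵐ p ∂(volume.restrict (Metric.ball (0 : Plane) R)).prod ν,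
      p.1 ∈ Metric.ball (0 : Plane) R :=
    Measure.quasiMeasurePreserving_fst.ae (ae_restrict_mem measurableSet_ball)
  have he : ∀ᵐ p ∂(volume.restrict (Metric.ball (0 : Plane) R)).prod ν,
      halfKernel j p.1 p.2 * β' p.2 = halfKernel j p.1 p.2 * β p.2 := by
    filter_upwards [hx] with p hp
    by_cases hy : p.2 ∈ Metric.ball (0 : Plane) R
    · rw [hβ', Set.indicator_of_mem hy]
    · have : cone p.2 (p.1 - p.2) = 0 := by
        rw [mem_ball_zero_iff] at hp hy
        exact cone_sub_eq_zero (by linarith)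
      simp [halfKernel, this]
  refine Integrable.congr ?_ he
  refine h1.mono ((measurable_halfKernel j).aestronglyMeasurable.mul hbm) (.of_forall fun p => ?_)
  rw [norm_mul, norm_mul, norm_norm]
  exact mul_le_mul_of_nonneg_right (abs_halfKernel_le j _ _) (norm_nonneg _)

lemma locallyIntegrable_halfField (hβ : ∀ R : ℝ, IntegrableOn β (Metric.ball 0 R) ν) (j : Fin 2) :
    LocallyIntegrable (halfField ν β j) :=
  locallyIntegrable_of_ball fun R => (integrable_halfKernel_prod hβ j R).integral_prod_left

lemma integrable_halfKernel_pairing (hβ : ∀ R : ℝ, IntegrableOn β (Metric.ball 0 R) ν)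
    {ψ : Plane → ℝ} (hψ : Continuous ψ) (hc : HasCompactSupport ψ) (j : Fin 2) :
    Integrable (fun p : Plane × Plane => ψ p.1 * (halfKernel j p.1 p.2 * β p.2))
      ((volume : Measure Plane).prod ν) := by
  obtain ⟨R, -, hR⟩ := tsupport_subset_ball hc
  obtain ⟨M, hM⟩ := hψ.bounded_above_of_compact_support hc
  have h2 : Integrable (fun p : Plane × Plane => ψ p.1 * (halfKernel j p.1 p.2 * β p.2))
      ((volume.restrict (Metric.ball (0 : Plane) R)).prod ν) :=
    (integrable_halfKernel_prod hβ j R).bdd_mul (c := M)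
      (hψ.comp continuous_fst).aestronglyMeasurable (.of_forall fun p => hM p.1)
  have e : (volume.restrict (Metric.ball (0 : Plane) R)).prod ν =
      ((volume : Measure Plane).prod ν).restrict (Metric.ball (0 : Plane) R ×ˢ Set.univ) := by
    rw [← Measure.prod_restrict, Measure.restrict_univ]
  rw [e] at h2
  refine (integrableOn_iff_integrable_of_support_subset ?_).1 h2
  intro p hp
  have : ψ p.1 ≠ 0 := fun h => hp (by simp [h])
  exact ⟨hR (subset_tsupport _ this), trivial⟩

lemma integral_mul_halfField (hβ : ∀ R : ℝ, IntegrableOn β (Metric.ball 0 R) ν)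
    {ψ : Plane → ℝ} (hψ : Continuous ψ) (hc : HasCompactSupport ψ) (j : Fin 2) :
    Integrable (fun y => β y * ∫ x, ψ x * halfKernel j x y) ν ∧
    ∫ x, ψ x * halfField ν β j x = ∫ y, β y * (∫ x, ψ x * halfKernel j x y) ∂ν := by
  have h := integrable_halfKernel_pairing hβ hψ hc j
  have e : ∀ y, (∫ x, ψ x * (halfKernel j x y * β y)) = β y * ∫ x, ψ x * halfKernel j x y := by
    intro y
    rw [← integral_const_mul]
    congr 1; ext x; ring
  constructor
  · exact h.integral_prod_right.congr (.of_forall e)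
  · simp only [halfField, ← integral_const_mul]
    rw [integral_integral_swap h]
    simp only [e, integral_const_mul]

lemma integral_halfField_div (hβ : ∀ R : ℝ, IntegrableOn β (Metric.ball 0 R) ν)
    {ψ : Plane → ℝ} (hψ : ContDiff ℝ 1 ψ) (hc : HasCompactSupport ψ) :
    (∫ x, pd 0 ψ x * halfField ν β 0 x) + (∫ x, pd 1 ψ x * halfField ν β 1 x) =
      Real.pi * ∫ y, β y * ψ y ∂ν := by
  obtain ⟨i0, e0⟩ := integral_mul_halfField hβ (continuous_pd hψ 0) (hasCompactSupport_pd hc 0) 0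
  obtain ⟨i1, e1⟩ := integral_mul_halfField hβ (continuous_pd hψ 1) (hasCompactSupport_pd hc 1) 1
  rw [e0, e1, ← integral_add i0 i1, ← integral_const_mul]
  congr 1; ext y
  rw [← mul_add, integral_halfKernel_pd y hψ hc]
  ring

end

end

/-! ### The force as a locally finite source, and the remainder tensor. -/

section

variable {μ : SignedMeasure Plane} {ν : Measure Plane} {σ : Plane → ℝ}

lemma gradient_neg_of_even {F : Plane → ℝ} (hF : ContDiff ℝ 1 F) (he : ∀ x, F (-x) = F x)
    (x : Plane) : gradient F (-x) = -gradient F x := by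
  have h : HasFDerivAt (fun x => F (-x)) ((fderiv ℝ F (-x)).comp (-ContinuousLinearMap.id ℝ Plane)) x :=
    ((hF.differentiable (by norm_num)) (-x)).hasFDerivAt.comp x (hasFDerivAt_id x).neg
  simp only [he] at h
  have h' : fderiv ℝ F x = -fderiv ℝ F (-x) := by
    rw [h.fderiv]; ext v; simp
  simp only [gradient, h', map_neg, neg_neg]

/-- Test the integrability hypothesis with `χ e_j`, where `χ = 1` on the ball of radius `R`. For `y`
outside the support of `χ` the symmetrized kernel is exactly `∂_j F(x - y)`; for the remaining
bounded `y`, continuity suffices. -/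
lemma PolarDecomp.integrableOn_gradient_sub (h : PolarDecomp μ ν σ) {F : Plane → ℝ}
    (hF1 : ContDiff ℝ 1 F) (hF : ForceDefined F μ) (R : ℝ) (j : Fin 2) :
    IntegrableOn (fun z : Plane × Plane => gradient F (z.1 - z.2) j)
      (Metric.ball 0 R ×ˢ Set.univ) (ν.prod ν) := by
  have := h.isFiniteMeasure
  obtain ⟨χ, hχ, -, hχ1, hχs⟩ := exists_test_eq_one (R := max R 1) (by positivity)
  set R' := max R 1 + 2
  have hz : ∀ y ∉ Metric.ball (0 : Plane) R', χ y = 0 := fun y hy =>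
    image_eq_zero_of_notMem_tsupport fun h => hy (hχs h)
  have hφ := hχ.smul_single j
  have hint := h.force_integrable hF hφ
  have hc : Continuous fun z : Plane × Plane => gradient F (z.1 - z.2) j :=
    (EuclideanSpace.proj (𝕜 := ℝ) j).continuous.comp
      ((continuous_gradient hF1).comp (continuous_fst.sub continuous_snd))
  have h1 : IntegrableOn (fun z : Plane × Plane => gradient F (z.1 - z.2) j)
      (Metric.ball 0 R ×ˢ Metric.ball 0 R') (ν.prod ν) :=
    (hc.continuousOn.integrableOn_compact ((isCompact_closedBall 0 R).prod
      (isCompact_closedBall 0 R'))).mono_set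
      (Set.prod_mono Metric.ball_subset_closedBall Metric.ball_subset_closedBall)
  have h2 : IntegrableOn (fun z : Plane × Plane => gradient F (z.1 - z.2) j)
      (Metric.ball 0 R ×ˢ (Metric.ball 0 R')ᶜ) (ν.prod ν) := by
    refine (hint.integrableOn (s := Metric.ball 0 R ×ˢ (Metric.ball 0 R')ᶜ)).congr_fun
      (fun z hz' => ?_) (measurableSet_ball.prod measurableSet_ball.compl)
    have e1 : χ z.1 = 1 := hχ1 _ (Metric.ball_subset_ball (le_max_left _ _) hz'.1)
    have e2 : χ z.2 = 0 := hz _ hz'.2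
    rw [gradient_coord]
    simp [symKernel, e1, e2, pd]
  have h3 := h1.union h2
  rwa [← Set.prod_union, Set.union_compl_self] at h3

/-- The `j`-th component of `∇F ∗ (σ ν)`. -/
def forceField (F : Plane → ℝ) (ν : Measure Plane) (σ : Plane → ℝ) (j : Fin 2) (x : Plane) : ℝ :=
  ∫ y, σ y * gradient F (x - y) j ∂ν

lemma PolarDecomp.integrableOn_forceField (h : PolarDecomp μ ν σ) {F : Plane → ℝ}
    (hF1 : ContDiff ℝ 1 F) (hF : ForceDefined F μ) (R : ℝ) (j : Fin 2) :
    IntegrableOn (forceField F ν σ j) (Metric.ball 0 R) ν := by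
  have := h.isFiniteMeasure
  have h1 := h.integrableOn_gradient_sub hF1 hF R j
  rw [IntegrableOn, ← Measure.prod_restrict, Measure.restrict_univ] at h1
  have hs : IsSign fun z : Plane × Plane => σ z.2 :=
    ⟨h.isSign.1.comp measurable_snd, fun z => h.isSign.2 z.2⟩
  exact (hs.integrable_smul h1).integral_prod_left

/-- The force acts as the integral of `∇F ∗ (σ ν)` against the test field. -/
lemma PolarDecomp.force_eq_integral_forceField (h : PolarDecomp μ ν σ) {F : Plane → ℝ}
    (hF1 : ContDiff ℝ 1 F) (he : ∀ x, F (-x) = F x) (hF : ForceDefined F μ) {φ : Plane → Plane}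
    (hφ : IsTest φ) :
    force F μ φ = (∫ x, σ x * forceField F ν σ 0 x * φ x 0 ∂ν) +
      ∫ x, σ x * forceField F ν σ 1 x * φ x 1 ∂ν := by
  have := h.isFiniteMeasure
  set A : Fin 2 → Plane × Plane → ℝ := fun j z =>
    σ z.1 * σ z.2 * (φ z.1 j * gradient F (z.1 - z.2) j) with hA
  have hAi : ∀ j, Integrable (A j) (ν.prod ν) := by
    intro j
    have ht := hφ.coord j
    obtain ⟨R, -, hR⟩ := tsupport_subset_ball ht.2
    obtain ⟨M, hM⟩ := ht.1.continuous.bounded_above_of_compact_support ht.2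
    refine h.isSign_prod.integrable_smul (f := fun z => φ z.1 j * gradient F (z.1 - z.2) j) ?_
    have h1 : IntegrableOn (fun z : Plane × Plane => φ z.1 j * gradient F (z.1 - z.2) j)
        (Metric.ball 0 R ×ˢ Set.univ) (ν.prod ν) :=
      (h.integrableOn_gradient_sub hF1 hF R j).bdd_mul (c := M)
        (ht.1.continuous.comp continuous_fst).aestronglyMeasurable (.of_forall fun z => hM z.1)
    refine (integrableOn_iff_integrable_of_support_subset fun z hz => ?_).1 h1
    have h0 : φ z.1 j ≠ 0 := fun h0 => hz (by simp [h0])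
    exact ⟨hR (subset_tsupport (fun x => φ x j) h0), trivial⟩
  have hval : ∀ j, ∫ z, A j z ∂ν.prod ν = ∫ x, σ x * forceField F ν σ j x * φ x j ∂ν := by
    intro j
    rw [integral_prod _ (hAi j)]
    congr 1; ext x
    rw [forceField, mul_right_comm, ← integral_const_mul]
    congr 1; ext y
    simp only [hA]; ring
  -- Since `∇F` is odd, the symmetrized kernel is an integrable function plus its reflection; this
  -- undoes the symmetrization and cancels the factor `1/2`.
  have hsym : ∀ z, σ z.1 * σ z.2 * symKernel (gradient F) φ z =
      (A 0 z + A 1 z) + (A 0 z.swap + A 1 z.swap) := by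
    intro z
    simp only [hA, symKernel, Prod.fst_swap, Prod.snd_swap]
    rw [← neg_sub z.1 z.2, gradient_neg_of_even hF1 he, inner_eq_coord]
    simp only [PiLp.sub_apply, PiLp.neg_apply]
    ring
  have hAs : Integrable (fun z => A 0 z + A 1 z) (ν.prod ν) := (hAi 0).add (hAi 1)
  have hAs' : Integrable (fun z : Plane × Plane => A 0 z.swap + A 1 z.swap) (ν.prod ν) := hAs.swap
  rw [h.force_eq hF hφ]
  simp only [hsym]
  rw [integral_add hAs hAs', integral_prod_swap fun z => A 0 z + A 1 z,
    integral_add (hAi 0) (hAi 1), hval, hval]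
  ring

/-- The density of the force `(∇F)_μ + μ ∇V` with respect to `ν`. -/
def forceDensity (F V : Plane → ℝ) (ν : Measure Plane) (σ : Plane → ℝ) (i : Fin 2) (x : Plane) : ℝ :=
  σ x * (forceField F ν σ i x + gradient V x i)

/-- A tensor field whose divergence is a multiple of the force. -/
def remainder (F V : Plane → ℝ) (ν : Measure Plane) (σ : Plane → ℝ) (x : Plane) :
    Matrix (Fin 2) (Fin 2) ℝ :=
  fun i j => 4 * halfField ν (forceDensity F V ν σ i) j x

lemma PolarDecomp.integrableOn_forceDensity (h : PolarDecomp μ ν σ) {F V : Plane → ℝ}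
    (hF1 : ContDiff ℝ 1 F) (hF : ForceDefined F μ) (hV : ContDiff ℝ 1 V) (i : Fin 2) (R : ℝ) :
    IntegrableOn (forceDensity F V ν σ i) (Metric.ball 0 R) ν := by
  have := h.isFiniteMeasure
  have hc : Continuous fun x => gradient V x i :=
    (EuclideanSpace.proj (𝕜 := ℝ) i).continuous.comp (continuous_gradient hV)
  have h1 : IntegrableOn (fun x => gradient V x i) (Metric.ball 0 R) ν :=
    (hc.continuousOn.integrableOn_compact (isCompact_closedBall 0 R)).mono_set
      Metric.ball_subset_closedBall
  exact h.isSign.integrable_smul ((h.integrableOn_forceField hF1 hF R i).add h1)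

lemma PolarDecomp.locallyIntegrable_remainder (h : PolarDecomp μ ν σ) {F V : Plane → ℝ}
    (hF1 : ContDiff ℝ 1 F) (hF : ForceDefined F μ) (hV : ContDiff ℝ 1 V) (i j : Fin 2) :
    LocallyIntegrable fun x => remainder F V ν σ x i j :=
  have := h.isFiniteMeasure
  (locallyIntegrable_halfField (h.integrableOn_forceDensity hF1 hF hV i) j).smul (4 : ℝ)

lemma integrable_mul_of_isTest {β ψ : Plane → ℝ}
    (hβ : ∀ R : ℝ, IntegrableOn β (Metric.ball 0 R) ν) (hψ : IsTest ψ) :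
    Integrable (fun x => β x * ψ x) ν := by
  obtain ⟨R, -, hR⟩ := tsupport_subset_ball hψ.2
  obtain ⟨M, hM⟩ := hψ.1.continuous.bounded_above_of_compact_support hψ.2
  have h1 : IntegrableOn (fun x => β x * ψ x) (Metric.ball 0 R) ν :=
    (hβ R).mul_bdd (c := M) hψ.1.continuous.aestronglyMeasurable (.of_forall hM)
  refine (integrableOn_iff_integrable_of_support_subset fun z hz => ?_).1 h1
  have h0 : ψ z ≠ 0 := fun h0 => hz (by simp [h0])
  exact hR (subset_tsupport _ h0)

lemma PolarDecomp.hasDiv_remainder (h : PolarDecomp μ ν σ) {F V : Plane → ℝ}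
    (hF1 : ContDiff ℝ 1 F) (he : ∀ x, F (-x) = F x) (hF : ForceDefined F μ) (hV : ContDiff ℝ 1 V) :
    HasDiv (remainder F V ν σ) fun φ => -2 * cd * (force F μ φ + potentialForce V μ φ) := by
  intro φ hφ
  have := h.isFiniteMeasure
  have hβ := fun i => h.integrableOn_forceDensity hF1 hF hV i
  have hi : ∀ i j, Integrable fun x => pd j (fun x => φ x i) x * remainder F V ν σ x i j := by
    intro i j
    have ht := (hφ.coord i).pderiv j
    simpa only [mul_comm] using (h.locallyIntegrable_remainder hF1 hF hV i j).integrable_mul_test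
      ht.1.continuous ht.2
  have hij : ∀ i j, ∫ x, pd j (fun x => φ x i) x * remainder F V ν σ x i j =
      4 * ∫ x, pd j (fun x => φ x i) x * halfField ν (forceDensity F V ν σ i) j x := by
    intro i j
    rw [← integral_const_mul]
    congr 1; ext x
    simp only [remainder]; ring
  have hdiv := fun i => integral_halfField_div (hβ i) (contDiff_infty.1 (hφ.coord i).1 1)
    (hφ.coord i).2
  have hsplit : ∀ i, ∫ y, forceDensity F V ν σ i y * φ y i ∂ν =
      (∫ x, σ x * forceField F ν σ i x * φ x i ∂ν) + ∫ x, σ x * gradient V x i * φ x i ∂ν := by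
    intro i
    have hc : Continuous fun x => gradient V x i :=
      (EuclideanSpace.proj (𝕜 := ℝ) i).continuous.comp (continuous_gradient hV)
    have j1 : Integrable (fun x => σ x * forceField F ν σ i x * φ x i) ν :=
      integrable_mul_of_isTest (fun R => h.isSign.integrable_smul
        (h.integrableOn_forceField hF1 hF R i)) (hφ.coord i)
    have j2 : Integrable (fun x => σ x * gradient V x i * φ x i) ν :=
      integrable_mul_of_isTest (fun R => h.isSign.integrable_smul
        ((hc.continuousOn.integrableOn_compact (isCompact_closedBall 0 R)).mono_set
          Metric.ball_subset_closedBall)) (hφ.coord i)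
    rw [← integral_add j1 j2]
    congr 1; ext x
    simp only [forceDensity]; ring
  have hpot : potentialForce V μ φ = (∫ x, σ x * gradient V x 0 * φ x 0 ∂ν) +
      ∫ x, σ x * gradient V x 1 * φ x 1 ∂ν := by
    have hc : ∀ i, Continuous fun x => gradient V x i := fun i =>
      (EuclideanSpace.proj (𝕜 := ℝ) i).continuous.comp (continuous_gradient hV)
    have j2 : ∀ i, Integrable (fun x => σ x * gradient V x i * φ x i) ν := fun i =>
      integrable_mul_of_isTest (fun R => h.isSign.integrable_smul
        (((hc i).continuousOn.integrableOn_compact (isCompact_closedBall 0 R)).mono_set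
          Metric.ball_subset_closedBall)) (hφ.coord i)
    rw [h.potentialForce_eq hV hφ, ← integral_add (j2 0) (j2 1)]
    congr 1; ext x
    rw [inner_eq_coord]; ring
  simp only [frob_eq, jac_eq_pd hφ]
  have s0 : Integrable fun x => pd 0 (fun x => φ x 0) x * remainder F V ν σ x 0 0 +
    pd 1 (fun x => φ x 0) x * remainder F V ν σ x 0 1 := (hi 0 0).add (hi 0 1)
  have s1 : Integrable fun x => pd 0 (fun x => φ x 1) x * remainder F V ν σ x 1 0 +
    pd 1 (fun x => φ x 1) x * remainder F V ν σ x 1 1 := (hi 1 0).add (hi 1 1)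
  -- The half-plane kernel contributes `π`, so the factor `4` in `remainder` yields `4π = 2 c_d`.
  rw [integral_add s0 s1, integral_add (hi 0 0) (hi 0 1), integral_add (hi 1 0) (hi 1 1),
    hij, hij, hij, hij, ← mul_add, ← mul_add, hdiv, hdiv, hsplit, hsplit,
    h.force_eq_integral_forceField hF1 he hF hφ, hpot, cd]
  ring

lemma memLpLoc_one_of_locallyIntegrable {f : Plane → ℝ} (hf : LocallyIntegrable f) :
    MemLpLoc f 1 := fun _ hK => memLp_one_iff_integrable.2 (hf.integrableOn_isCompact hK)

lemma MemHNegOneLoc.locallyIntegrable_stress (hμ : MemHNegOneLoc μ) (i j : Fin 2) :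
    LocallyIntegrable fun x => stress (gradGConv μ) x i j := by
  obtain ⟨ν, σ, h⟩ := exists_polarDecomp μ
  rw [h.gradGConv_eq]
  refine locallyIntegrable_of_ball fun R => IntegrableOn.mono_set (t := Metric.ball 0 (max R 1)) ?_
    (Metric.ball_subset_ball (le_max_left _ _))
  have hR : 0 < max R 1 := by positivity
  have hL := fun j => hμ.memLp_field_coord h hR j
  have h1 : IntegrableOn (fun x => field ν σ x i * field ν σ x j) (Metric.ball 0 (max R 1)) :=
    (hL i).integrable_mul (hL j)
  have h2 : IntegrableOn (fun x => ‖field ν σ x‖ ^ 2) (Metric.ball 0 (max R 1)) :=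
    (hμ.memLp_field h hR).norm.integrable_sq
  simp only [stress, mul_assoc]
  exact (h1.const_mul 2).sub (h2.mul_const _)

lemma MemHNegOneLoc.velocityCritical_of_vorticityCritical (hμ : MemHNegOneLoc μ)
    {F V : Plane → ℝ} (hF1 : ContDiff ℝ 1 F) (he : ∀ x, F (-x) = F x) (hV : ContDiff ℝ 1 V)
    (hF : ForceDefined F μ) (hv : VorticityCritical F V μ) : VelocityCritical F V μ := by
  obtain ⟨ν, σ, h⟩ := exists_polarDecomp μ
  have hR := h.locallyIntegrable_remainder hF1 hF hV
  have hdiv := h.hasDiv_remainder hF1 he hF hV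
  have h0 := (hμ.hasDiv_stress_add_iff h hR hdiv).2 ((hμ.vorticityCritical_iff h V hF).1 hv)
  -- The exponent is `p = 1`: local integrability is all that the construction of the remainder
  -- provides.
  exact ⟨remainder F V ν σ, ⟨⟨1, le_rfl, by norm_num, fun i j =>
    memLpLoc_one_of_locallyIntegrable (hR i j)⟩, hdiv⟩,
    divFreeFinitePart_row (fun i j => (hμ.locallyIntegrable_stress i j).add (hR i j)) h0,
    hμ.memLpLoc_gradGConv, h0⟩

end

end Coulomb2D

end

theorem proposition6p4 (μ : SignedMeasure Coulomb2D.Plane) (hμ : Coulomb2D.MemHNegOneLoc μ) :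
    -- the constant: `-Δg = c_d δ_0` in the sense of distributions
    (∀ ψ : Coulomb2D.Plane → ℝ, Coulomb2D.IsTest ψ →
      Integrable (fun x => Coulomb2D.g x * Laplacian.laplacian ψ x) ∧
      -∫ x, Coulomb2D.g x * Laplacian.laplacian ψ x = Coulomb2D.cd * ψ 0) ∧
    -- `∇g ∗ μ` is defined almost everywhere and locally square integrable
    (∀ᵐ x : Coulomb2D.Plane, μ.Integrable (fun y => Coulomb2D.gradG (x - y))) ∧
    Coulomb2D.MemLpLoc (Coulomb2D.gradGConv μ) 2 ∧
    -- the identity, with absolutely convergent integrals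
    (∀ φ : Coulomb2D.Plane → Coulomb2D.Plane, Coulomb2D.IsTest φ →
      (Coulomb2D.tensorSq μ).Integrable (Coulomb2D.symKernel Coulomb2D.gradG φ) ∧
      Integrable (fun x =>
        Coulomb2D.frob (Coulomb2D.jac φ x) (Coulomb2D.stress (Coulomb2D.gradGConv μ) x)) ∧
      ∫ᵛ z, Coulomb2D.symKernel Coulomb2D.gradG φ z ∂•(Coulomb2D.tensorSq μ) =
        (1 / Coulomb2D.cd) *
          ∫ x, Coulomb2D.frob (Coulomb2D.jac φ x)
            (Coulomb2D.stress (Coulomb2D.gradGConv μ) x)) ∧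
    -- the two criticality conditions are equivalent
    (∀ F V : Coulomb2D.Plane → ℝ, ContDiff ℝ 1 F → (∀ x, F (-x) = F x) → ContDiff ℝ 1 V →
      Coulomb2D.ForceDefined F μ →
      (Coulomb2D.VelocityCritical F V μ ↔ Coulomb2D.VorticityCritical F V μ)) := by
  obtain ⟨ν, σ, h⟩ := Coulomb2D.exists_polarDecomp μ
  have := h.isFiniteMeasure
  refine ⟨fun ψ hψ => Coulomb2D.laplacian_g hψ, ?_, hμ.memLpLoc_gradGConv, fun φ hφ => ?_,
    fun F V hF1 he hV hF => ⟨hμ.vorticityCritical_of_velocityCritical hF,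
      hμ.velocityCritical_of_vorticityCritical hF1 he hV hF⟩⟩
  · filter_upwards [Coulomb2D.ae_integrable_gradG ν] with x hx
    rwa [VectorMeasure.Integrable, h.variation_eq]
  · have hi := Coulomb2D.integrable_symKernel_gradG (ν := ν) hφ
    have hid := hμ.integral_frob_field h hφ
    refine ⟨by rwa [VectorMeasure.Integrable, h.tensorSq_variation], ?_, ?_⟩
    · rw [h.gradGConv_eq]; exact hid.1
    · rw [h.tensorSq_integral hi, h.gradGConv_eq, hid.2, ← mul_assoc, one_div,
        inv_mul_cancel₀ (by unfold Coulomb2D.cd; positivity), one_mul]
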